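/- Let $I$ be a set and $\cdot$ a symmetric bilinear form on $\mathbb Z[I]$ with $i\cdot i\in\{2,4,6,\dots\}$ for all $i\in I$ and $a_{ij}=\frac{2\,i\cdot j}{i\cdot i}\in\{0,-1,-2,\dots\}$ for $i\neq j$ (a Cartan datum). Let $Y,X$ be finitely generated free abelian groups with a perfect pairing $\langle\ ,\ \rangle:Y\times X\to\mathbb Z$ and injections $I\hookrightarrow Y$, $i\mapsto i$, and $I\hookrightarrow X$, $i\mapsto i'$, such that $\langle i,j'\rangle=a_{ij}$ (a root datum). Let $k$ be a field and $0\neq q\in k$ with $q^{i\cdot i}\neq1$ for all $i$ (for example $k=\mathbb Q(q)$). Put $q_i=q^{i\cdot i/2}$. Let $H=kY$ with basis $K_\mu$ ($\mu\in Y$), and $A=k\mathbb Z[I]$ with group-like generators $g_i^{\pm1}$. With $\langle K_\mu,g_i\rangle=q^{\langle\mu,i'\rangle}$, $\mathcal R(g_i)=K_i^{i\cdot i/2}$ and $\bar{\mathcal R}(g_i)=K_i^{-i\cdot i/2}$, $(H,A)$ is a weakly quasitriangular dual pair (a Hopf algebra duality pairing and convolution-invertible algebra and anti-coalgebra maps $\mathcal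 R,\bar{\mathcal R}:A\to H$ with $\langle\bar{\mathcal R}(a),b\rangle=\langle\mathcal R^{-1}(b),a\rangle$ and $h_{(1)}\langle h_{(2)},\,\cdot\,\rangle=\mathcal R*\langle h_{(1)},\,\cdot\,\rangle h_{(2)}*\mathcal R^{-1}$, and the same with $\bar{\mathcal R}$ for $\mathcal R$). Give the free algebra on symbols $e^i$ the braided coproduct in which the $e^i$ are primitive, multiplicative for the braided tensor product with $(1\otimes e^i)(e^j\otimes1)=q^{i\cdot j}e^j\otimes e^i$, and likewise for the free algebra on symbols $f_i$; let $\langle f_i,e^j\rangle=\delta_i^j(q_i-q_i^{-1})^{-1}$, extended by $\langle xy,b\rangle=\langle x\otimes y,\underline\Delta b\rangle$ and $\langle 1,b\rangle=\underline\epsilon(b)$. Let $B$, $D$ be the quotients of the free algebras on the $e^i$, resp. the $f_i$, by the radical of this pairing. Let Lusztig's algebra $\mathbf f$ be the quotient of the free algebra on symbols $\theta_i$ by the radical of the form defined in the same way with $(\theta_i,\theta_j)=\delta_{ij}(1-q_i^{-2})^{-1}$. Then $\mathbf f\cong B$ by $\theta_i\mapsto e^i$ and $\mathbf f\cong D$ by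 $\theta_i\mapsto f_i$. Moreover $B$ is a braided group in left $A$-comodules by $e^i\mapsto g_i\otimes e^i$, $D$ is a braided group with invertible braided antipode in right $A$-comodules by $f_i\mapsto f_i\otimes g_i$, the generators being braided-primitive, and $\langle\ ,\ \rangle$ descends to a nondegenerate covariant duality pairing of $D$ with $B$. Let $\bar C=D^{\underline{\rm cop}}$ be the algebra $D$ with coproduct $\bar\Delta=\Psi^{-1}\circ\underline\Delta$, $\bar\Delta c=c_{(\bar1)}\otimes c_{(\bar2)}$, and antipode $\bar S=\underline S^{-1}$. Write coactions as $c\mapsto c^{(\bar1)}\otimes c^{(\bar2)}\in D\otimes A$ and $b\mapsto b^{(\bar1)}\otimes b^{(\bar2)}\in A\otimes B$, and $h\triangleright c=c^{(\bar1)}\langle h,c^{(\bar2)}\rangle$, $b\triangleleft h=\langle h,b^{(\bar1)}\rangle b^{(\bar2)}$ for the induced actions of $H$. Then the double-bosonisation $U=U(\bar C,H,B)$, that is the vector space $\bar C\otimes H\otimes B$ with unit $1\otimes1\otimes1$, counit $\epsilon\otimes\epsilon\otimes\epsilon$, product $$(c\otimes h\otimes b)(d\otimes g\otimes a)=\sum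 c\,(h_{(1)}\triangleright d_s)\otimes h_{(2)}r_s\,g_{(1)}\otimes(b_s\triangleleft g_{(2)})\,a,$$ $$\sum d_s\otimes r_s\otimes b_s=\big(\mathcal R(d_{(\bar1)}{}^{(\bar2)})\triangleright d_{(\bar2)}\big)\otimes\mathcal R(b_{(1)}{}^{(\bar1)})\,\bar{\mathcal R}\big((\bar Sd_{(\bar3)})^{(\bar2)}\big)\otimes\big(b_{(2)}\triangleleft\bar{\mathcal R}(b_{(3)}{}^{(\bar1)})\big)\ \langle d_{(\bar1)}{}^{(\bar1)},b_{(1)}{}^{(\bar2)}\rangle\,\langle(\bar Sd_{(\bar3)})^{(\bar1)},b_{(3)}{}^{(\bar2)}\rangle$$ and coproduct $$\Delta(c\otimes h\otimes b)=\big(c_{(\bar1)}\otimes\bar{\mathcal R}(c_{(\bar2)}{}^{(\bar2)})h_{(1)}\otimes b_{(1)}{}^{(\bar2)}\big)\otimes\big(c_{(\bar2)}{}^{(\bar1)}\otimes h_{(2)}\mathcal R(b_{(1)}{}^{(\bar1)})\otimes b_{(2)}\big),$$ is a Hopf algebra. Writing $e^i,f_i,K_\mu$ for the images of the generators in $U$,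 one has $K_0=1$, $K_\mu K_\nu=K_{\mu+\nu}$, $$e^iK_\mu=q^{\langle\mu,i'\rangle}K_\mu e^i,\qquad K_\mu f_i=q^{\langle\mu,i'\rangle}f_iK_\mu,\qquad [e^i,f_j]=\delta^i_j\,\frac{K_i^{i\cdot i/2}-K_i^{-i\cdot i/2}}{q_i-q_i^{-1}},$$ $$\Delta e^i=e^i\otimes K_i^{i\cdot i/2}+1\otimes e^i,\qquad \Delta f_i=f_i\otimes1+K_i^{-i\cdot i/2}\otimes f_i,\qquad \Delta K_\mu=K_\mu\otimes K_\mu,$$ $\epsilon(e^i)=\epsilon(f_i)=0$ and $\epsilon(K_\mu)=1$. Finally let $U_q(\mathfrak g)$ be Lusztig's algebra, generated by $E_i,F_i$ ($i\in I$) and $K_\mu$ ($\mu\in Y$) with relations $K_0=1$, $K_\mu K_\nu=K_{\mu+\nu}$, $K_\mu E_i=q^{\langle\mu,i'\rangle}E_iK_\mu$, $K_\mu F_i=q^{-\langle\mu,i'\rangle}F_iK_\mu$, $[E_i,F_j]=\delta_{ij}\frac{K_i^{i\cdot i/2}-K_i^{-i\cdot i/2}}{q_i-q_i^{-1}}$,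 and $x(E)=0=x(F)$ for every $x=x(\theta)$ in the radical of the form defining $\mathbf f$. Then there is an algebra isomorphism $U_q(\mathfrak g)\cong U(\bar C,H,B)$ with $E_i\mapsto-e^i$, $F_i\mapsto f_i$, $K_\mu\mapsto K_{-\mu}$; it carries the coproduct of $U$ to the (right-handed) coproduct on $U_q(\mathfrak g)$ with $\Delta E_i=E_i\otimes K_i^{-i\cdot i/2}+1\otimes E_i$, $\Delta F_i=F_i\otimes1+K_i^{i\cdot i/2}\otimes F_i$, $\Delta K_\mu=K_\mu\otimes K_\mu$. -/

import Mathlib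

open scoped TensorProduct

universe u v w x

noncomputable section

namespace DoubleBoson

/-! ## Smash products and convolution -/

section General

variable {k : Type*} [Field k]

/-- For algebras `X`, `Y` and a map `σ : Y ⊗ X → X ⊗ Y`, the product
`(x ⊗ y)(x' ⊗ y') = x σ(y ⊗ x') y'` on `X ⊗ Y`, the output of `σ` being multiplied by `x` from the
left and by `y'` from the right. Both the braided tensor product algebra (`σ` the braiding) and the
smash products with `H` have this form. -/
def crossMul {X Y : Type*} [Ring X] [Algebra k X] [Ring Y] [Algebra k Y]
    (σ : Y ⊗[k] X →ₗ[k] X ⊗[k] Y) : (X ⊗[k] Y) ⊗[k] (X ⊗[k] Y) →ₗ[k] X ⊗[k] Y :=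
  TensorProduct.map (LinearMap.mul' k X) (LinearMap.mul' k Y)
    ∘ₗ (TensorProduct.assoc k X X (Y ⊗[k] Y)).symm.toLinearMap
    ∘ₗ LinearMap.lTensor X
        ((TensorProduct.assoc k X Y Y).toLinearMap
          ∘ₗ LinearMap.rTensor Y σ
          ∘ₗ (TensorProduct.assoc k Y X Y).symm.toLinearMap)
    ∘ₗ (TensorProduct.assoc k X Y (X ⊗[k] Y)).toLinearMap

/-- The convolution product `(f * g)(a) = f(a₁) g(a₂)` of linear maps `A → H`. -/
def conv {A H : Type*} [Ring A] [HopfAlgebra k A] [Ring H] [HopfAlgebra k H]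
    (f g : A →ₗ[k] H) : A →ₗ[k] H :=
  LinearMap.mul' k H ∘ₗ TensorProduct.map f g ∘ₗ Coalgebra.comul

/-- The unit `a ↦ ε(a) 1` of the convolution product. -/
def convOne {A H : Type*} [Ring A] [HopfAlgebra k A] [Ring H] [HopfAlgebra k H] : A →ₗ[k] H :=
  Algebra.linearMap k H ∘ₗ Coalgebra.counit

/-- `(∂ᴸ h)(a) = ⟨h₁, a⟩ h₂`. -/
def diffL {A H : Type*} [Ring A] [HopfAlgebra k A] [Ring H] [HopfAlgebra k H]
    (pair : H →ₗ[k] A →ₗ[k] k) (h : H) : A →ₗ[k] H :=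
  (TensorProduct.lid k H).toLinearMap
    ∘ₗ (LinearMap.rTensorHom H ∘ₗ pair.flip).flip (Coalgebra.comul h)

/-- `(∂ᴿ h)(a) = h₁ ⟨h₂, a⟩`. -/
def diffR {A H : Type*} [Ring A] [HopfAlgebra k A] [Ring H] [HopfAlgebra k H]
    (pair : H →ₗ[k] A →ₗ[k] k) (h : H) : A →ₗ[k] H :=
  (TensorProduct.rid k H).toLinearMap
    ∘ₗ (LinearMap.lTensorHom H ∘ₗ pair.flip).flip (Coalgebra.comul h)

/-- A weakly quasitriangular dual pair of Hopf algebras `(H, A)`: a Hopf algebra duality pairing and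
two convolution-invertible algebra and anti-coalgebra maps `R, Rbar : A → H`. -/
structure WeaklyQuasitriangular (k H A : Type*) [Field k] [Ring H] [HopfAlgebra k H]
    [Ring A] [HopfAlgebra k A] where
  pair : H →ₗ[k] A →ₗ[k] k
  pair_one_left : ∀ a, pair 1 a = Coalgebra.counit (R := k) a
  pair_one_right : ∀ h, pair h 1 = Coalgebra.counit (R := k) h
  pair_mul_left : ∀ g h a, pair (g * h) a =
    LinearMap.mul' k k (TensorProduct.map (pair g) (pair h) (Coalgebra.comul a))
  pair_mul_right : ∀ h a b, pair h (a * b) =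
    LinearMap.mul' k k (TensorProduct.map (pair.flip a) (pair.flip b) (Coalgebra.comul h))
  R : A →ₐ[k] H
  Rbar : A →ₐ[k] H
  R_counit : ∀ a, Coalgebra.counit (R := k) (R a) = Coalgebra.counit (R := k) a
  Rbar_counit : ∀ a, Coalgebra.counit (R := k) (Rbar a) = Coalgebra.counit (R := k) a
  R_comul : ∀ a, Coalgebra.comul (R := k) (R a) =
    TensorProduct.map R.toLinearMap R.toLinearMap
      (TensorProduct.comm k A A (Coalgebra.comul a))
  Rbar_comul : ∀ a, Coalgebra.comul (R := k) (Rbar a) =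
    TensorProduct.map Rbar.toLinearMap Rbar.toLinearMap
      (TensorProduct.comm k A A (Coalgebra.comul a))
  /-- the convolution inverse of `R` -/
  Rinv : A →ₗ[k] H
  /-- the convolution inverse of `Rbar` -/
  Rbarinv : A →ₗ[k] H
  R_conv_Rinv : conv R.toLinearMap Rinv = convOne
  Rinv_conv_R : conv Rinv R.toLinearMap = convOne
  Rbar_conv_Rbarinv : conv Rbar.toLinearMap Rbarinv = convOne
  Rbarinv_conv_Rbar : conv Rbarinv Rbar.toLinearMap = convOne
  pair_Rbar : ∀ a b, pair (Rbar a) b = pair (Rinv b) a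
  diff_R : ∀ h, diffR pair h = conv (conv R.toLinearMap (diffL pair h)) Rinv
  diff_Rbar : ∀ h, diffR pair h = conv (conv Rbar.toLinearMap (diffL pair h)) Rbarinv

/-- The algebraic axioms of a Hopf algebra in a braided category, on an algebra `V` with
self-braiding `Ψ`: the coproduct is multiplicative for the braided tensor product algebra. -/
structure BraidedHopf (k V : Type*) [Field k] [Ring V] [Algebra k V]
    (Ψ : V ⊗[k] V →ₗ[k] V ⊗[k] V) where
  comul : V →ₗ[k] V ⊗[k] V
  counit : V →ₐ[k] k
  antipode : V →ₗ[k] V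
  coassoc : (TensorProduct.assoc k V V V).toLinearMap ∘ₗ LinearMap.rTensor V comul ∘ₗ comul =
    LinearMap.lTensor V comul ∘ₗ comul
  counit_left : (TensorProduct.lid k V).toLinearMap
    ∘ₗ LinearMap.rTensor V counit.toLinearMap ∘ₗ comul = LinearMap.id
  counit_right : (TensorProduct.rid k V).toLinearMap
    ∘ₗ LinearMap.lTensor V counit.toLinearMap ∘ₗ comul = LinearMap.id
  comul_one : comul 1 = 1 ⊗ₜ 1
  comul_mul : ∀ a b, comul (a * b) = crossMul Ψ (comul a ⊗ₜ comul b)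
  antipode_left : LinearMap.mul' k V ∘ₗ LinearMap.rTensor V antipode ∘ₗ comul =
    Algebra.linearMap k V ∘ₗ counit.toLinearMap
  antipode_right : LinearMap.mul' k V ∘ₗ LinearMap.lTensor V antipode ∘ₗ comul =
    Algebra.linearMap k V ∘ₗ counit.toLinearMap

end General

/-! ## Actions and braidings induced by coactions -/

section Comodules

variable {k H A : Type*} [Field k] [Ring H] [HopfAlgebra k H] [Ring A] [HopfAlgebra k A]
  (W : WeaklyQuasitriangular k H A)

section Left

variable {B : Type*} [AddCommGroup B] [Module k B] (ρ : B →ₗ[k] A ⊗[k] B)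

/-- The right action `b ◁ h = ⟨h, b⁽¹⁾⟩ b⁽²⁾` of `H` on a left `A`-comodule
with coaction `ρ b = b⁽¹⁾ ⊗ b⁽²⁾`. -/
def rightAct : B ⊗[k] H →ₗ[k] B :=
  (TensorProduct.lid k B).toLinearMap
    ∘ₗ LinearMap.rTensor B (TensorProduct.lift W.pair)
    ∘ₗ (TensorProduct.assoc k H A B).symm.toLinearMap
    ∘ₗ LinearMap.lTensor H ρ
    ∘ₗ (TensorProduct.comm k B H).toLinearMap

/-- `v ⊗ w ↦ v ◁ S(w⁽¹⁾) ⊗ w⁽²⁾`, for a linear map `S : A → H`. -/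
def twistL (S : A →ₗ[k] H) : B ⊗[k] B →ₗ[k] B ⊗[k] B :=
  LinearMap.rTensor B (rightAct W ρ)
    ∘ₗ (TensorProduct.assoc k B H B).symm.toLinearMap
    ∘ₗ LinearMap.lTensor B (LinearMap.rTensor B S ∘ₗ ρ)

/-- The braiding `Ψ(v ⊗ w) = w⁽²⁾ ⊗ v ◁ R(w⁽¹⁾)` of left `A`-comodules. -/
def braidL : B ⊗[k] B →ₗ[k] B ⊗[k] B :=
  (TensorProduct.comm k B B).toLinearMap ∘ₗ twistL W ρ W.R.toLinearMap

/-- The map `b ⊗ h ↦ h₁ ⊗ (b ◁ h₂)` which reorders `B ⊗ H`. -/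
def crossBH : B ⊗[k] H →ₗ[k] H ⊗[k] B :=
  LinearMap.lTensor H (rightAct W ρ)
    ∘ₗ (TensorProduct.leftComm k B H H).toLinearMap
    ∘ₗ LinearMap.lTensor B Coalgebra.comul

end Left

section Right

variable {D : Type*} [AddCommGroup D] [Module k D] (ρ : D →ₗ[k] D ⊗[k] A)

/-- The left action `h ▷ c = c⁽¹⁾ ⟨h, c⁽²⁾⟩` of `H` on a right `A`-comodule
with coaction `ρ c = c⁽¹⁾ ⊗ c⁽²⁾`. -/
def leftAct : H ⊗[k] D →ₗ[k] D :=
  (TensorProduct.rid k D).toLinearMap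
    ∘ₗ LinearMap.lTensor D (TensorProduct.lift W.pair.flip)
    ∘ₗ (TensorProduct.assoc k D A H).toLinearMap
    ∘ₗ LinearMap.rTensor H ρ
    ∘ₗ (TensorProduct.comm k H D).toLinearMap

/-- `v ⊗ w ↦ v⁽¹⁾ ⊗ S(v⁽²⁾) ▷ w`, for a linear map `S : A → H`. -/
def twistR (S : A →ₗ[k] H) : D ⊗[k] D →ₗ[k] D ⊗[k] D :=
  LinearMap.lTensor D (leftAct W ρ)
    ∘ₗ (TensorProduct.assoc k D H D).toLinearMap
    ∘ₗ LinearMap.rTensor D (LinearMap.lTensor D S ∘ₗ ρ)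

/-- The braiding `Ψ(v ⊗ w) = R(v⁽²⁾) ▷ w ⊗ v⁽¹⁾` of right `A`-comodules. -/
def braidR : D ⊗[k] D →ₗ[k] D ⊗[k] D :=
  (TensorProduct.comm k D D).toLinearMap ∘ₗ twistR W ρ W.R.toLinearMap

/-- The inverse braiding `Ψ⁻¹(w ⊗ v) = v⁽¹⁾ ⊗ R⁻¹(v⁽²⁾) ▷ w` of right `A`-comodules. -/
def braidRInv : D ⊗[k] D →ₗ[k] D ⊗[k] D :=
  twistR W ρ W.Rinv ∘ₗ (TensorProduct.comm k D D).toLinearMap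

/-- The map `h ⊗ c ↦ (h₁ ▷ c) ⊗ h₂` which reorders `H ⊗ D`. -/
def crossHD : H ⊗[k] D →ₗ[k] D ⊗[k] H :=
  LinearMap.rTensor H (leftAct W ρ)
    ∘ₗ (TensorProduct.rightComm k H H D).toLinearMap
    ∘ₗ LinearMap.rTensor D Coalgebra.comul

end Right

/-- A braided group (Hopf algebra) in the braided category of left `A`-comodules: a left
`A`-comodule algebra with a braided Hopf structure whose structure maps are comodule maps. -/
structure LeftBraidedGroup (B : Type*) [Ring B] [Algebra k B] where
  coact : B →ₐ[k] A ⊗[k] B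
  coact_coassoc : (TensorProduct.assoc k A A B).toLinearMap
      ∘ₗ LinearMap.rTensor B Coalgebra.comul ∘ₗ coact.toLinearMap =
    LinearMap.lTensor A coact.toLinearMap ∘ₗ coact.toLinearMap
  coact_counit : (TensorProduct.lid k B).toLinearMap
      ∘ₗ LinearMap.rTensor B Coalgebra.counit ∘ₗ coact.toLinearMap = LinearMap.id
  hopf : BraidedHopf k B (braidL W coact.toLinearMap)
  comul_covariant : LinearMap.rTensor (B ⊗[k] B) (LinearMap.mul' k A)
      ∘ₗ (TensorProduct.tensorTensorTensorComm k A B A B).toLinearMap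
      ∘ₗ TensorProduct.map coact.toLinearMap coact.toLinearMap ∘ₗ hopf.comul =
    LinearMap.lTensor A hopf.comul ∘ₗ coact.toLinearMap
  counit_covariant : ∀ b, LinearMap.lTensor A hopf.counit.toLinearMap (coact b) =
    1 ⊗ₜ hopf.counit b
  antipode_covariant : coact.toLinearMap ∘ₗ hopf.antipode =
    LinearMap.lTensor A hopf.antipode ∘ₗ coact.toLinearMap

/-- A braided group (Hopf algebra) in the braided category of right `A`-comodules. -/
structure RightBraidedGroup (D : Type*) [Ring D] [Algebra k D] where
  coact : D →ₐ[k] D ⊗[k] A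
  coact_coassoc : (TensorProduct.assoc k D A A).toLinearMap
      ∘ₗ LinearMap.rTensor A coact.toLinearMap ∘ₗ coact.toLinearMap =
    LinearMap.lTensor D Coalgebra.comul ∘ₗ coact.toLinearMap
  coact_counit : (TensorProduct.rid k D).toLinearMap
      ∘ₗ LinearMap.lTensor D Coalgebra.counit ∘ₗ coact.toLinearMap = LinearMap.id
  hopf : BraidedHopf k D (braidR W coact.toLinearMap)
  comul_covariant : LinearMap.lTensor (D ⊗[k] D) (LinearMap.mul' k A)
      ∘ₗ (TensorProduct.tensorTensorTensorComm k D A D A).toLinearMap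
      ∘ₗ TensorProduct.map coact.toLinearMap coact.toLinearMap ∘ₗ hopf.comul =
    LinearMap.rTensor A hopf.comul ∘ₗ coact.toLinearMap
  counit_covariant : ∀ c, LinearMap.rTensor A hopf.counit.toLinearMap (coact c) =
    hopf.counit c ⊗ₜ 1
  antipode_covariant : coact.toLinearMap ∘ₗ hopf.antipode =
    LinearMap.rTensor A hopf.antipode ∘ₗ coact.toLinearMap

end Comodules

/-! ## The double-bosonisation `U(C̄, H, B)` -/

/-- The data from which the double-bosonisation is built: a weakly quasitriangular dual pair
`(H, A)`, a braided group `B` in left `A`-comodules, a braided group `D` with invertible braided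
antipode in right `A`-comodules, and a covariant (ordinary) duality pairing `ev` of `D` with `B`. -/
structure DoubleInput (k H A D B : Type*) [Field k] [Ring H] [HopfAlgebra k H]
    [Ring A] [HopfAlgebra k A] [Ring D] [Algebra k D] [Ring B] [Algebra k B] where
  W : WeaklyQuasitriangular k H A
  bg : LeftBraidedGroup W B
  dg : RightBraidedGroup W D
  /-- the inverse of the braided antipode of `D` -/
  antipodeInv : D →ₗ[k] D
  antipodeInv_comp : antipodeInv ∘ₗ dg.hopf.antipode = LinearMap.id
  comp_antipodeInv : dg.hopf.antipode ∘ₗ antipodeInv = LinearMap.id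
  ev : D →ₗ[k] B →ₗ[k] k
  ev_one_left : ∀ b, ev 1 b = bg.hopf.counit b
  ev_one_right : ∀ c, ev c 1 = dg.hopf.counit c
  ev_mul_left : ∀ c d b, ev (c * d) b =
    LinearMap.mul' k k (TensorProduct.map (ev c) (ev d) (bg.hopf.comul b))
  ev_mul_right : ∀ c a b, ev c (a * b) =
    LinearMap.mul' k k (TensorProduct.map (ev.flip a) (ev.flip b) (dg.hopf.comul c))
  /-- `⟨c⁽¹⁾, b⟩ c⁽²⁾ = b⁽¹⁾ ⟨c, b⁽²⁾⟩` -/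
  ev_covariant : ∀ c b,
    TensorProduct.lid k A (LinearMap.rTensor A (ev.flip b) (dg.coact c)) =
      TensorProduct.rid k A (LinearMap.lTensor A (ev c) (bg.coact b))

namespace DoubleInput

variable {k H A D B : Type*} [Field k] [Ring H] [HopfAlgebra k H] [Ring A] [HopfAlgebra k A]
  [Ring D] [Algebra k D] [Ring B] [Algebra k B] (P : DoubleInput k H A D B)

/-- The coaction of `A` on `B` as a linear map. -/
def ρB : B →ₗ[k] A ⊗[k] B := P.bg.coact.toLinearMap

/-- The coaction of `A` on `D` as a linear map. -/
def ρD : D →ₗ[k] D ⊗[k] A := P.dg.coact.toLinearMap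

/-- The coproduct `Ψ⁻¹ ∘ Δ` of the braided group `C̄ = Dᶜᵒᵖ`, written `c ↦ c₁ ⊗ c₂` below. Its
algebra and counit are those of `D`, its antipode is the inverse `antipodeInv` of that of `D`. -/
def comulBar : D →ₗ[k] D ⊗[k] D := braidRInv P.W P.ρD ∘ₗ P.dg.hopf.comul

/-- `(x ⊗ b) ⊗ (d ⊗ z) ↦ ⟨d, b⟩ x ⊗ z`. -/
def contract (X Z : Type*) [AddCommGroup X] [Module k X] [AddCommGroup Z] [Module k Z] :
    (X ⊗[k] B) ⊗[k] (D ⊗[k] Z) →ₗ[k] X ⊗[k] Z :=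
  LinearMap.lTensor X
      ((TensorProduct.lid k Z).toLinearMap
        ∘ₗ LinearMap.rTensor Z (TensorProduct.lift P.ev.flip)
        ∘ₗ (TensorProduct.assoc k B D Z).symm.toLinearMap)
    ∘ₗ (TensorProduct.assoc k X B (D ⊗[k] Z)).toLinearMap

/-- `b ↦ (R(b₁⁽¹⁾) ⊗ b₁⁽²⁾) ⊗ ((b₂ ◁ Rbar(b₃⁽¹⁾)) ⊗ b₃⁽²⁾)`. -/
def reorderB : B →ₗ[k] (H ⊗[k] B) ⊗[k] (B ⊗[k] B) :=
  TensorProduct.map (LinearMap.rTensor B P.W.R.toLinearMap ∘ₗ P.ρB)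
      (twistL P.W P.ρB P.W.Rbar.toLinearMap)
    ∘ₗ LinearMap.lTensor B P.bg.hopf.comul ∘ₗ P.bg.hopf.comul

/-- `c ↦ (c₁⁽¹⁾ ⊗ (R(c₁⁽²⁾) ▷ c₂)) ⊗ ((S̄ c₃)⁽¹⁾ ⊗ Rbar((S̄ c₃)⁽²⁾))`. -/
def reorderD : D →ₗ[k] (D ⊗[k] D) ⊗[k] (D ⊗[k] H) :=
  TensorProduct.map (twistR P.W P.ρD P.W.R.toLinearMap)
      (LinearMap.lTensor D P.W.Rbar.toLinearMap ∘ₗ P.ρD ∘ₗ P.antipodeInv)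
    ∘ₗ LinearMap.rTensor D P.comulBar ∘ₗ P.comulBar

/-- The cross relation, which reorders `b c` in the form
`(R(c₁⁽²⁾) ▷ c₂) ⊗ R(b₁⁽¹⁾) Rbar((S̄ c₃)⁽²⁾) ⊗ (b₂ ◁ Rbar(b₃⁽¹⁾))`
with coefficient `⟨c₁⁽¹⁾, b₁⁽²⁾⟩ ⟨(S̄ c₃)⁽¹⁾, b₃⁽²⁾⟩`. -/
def reorder : B ⊗[k] D →ₗ[k] D ⊗[k] (H ⊗[k] B) :=
  LinearMap.lTensor D
      (LinearMap.rTensor B (LinearMap.mul' k H)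
        ∘ₗ (TensorProduct.assoc k H H B).symm.toLinearMap)
    ∘ₗ (TensorProduct.assoc k D H (H ⊗[k] B)).toLinearMap
    ∘ₗ TensorProduct.map (TensorProduct.comm k H D).toLinearMap
        (TensorProduct.comm k B H).toLinearMap
    ∘ₗ TensorProduct.map (P.contract H D) (P.contract B H)
    ∘ₗ (TensorProduct.tensorTensorTensorComm k (H ⊗[k] B) (B ⊗[k] B)
        (D ⊗[k] D) (D ⊗[k] H)).toLinearMap
    ∘ₗ TensorProduct.map P.reorderB P.reorderD

/-- The product of `U(C̄, H, B)` on `C̄ ⊗ H ⊗ B`: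
`(c ⊗ h ⊗ b)(d ⊗ g ⊗ a) = c (h₁ ▷ dᵢ) ⊗ h₂ rᵢ g₁ ⊗ (bᵢ ◁ g₂) a`,
where `dᵢ ⊗ rᵢ ⊗ bᵢ` is the reordered form of `b d`. -/
def mulU : (D ⊗[k] (H ⊗[k] B)) ⊗[k] (D ⊗[k] (H ⊗[k] B)) →ₗ[k] D ⊗[k] (H ⊗[k] B) :=
  (TensorProduct.assoc k D H B).toLinearMap
    ∘ₗ LinearMap.rTensor B (crossMul (crossHD P.W P.ρD))
    ∘ₗ (TensorProduct.assoc k (D ⊗[k] H) (D ⊗[k] H) B).symm.toLinearMap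
    ∘ₗ LinearMap.lTensor (D ⊗[k] H)
        ((TensorProduct.assoc k D H B).symm.toLinearMap
          ∘ₗ LinearMap.lTensor D (crossMul (crossBH P.W P.ρB))
          ∘ₗ (TensorProduct.assoc k D (H ⊗[k] B) (H ⊗[k] B)).toLinearMap
          ∘ₗ LinearMap.rTensor (H ⊗[k] B) P.reorder
          ∘ₗ (TensorProduct.assoc k B D (H ⊗[k] B)).symm.toLinearMap)
    ∘ₗ (TensorProduct.assoc k (D ⊗[k] H) B (D ⊗[k] (H ⊗[k] B))).toLinearMap
    ∘ₗ LinearMap.rTensor (D ⊗[k] (H ⊗[k] B)) (TensorProduct.assoc k D H B).symm.toLinearMap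

/-- The coproduct of the bosonisation on `H ⊗ B`:
`h ⊗ b ↦ (h₁ ⊗ b₁⁽²⁾) ⊗ (h₂ R(b₁⁽¹⁾) ⊗ b₂)`. -/
def comulHB : H ⊗[k] B →ₗ[k] (H ⊗[k] B) ⊗[k] (H ⊗[k] B) :=
  LinearMap.lTensor (H ⊗[k] B)
      (LinearMap.rTensor B (LinearMap.mul' k H)
        ∘ₗ (TensorProduct.assoc k H H B).symm.toLinearMap)
    ∘ₗ (TensorProduct.tensorTensorTensorComm k H H B (H ⊗[k] B)).toLinearMap
    ∘ₗ TensorProduct.map Coalgebra.comul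
        ((TensorProduct.assoc k B H B).toLinearMap
          ∘ₗ LinearMap.rTensor B ((TensorProduct.comm k H B).toLinearMap
            ∘ₗ LinearMap.rTensor B P.W.R.toLinearMap ∘ₗ P.ρB)
          ∘ₗ P.bg.hopf.comul)

/-- `c ↦ (c₁ ⊗ Rbar(c₂⁽²⁾)) ⊗ c₂⁽¹⁾`, the coproduct of `C̄` inside the bosonisation of `C̄`. -/
def comulC : D →ₗ[k] (D ⊗[k] H) ⊗[k] D :=
  (TensorProduct.assoc k D H D).symm.toLinearMap
    ∘ₗ LinearMap.lTensor D ((TensorProduct.comm k D H).toLinearMap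
      ∘ₗ LinearMap.lTensor D P.W.Rbar.toLinearMap ∘ₗ P.ρD)
    ∘ₗ P.comulBar

/-- The coproduct of `U(C̄, H, B)`: `c ⊗ h ⊗ b` goes to
`(c₁ ⊗ Rbar(c₂⁽²⁾) h₁ ⊗ b₁⁽²⁾) ⊗ (c₂⁽¹⁾ ⊗ h₂ R(b₁⁽¹⁾) ⊗ b₂)`. -/
def comulU : D ⊗[k] (H ⊗[k] B) →ₗ[k] (D ⊗[k] (H ⊗[k] B)) ⊗[k] (D ⊗[k] (H ⊗[k] B)) :=
  LinearMap.rTensor (D ⊗[k] (H ⊗[k] B))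
      (LinearMap.lTensor D
          (LinearMap.rTensor B (LinearMap.mul' k H)
            ∘ₗ (TensorProduct.assoc k H H B).symm.toLinearMap)
        ∘ₗ (TensorProduct.assoc k D H (H ⊗[k] B)).toLinearMap)
    ∘ₗ (TensorProduct.tensorTensorTensorComm k (D ⊗[k] H) D
        (H ⊗[k] B) (H ⊗[k] B)).toLinearMap
    ∘ₗ TensorProduct.map P.comulC P.comulHB

/-- The counit `ε ⊗ ε ⊗ ε` of `U(C̄, H, B)`. -/
def counitU : D ⊗[k] (H ⊗[k] B) →ₗ[k] k :=
  (TensorProduct.lid k k).toLinearMap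
    ∘ₗ TensorProduct.map P.dg.hopf.counit.toLinearMap
      ((TensorProduct.lid k k).toLinearMap
        ∘ₗ TensorProduct.map Coalgebra.counit P.bg.hopf.counit.toLinearMap)

/-- The Hopf algebra `U` is the double-bosonisation `U(C̄, H, B)`, realised on the vector space
`C̄ ⊗ H ⊗ B` through the linear isomorphism `θ`. (The antipode of a bialgebra is unique.) -/
structure IsDoubleBosonisation {U : Type*} [Ring U] [HopfAlgebra k U]
    (θ : D ⊗[k] (H ⊗[k] B) ≃ₗ[k] U) : Prop where
  one : θ (1 ⊗ₜ (1 ⊗ₜ 1)) = 1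
  mul : ∀ x y, θ x * θ y = θ (P.mulU (x ⊗ₜ y))
  comul : ∀ x, Coalgebra.comul (R := k) (θ x) =
    TensorProduct.map θ.toLinearMap θ.toLinearMap (P.comulU x)
  counit : ∀ x, Coalgebra.counit (R := k) (θ x) = P.counitU x

end DoubleInput

/-! ## Cartan data, root data and the free braided algebra -/

/-- A Cartan datum: a symmetric bilinear form on `ℤ[I]` with `i · i ∈ {2, 4, 6, …}` and
`2 (i · j) / (i · i) ∈ {0, -1, -2, …}` for `i ≠ j`. -/
structure LusztigCartanDatum (I : Type*) where
  form : (I →₀ ℤ) →ₗ[ℤ] (I →₀ ℤ) →ₗ[ℤ] ℤ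
  symm : ∀ x y, form x y = form y x
  pos : ∀ i, 0 < form (Finsupp.single i 1) (Finsupp.single i 1)
  even : ∀ i, 2 ∣ form (Finsupp.single i 1) (Finsupp.single i 1)
  dvd : ∀ i j, i ≠ j → form (Finsupp.single i 1) (Finsupp.single i 1) ∣
    2 * form (Finsupp.single i 1) (Finsupp.single j 1)
  nonpos : ∀ i j, i ≠ j → form (Finsupp.single i 1) (Finsupp.single j 1) ≤ 0

namespace LusztigCartanDatum

variable {I : Type*} (C : LusztigCartanDatum I)

/-- `i · j`. -/
def dot (i j : I) : ℤ := C.form (Finsupp.single i 1) (Finsupp.single j 1)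

/-- `i · i / 2`, an exact division. -/
def half (i : I) : ℤ := C.dot i i / 2

/-- The Cartan matrix entry `2 (i · j) / (i · i)`, an exact division. -/
def a (i j : I) : ℤ := 2 * C.dot i j / C.dot i i

/-- `qᵢ = q ^ (i · i / 2)`. -/
def qi {k : Type*} [Field k] (q : k) (i : I) : k := q ^ C.half i

end LusztigCartanDatum

/-- A root datum for a Cartan datum: lattices `Y`, `X` in perfect duality and
inclusions `I → Y`, `I → X` with `⟨i, j'⟩` the Cartan matrix. -/
structure LusztigRootDatum {I : Type*} (C : LusztigCartanDatum I) (Y X : Type*)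
    [AddCommGroup Y] [AddCommGroup X] where
  pairing : Y →ₗ[ℤ] X →ₗ[ℤ] ℤ
  perfect : pairing.IsPerfPair
  coroot : I → Y
  coroot_injective : Function.Injective coroot
  root : I → X
  root_injective : Function.Injective root
  pairing_coroot_root : ∀ i j, pairing (coroot i) (root j) = C.a i j

section FreeBraided

variable {k : Type*} [Field k] {I : Type*} [DecidableEq I]

/-- The braided coproduct of the free algebra for the braiding `Ψ(eᵢ ⊗ eⱼ) = q^{i·j} eⱼ ⊗ eᵢ`,
with primitive generators. It is computed letter by letter: by multiplicativity `Δ(1) = 1 ⊗ 1` and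
`Δ(eᵢ b) = (eᵢ ⊗ 1) Δ(b) + (1 ⊗ eᵢ) Δ(b)`, where `(1 ⊗ eᵢ)(x ⊗ y) = Ψ(eᵢ ⊗ x) y` is the image of
`x ⊗ eᵢ y` under the algebra automorphism `eⱼ ↦ q^{i·j} eⱼ` of the first factor. -/
def freeComul (C : LusztigCartanDatum I) (q : k) :
    FreeAlgebra k I →ₗ[k] FreeAlgebra k I ⊗[k] FreeAlgebra k I :=
  LinearMap.applyₗ (1 ⊗ₜ 1) ∘ₗ
    (FreeAlgebra.lift k fun i : I =>
      (TensorProduct.map (LinearMap.mulLeft k (FreeAlgebra.ι k i)) LinearMap.id +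
        TensorProduct.map
          (FreeAlgebra.lift k fun j : I => q ^ C.dot i j • FreeAlgebra.ι k j).toLinearMap
          (LinearMap.mulLeft k (FreeAlgebra.ι k i)) :
        Module.End k (FreeAlgebra k I ⊗[k] FreeAlgebra k I))).toLinearMap

/-- The counit `eᵢ ↦ 0` of the free algebra. -/
def freeCounit : FreeAlgebra k I →ₐ[k] k := FreeAlgebra.lift k fun _ : I => (0 : k)

/-- The coefficient of the word `eᵢ`: the `ε`-component of the homomorphism to the dual numbers
with `eᵢ ↦ ε` and `eⱼ ↦ 0` for `j ≠ i`. -/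
def freeCoord (i : I) : FreeAlgebra k I →ₗ[k] k :=
  TrivSqZeroExt.sndHom k k ∘ₗ
    (FreeAlgebra.lift k fun j : I => if j = i then DualNumber.eps else (0 : DualNumber k)).toLinearMap

/-- The pairing of two copies of the free algebra with `⟨fᵢ, eⱼ⟩ = δᵢⱼ cᵢ`, extended by
`⟨1, b⟩ = ε(b)` and `⟨x y, b⟩ = ⟨x ⊗ y, Δ b⟩`. -/
def freePairing (C : LusztigCartanDatum I) (q : k) (c : I → k) :
    FreeAlgebra k I →ₗ[k] FreeAlgebra k I →ₗ[k] k :=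
  LinearMap.applyₗ (freeCounit (k := k) (I := I)).toLinearMap ∘ₗ
    (FreeAlgebra.lift k fun i : I =>
      ((freeComul C q).dualMap
        ∘ₗ TensorProduct.dualDistrib k (FreeAlgebra k I) (FreeAlgebra k I)
        ∘ₗ TensorProduct.mk k _ _ (c i • freeCoord i) :
        Module.End k (Module.Dual k (FreeAlgebra k I)))).toLinearMap

/-- Equality modulo the radical of the pairing in the first argument. -/
def radLeft (C : LusztigCartanDatum I) (q : k) (c : I → k) (x y : FreeAlgebra k I) : Prop :=
  ∀ b, freePairing C q c x b = freePairing C q c y b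

/-- Equality modulo the radical of the pairing in the second argument. -/
def radRight (C : LusztigCartanDatum I) (q : k) (c : I → k) (a b : FreeAlgebra k I) : Prop :=
  ∀ x, freePairing C q c x a = freePairing C q c x b

/-- The normalisation `⟨fᵢ, eʲ⟩ = δᵢⱼ (qᵢ - qᵢ⁻¹)⁻¹`. -/
def bosNorm (C : LusztigCartanDatum I) (q : k) (i : I) : k := (C.qi q i - (C.qi q i)⁻¹)⁻¹

/-- Lusztig's normalisation `(θᵢ, θⱼ) = δᵢⱼ (1 - qᵢ⁻²)⁻¹`. -/
def lusNorm (C : LusztigCartanDatum I) (q : k) (i : I) : k := (1 - (C.qi q i)⁻¹ ^ 2)⁻¹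

/-- `B`: the free algebra on the `eⁱ` modulo the radical of its pairing with the `fᵢ`. -/
abbrev QuotB (C : LusztigCartanDatum I) (q : k) := RingQuot (radRight C q (bosNorm C q))

/-- `D`: the free algebra on the `fᵢ` modulo the radical of its pairing with the `eⁱ`. -/
abbrev QuotD (C : LusztigCartanDatum I) (q : k) := RingQuot (radLeft C q (bosNorm C q))

/-- Lusztig's algebra `f`: the free algebra on the `θᵢ` modulo the radical of his form. -/
abbrev LusztigF (C : LusztigCartanDatum I) (q : k) := RingQuot (radLeft C q (lusNorm C q))

/-- The generator `eⁱ` of `B`. -/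
def genB (C : LusztigCartanDatum I) (q : k) (i : I) : QuotB C q :=
  RingQuot.mkAlgHom k (radRight C q (bosNorm C q)) (FreeAlgebra.ι k i)

/-- The generator `fᵢ` of `D`. -/
def genD (C : LusztigCartanDatum I) (q : k) (i : I) : QuotD C q :=
  RingQuot.mkAlgHom k (radLeft C q (bosNorm C q)) (FreeAlgebra.ι k i)

/-- The generator `θᵢ` of Lusztig's algebra `f`. -/
def genF (C : LusztigCartanDatum I) (q : k) (i : I) : LusztigF C q :=
  RingQuot.mkAlgHom k (radLeft C q (lusNorm C q)) (FreeAlgebra.ι k i)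

end FreeBraided

/-! ## Lusztig's algebra `U_q(g)` -/

section Uq

/-- The generators `Eᵢ`, `Fᵢ` (`i ∈ I`) and `K_μ` (`μ ∈ Y`). -/
inductive UqGen (I Y : Type*) where
  | E (i : I) : UqGen I Y
  | F (i : I) : UqGen I Y
  | K (μ : Y) : UqGen I Y

variable {k : Type*} [Field k] {I : Type*} [DecidableEq I] {C : LusztigCartanDatum I}
  {Y X : Type*} [AddCommGroup Y] [AddCommGroup X]

/-- `(i · i / 2) i ∈ Y`, the index of `K̃ᵢ = Kᵢ ^ (i · i / 2)`. -/
def LusztigRootDatum.tilde (T : LusztigRootDatum C Y X) (i : I) : Y := C.half i • T.coroot i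

/-- The generator `E`, `F` or `K` in the free algebra. -/
abbrev ug (k : Type*) [Field k] {I Y : Type*} (g : UqGen I Y) : FreeAlgebra k (UqGen I Y) :=
  FreeAlgebra.ι k g

/-- The defining relations of Lusztig's `U_q(g)`; the last two impose on the `Eᵢ` and on the `Fᵢ`
all the relations which hold between the generators of Lusztig's algebra `f`. -/
inductive UqRel (T : LusztigRootDatum C Y X) (q : k) :
    FreeAlgebra k (UqGen I Y) → FreeAlgebra k (UqGen I Y) → Prop
  | K_zero : UqRel T q (ug k (.K 0)) 1
  | K_add (μ ν : Y) : UqRel T q (ug k (.K μ) * ug k (.K ν)) (ug k (.K (μ + ν)))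
  | K_E (μ : Y) (i : I) : UqRel T q (ug k (.K μ) * ug k (.E i))
      (q ^ T.pairing μ (T.root i) • (ug k (.E i) * ug k (.K μ)))
  | K_F (μ : Y) (i : I) : UqRel T q (ug k (.K μ) * ug k (.F i))
      (q ^ (-T.pairing μ (T.root i)) • (ug k (.F i) * ug k (.K μ)))
  | E_F_same (i : I) : UqRel T q (ug k (.E i) * ug k (.F i) - ug k (.F i) * ug k (.E i))
      ((C.qi q i - (C.qi q i)⁻¹)⁻¹ • (ug k (.K (T.tilde i)) - ug k (.K (-T.tilde i))))
  | E_F_ne (i j : I) (h : i ≠ j) :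
      UqRel T q (ug k (.E i) * ug k (.F j) - ug k (.F j) * ug k (.E i)) 0
  | rad_E (x : FreeAlgebra k I) (hx : ∀ y, freePairing C q (lusNorm C q) x y = 0) :
      UqRel T q (FreeAlgebra.lift k (fun i : I => ug k (.E i)) x) 0
  | rad_F (x : FreeAlgebra k I) (hx : ∀ y, freePairing C q (lusNorm C q) x y = 0) :
      UqRel T q (FreeAlgebra.lift k (fun i : I => ug k (.F i)) x) 0

/-- Lusztig's algebra `U_q(g)`, by generators and relations. -/
abbrev Uq (T : LusztigRootDatum C Y X) (q : k) := RingQuot (UqRel T q)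

/-- A generator as an element of `U_q(g)`. -/
def uqGen (T : LusztigRootDatum C Y X) (q : k) (g : UqGen I Y) : Uq T q :=
  RingQuot.mkAlgHom k (UqRel T q) (FreeAlgebra.ι k g)

end Uq

/-! ## The input given by a Cartan datum and a root datum -/

section Input

variable {k : Type*} [Field k] {I : Type*} [DecidableEq I] {C : LusztigCartanDatum I}
  {Y X : Type*} [AddCommGroup Y] [AddCommGroup X]

/-- The basis element `K_μ` of `kY`, or `g_ν` of `kℤ[I]`. -/
abbrev grp (k : Type*) [Field k] {G : Type*} (g : G) : AddMonoidAlgebra k G :=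
  AddMonoidAlgebra.single g 1

/-- The element `gᵢ` of `kℤ[I]`. -/
abbrev gElt (k : Type*) [Field k] {I : Type*} (i : I) : AddMonoidAlgebra k (I →₀ ℤ) :=
  grp k (Finsupp.single i 1)

/-- The input of the construction with `H = kY`, `A = kℤ[I]`, and `B`, `D` the quotients of the free
braided algebras by the radical of the pairing, has the structure given by the Cartan datum and the
root datum. All maps are prescribed on algebra generators, which determines them. -/
structure IsLusztigInput (T : LusztigRootDatum C Y X) (q : k)
    (P : DoubleInput k (AddMonoidAlgebra k Y) (AddMonoidAlgebra k (I →₀ ℤ))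
      (QuotD C q) (QuotB C q)) : Prop where
  pair : ∀ μ i, P.W.pair (grp k μ) (gElt k i) = q ^ T.pairing μ (T.root i)
  R : ∀ i, P.W.R (gElt k i) = grp k (T.tilde i)
  Rbar : ∀ i, P.W.Rbar (gElt k i) = grp k (-T.tilde i)
  coactB : ∀ i, P.bg.coact (genB C q i) = gElt k i ⊗ₜ genB C q i
  comulB : ∀ i, P.bg.hopf.comul (genB C q i) = genB C q i ⊗ₜ 1 + 1 ⊗ₜ genB C q i
  counitB : ∀ i, P.bg.hopf.counit (genB C q i) = 0
  antipodeB : ∀ i, P.bg.hopf.antipode (genB C q i) = -genB C q i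
  coactD : ∀ i, P.dg.coact (genD C q i) = genD C q i ⊗ₜ gElt k i
  comulD : ∀ i, P.dg.hopf.comul (genD C q i) = genD C q i ⊗ₜ 1 + 1 ⊗ₜ genD C q i
  counitD : ∀ i, P.dg.hopf.counit (genD C q i) = 0
  antipodeD : ∀ i, P.dg.hopf.antipode (genD C q i) = -genD C q i
  ev_gen : ∀ i j, P.ev (genD C q i) (genB C q j) =
    if i = j then (C.qi q i - (C.qi q i)⁻¹)⁻¹ else 0
  ev_mk : ∀ x b, P.ev (RingQuot.mkAlgHom k (radLeft C q (bosNorm C q)) x)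
    (RingQuot.mkAlgHom k (radRight C q (bosNorm C q)) b) = freePairing C q (bosNorm C q) x b
  ev_nondegenerate_left : ∀ d, (∀ b, P.ev d b = 0) → d = 0
  ev_nondegenerate_right : ∀ b, (∀ d, P.ev d b = 0) → b = 0

end Input

end DoubleBoson

end

open DoubleBoson

noncomputable section

namespace DoubleBoson

/-! Associativity of the double-bosonisation product on `C̄ ⊗ H ⊗ B` is never checked on the
explicit formula. Instead `U_q(g)` is taken with its presentation, its Hopf structure is obtained
from the universal property, and multiplication `D ⊗ kY ⊗ B → U_q(g)` is shown to be a linear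
isomorphism which carries `mulU` and `comulU` to the product and coproduct.

The input is the pairing on the free algebra. In either argument, left multiplication by a letter is
adjoint to the skew derivation `lder` (`freePairing_gen_mul`, `freePairing_gen_mul_right`), and
right multiplication to `rder` (`freePairing_mul_gen`). Hence the pairing is symmetric, homogeneous
and dual for product and coproduct, and the inverse braided antipode is self-adjoint. The radical is
therefore a homogeneous braided Hopf ideal, and a quotient by it (`Nichols`) is a braided group with
a nondegenerate pairing between any two copies. Lusztig's normalisation differs from the other one
by the units `q_i`, which does not change the radical (`radical_rescale`), so `f`, `B` and `D` are
copies of one algebra. The braiding defined by `R` is `q ^ (β · γ)` because `(i · i / 2) a_ij = i ·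
j`.

The heart is `reorder_gen_mul`. The cross relation contains iterated coproducts, two pairings and an
antipode, but replacing `b` by `e_i b` changes it by the single operator `crossOp`, which encodes
`e_i d = d e_i + ∂ʳ(d) K̃_i - χ(∂ˡ d) K̃_i⁻¹`. The three terms are the three legs of the two-fold
coproduct into which the new letter can fall. So left multiplications by `e_i`, `f_i`, `K_μ` are
explicit operators, and they satisfy the relations of `U_q(g)` (`isRealisation_operators`); the
radical relations hold since words in these operators compute multiplication by elements of `B` and
`D`. Thus `U_q(g)` acts on `D ⊗ kY ⊗ B`, the multiplication map is linear for this action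
(`triangular_action`), and acting on `1 ⊗ 1 ⊗ 1` inverts it (`action_triangular_one`).

For the Hopf structure, the proposed coproducts in `U ⊗ U`, counits in `k` and antipodes in the
opposite algebra again satisfy the relations (`tensor`, `counit`, `opposite`). The radical relations
for coproducts and antipodes follow since words in them compute the braided coproduct or antipode
dressed with torus elements, and the same computation identifies the coproduct with `comulU`. -/

/-- Powers of `q` by the bilinear form, as characters of `ℤ[I]`. -/
def LusztigCartanDatum.formChar {k : Type*} [Field k] {I : Type*} (C : LusztigCartanDatum I)
    (q : kˣ) (β : I →₀ ℤ) : AddMonoidAlgebra k (I →₀ ℤ) →ₐ[k] k :=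
  AddMonoidAlgebra.lift k k (I →₀ ℤ)
    { toFun := fun γ => ((q ^ C.form β γ.toAdd : kˣ) : k)
      map_one' := by simp
      map_mul' := fun a b => by simp [zpow_add] }

/-! ### Algebras generated by letters and graded by `ℤ[I]` -/

section Graded

variable {k : Type*} [Field k] {I : Type*} {V : Type*} [Ring V] [Algebra k V]

/-- An algebra generated by elements `gen i`, with a left coaction of `k ℤ[I]` for which `gen i` is
homogeneous of degree `i`. -/
structure GradedGen (k : Type*) [Field k] (I : Type*) (V : Type*) [Ring V] [Algebra k V] where
  gen : I → V
  adjoin_gen : Algebra.adjoin k (Set.range gen) = ⊤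
  coact : V →ₐ[k] AddMonoidAlgebra k (I →₀ ℤ) ⊗[k] V
  coact_gen : ∀ i, coact (gen i) = gElt k i ⊗ₜ gen i

namespace GradedGen

variable (g : GradedGen k I V)

/-- Homogeneous elements of degree `β`. -/
def IsWt (β : I →₀ ℤ) (v : V) : Prop := g.coact v = grp k β ⊗ₜ v

theorem isWt_one : g.IsWt 0 1 := by
  simp [IsWt, grp, Algebra.TensorProduct.one_def, AddMonoidAlgebra.one_def]

theorem isWt_gen (i : I) : g.IsWt (Finsupp.single i 1) (g.gen i) := g.coact_gen i

variable {g} in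
theorem IsWt.mul {β γ : I →₀ ℤ} {v w : V} (hv : g.IsWt β v) (hw : g.IsWt γ w) :
    g.IsWt (β + γ) (v * w) := by
  simp only [IsWt] at *
  simp [map_mul, hv, hw, grp, AddMonoidAlgebra.single_mul_single]

variable {g} in
theorem IsWt.smul {β : I →₀ ℤ} {v : V} (hv : g.IsWt β v) (a : k) : g.IsWt β (a • v) := by
  simp only [IsWt] at *
  simp [hv]

variable {g} in
theorem IsWt.neg {β : I →₀ ℤ} {v : V} (hv : g.IsWt β v) : g.IsWt β (-v) := by
  simp only [IsWt] at *
  simp [hv, TensorProduct.tmul_neg]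

/-- Induction over the words in the generators. -/
theorem induction {p : V → Prop} (one : p 1) (gen_mul : ∀ i v, p v → p (g.gen i * v))
    (add : ∀ v w, p v → p w → p (v + w)) (smul : ∀ (a : k) v, p v → p (a • v)) (v : V) : p v := by
  -- Generalising to left multiplication by every element of the subalgebra turns the product case
  -- into a composition, so that only `gen i * v` with `p v` is ever needed.
  have h : ∀ u : V, u ∈ Algebra.adjoin k (Set.range g.gen) → ∀ v, p v → p (u * v) := by
    intro u hu
    induction hu using Algebra.adjoin_induction with
    | mem x hx => obtain ⟨i, rfl⟩ := hx; exact gen_mul i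
    | algebraMap r => intro v hv; rw [← Algebra.smul_def]; exact smul r v hv
    | add x y _ _ hx hy => intro v hv; rw [add_mul]; exact add _ _ (hx v hv) (hy v hv)
    | mul x y _ _ hx hy => intro v hv; rw [mul_assoc]; exact hx _ (hy v hv)
  simpa using h v (by rw [g.adjoin_gen]; trivial) 1 one

/-- Linear maps which agree at `1`, and satisfy the same recursion over words, agree. -/
theorem linearMap_ext {M : Type*} [AddCommMonoid M] [Module k M] {φ ψ : V →ₗ[k] M}
    (one : φ 1 = ψ 1) (gen_mul : ∀ i v, φ v = ψ v → φ (g.gen i * v) = ψ (g.gen i * v)) : φ = ψ := by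
  ext v
  induction v using g.induction with
  | one => exact one
  | gen_mul i v h => exact gen_mul i v h
  | add v w hv hw => simp [hv, hw]
  | smul a v hv => simp [hv]

/-- Homogeneous elements span. -/
theorem linearMap_ext_wt {M : Type*} [AddCommMonoid M] [Module k M] {φ ψ : V →ₗ[k] M}
    (h : ∀ β v, g.IsWt β v → φ v = ψ v) : φ = ψ := by
  -- The span contains `1` and is stable under left multiplication by letters, hence is everything.
  have key : ∀ v : V, v ∈ Submodule.span k {w : V | ∃ β, g.IsWt β w} := by
    intro v
    induction v using g.induction with
    | one => exact Submodule.subset_span ⟨0, g.isWt_one⟩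
    | gen_mul i v hv =>
      induction hv using Submodule.span_induction with
      | mem w hw =>
        obtain ⟨β, hβ⟩ := hw
        exact Submodule.subset_span ⟨_, (g.isWt_gen i).mul hβ⟩
      | zero => simp
      | add v w _ _ hv hw => rw [mul_add]; exact Submodule.add_mem _ hv hw
      | smul a v _ hv => rw [mul_smul_comm]; exact Submodule.smul_mem _ _ hv
    | add v w hv hw => exact Submodule.add_mem _ hv hw
    | smul a v hv => exact Submodule.smul_mem _ _ hv
  ext v
  have hv := key v
  induction hv using Submodule.span_induction with
  | mem w hw => obtain ⟨β, hβ⟩ := hw; exact h β w hβ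
  | zero => simp
  | add v w _ _ hv hw => simp [hv, hw]
  | smul a v _ hv => simp [hv]

/-- Extensionality on words, among homogeneous elements. -/
theorem linearMap_ext_words {M : Type*} [AddCommMonoid M] [Module k M] {φ ψ : V →ₗ[k] M}
    (one : φ 1 = ψ 1)
    (gen_mul : ∀ i β v, g.IsWt β v → φ v = ψ v → φ (g.gen i * v) = ψ (g.gen i * v)) :
    φ = ψ := by
  -- Homogeneity and equality are put into one spanning set: two maps which agree on a sum need not
  -- agree on its homogeneous summands.
  have key : ∀ v : V, v ∈ Submodule.span k {w : V | (∃ β, g.IsWt β w) ∧ φ w = ψ w} := by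
    intro v
    induction v using g.induction with
    | one => exact Submodule.subset_span ⟨⟨0, g.isWt_one⟩, one⟩
    | gen_mul i v hv =>
      induction hv using Submodule.span_induction with
      | mem w hw =>
        obtain ⟨⟨β, hβ⟩, h⟩ := hw
        exact Submodule.subset_span ⟨⟨_, (g.isWt_gen i).mul hβ⟩, gen_mul i β w hβ h⟩
      | zero => simp
      | add v w _ _ hv hw => rw [mul_add]; exact Submodule.add_mem _ hv hw
      | smul a v _ hv => rw [mul_smul_comm]; exact Submodule.smul_mem _ _ hv
    | add v w hv hw => exact Submodule.add_mem _ hv hw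
    | smul a v hv => exact Submodule.smul_mem _ _ hv
  ext v
  have hv := key v
  induction hv using Submodule.span_induction with
  | mem w hw => exact hw.2
  | zero => simp
  | add v w _ _ hv hw => simp [hv, hw]
  | smul a v _ hv => simp [hv]

theorem linearMap_ext_wt₂ {V' : Type*} [Ring V'] [Algebra k V'] (g' : GradedGen k I V')
    {M : Type*} [AddCommMonoid M] [Module k M] {φ ψ : V ⊗[k] V' →ₗ[k] M}
    (h : ∀ β γ v w, g.IsWt β v → g'.IsWt γ w → φ (v ⊗ₜ w) = ψ (v ⊗ₜ w)) : φ = ψ := by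
  apply TensorProduct.ext
  apply g.linearMap_ext_wt
  intro β v hv
  apply g'.linearMap_ext_wt
  intro γ w hw
  exact h β γ v w hv hw

theorem algHom_ext {W : Type*} [Ring W] [Algebra k W] {φ ψ : V →ₐ[k] W}
    (h : ∀ i, φ (g.gen i) = ψ (g.gen i)) : φ = ψ := by
  apply AlgHom.ext_of_adjoin_eq_top g.adjoin_gen
  rintro _ ⟨i, rfl⟩
  exact h i

/-- The algebra endomorphism of `V` by which a character of `k ℤ[I]` acts. -/
def twist (φ : AddMonoidAlgebra k (I →₀ ℤ) →ₐ[k] k) : V →ₐ[k] V :=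
  ((Algebra.TensorProduct.lid k V).toAlgHom.comp
    (Algebra.TensorProduct.map φ (AlgHom.id k V))).comp g.coact

variable {g} in
theorem IsWt.twist {β : I →₀ ℤ} {v : V} (hv : g.IsWt β v)
    (φ : AddMonoidAlgebra k (I →₀ ℤ) →ₐ[k] k) : g.twist φ v = φ (grp k β) • v := by
  rw [IsWt] at hv
  simp [GradedGen.twist, hv]

@[simp] theorem twist_gen (φ : AddMonoidAlgebra k (I →₀ ℤ) →ₐ[k] k) (i : I) :
    g.twist φ (g.gen i) = φ (gElt k i) • g.gen i :=
  (g.isWt_gen i).twist φ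

theorem coact_coassoc : (TensorProduct.assoc k _ _ V).toLinearMap
      ∘ₗ LinearMap.rTensor V Coalgebra.comul ∘ₗ g.coact.toLinearMap =
    LinearMap.lTensor _ g.coact.toLinearMap ∘ₗ g.coact.toLinearMap := by
  apply g.linearMap_ext_wt
  intro β v hv
  rw [IsWt] at hv
  simp [hv, grp]

theorem coact_counit : (TensorProduct.lid k V).toLinearMap
      ∘ₗ LinearMap.rTensor V Coalgebra.counit ∘ₗ g.coact.toLinearMap = LinearMap.id := by
  apply g.linearMap_ext_wt
  intro β v hv
  rw [IsWt] at hv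
  simp [hv, grp]

/-- Homogeneity of a linear map of degree zero, from its values on words. -/
theorem coact_comp {φ : V →ₗ[k] V} (one : g.IsWt 0 (φ 1))
    (gen_mul : ∀ i β v, g.IsWt β (φ v) → g.IsWt β v →
      g.IsWt (Finsupp.single i 1 + β) (φ (g.gen i * v))) :
    g.coact.toLinearMap ∘ₗ φ = LinearMap.lTensor _ φ ∘ₗ g.coact.toLinearMap := by
  apply g.linearMap_ext_words
  · have h := g.isWt_one
    rw [IsWt] at one h
    simp only [LinearMap.comp_apply, AlgHom.toLinearMap_apply, one, h, LinearMap.lTensor_tmul]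
  · intro i β v hv h
    have h2 := gen_mul i β v (by
      rw [IsWt] at hv ⊢
      simpa only [LinearMap.comp_apply, AlgHom.toLinearMap_apply, hv, LinearMap.lTensor_tmul]
        using h) hv
    have h3 := (g.isWt_gen i).mul hv
    rw [IsWt] at h2 h3
    simp only [LinearMap.comp_apply, AlgHom.toLinearMap_apply, h2, h3, LinearMap.lTensor_tmul]

variable {g} in
theorem IsWt.map {φ : V →ₗ[k] V}
    (h : g.coact.toLinearMap ∘ₗ φ = LinearMap.lTensor _ φ ∘ₗ g.coact.toLinearMap)
    {β : I →₀ ℤ} {v : V} (hv : g.IsWt β v) : g.IsWt β (φ v) := by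
  rw [IsWt] at hv ⊢
  simpa [hv] using LinearMap.congr_fun h v

end GradedGen

end Graded

/-! ### Braided coproduct and antipode prescribed on words -/

section Words

variable {k : Type*} [Field k] {I : Type*}

theorem LusztigCartanDatum.formChar_single (C : LusztigCartanDatum I) (q : kˣ) (β γ : I →₀ ℤ) :
    C.formChar q β (AddMonoidAlgebra.single γ 1) = (q : k) ^ C.form β γ := by
  simp [LusztigCartanDatum.formChar]

variable {V : Type*} [Ring V] [Algebra k V]

namespace GradedGen

variable (g : GradedGen k I V) (C : LusztigCartanDatum I) (q : kˣ)

/-- The automorphism `v ↦ q ^ (β · |v|) v`. -/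
abbrev chi (β : I →₀ ℤ) : V →ₐ[k] V := g.twist (C.formChar q β)

variable {g} in
theorem IsWt.chi {γ : I →₀ ℤ} {v : V} (hv : g.IsWt γ v) (β : I →₀ ℤ) :
    g.chi C q β v = (q : k) ^ C.form β γ • v := by
  rw [GradedGen.chi, hv.twist, C.formChar_single]

theorem chi_gen (β : I →₀ ℤ) (i : I) :
    g.chi C q β (g.gen i) = (q : k) ^ C.form β (Finsupp.single i 1) • g.gen i :=
  (g.isWt_gen i).chi C q β

theorem twist_comm (φ ψ : AddMonoidAlgebra k (I →₀ ℤ) →ₐ[k] k) (v : V) :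
    g.twist φ (g.twist ψ v) = g.twist ψ (g.twist φ v) := by
  have : (g.twist φ).comp (g.twist ψ) = (g.twist ψ).comp (g.twist φ) := by
    apply g.algHom_ext
    intro i
    simp only [AlgHom.comp_apply, twist_gen, map_smul]
    rw [smul_comm]
  exact AlgHom.congr_fun this v

theorem chi_chi (β γ : I →₀ ℤ) (v : V) :
    g.chi C q β (g.chi C q γ v) = g.chi C q (β + γ) v := by
  have : (g.chi C q β).comp (g.chi C q γ) = g.chi C q (β + γ) := by
    apply g.algHom_ext
    intro i
    simp [C.formChar_single, zpow_add₀, smul_smul, mul_comm]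
  exact AlgHom.congr_fun this v

@[simp] theorem chi_zero (v : V) : g.chi C q 0 v = v := by
  have : g.chi C q 0 = AlgHom.id k V := by
    apply g.algHom_ext
    intro i
    simp [C.formChar_single]
  exact AlgHom.congr_fun this v

/-- On each homogeneous component `twist ψ` is a scalar, and a map which commutes with the coaction
preserves these components. -/
theorem twist_map {φ : V →ₗ[k] V}
    (h : g.coact.toLinearMap ∘ₗ φ = LinearMap.lTensor _ φ ∘ₗ g.coact.toLinearMap)
    (ψ : AddMonoidAlgebra k (I →₀ ℤ) →ₐ[k] k) (v : V) :
    g.twist ψ (φ v) = φ (g.twist ψ v) := by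
  have : (g.twist ψ).toLinearMap ∘ₗ φ = φ ∘ₗ (g.twist ψ).toLinearMap := by
    apply g.linearMap_ext_wt
    intro β v hv
    simp [hv.twist, (hv.map h).twist]
  exact LinearMap.congr_fun this v

theorem isWt_chi {γ : I →₀ ℤ} {v : V} (hv : g.IsWt γ v) (β : I →₀ ℤ) :
    g.IsWt γ (g.chi C q β v) := by
  rw [hv.chi]; exact hv.smul _

/-- Multiplication by `gen i ⊗ 1 + 1 ⊗ gen i` in the braided tensor product algebra. -/
def comulStep (i : I) : V ⊗[k] V →ₗ[k] V ⊗[k] V :=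
  TensorProduct.map (LinearMap.mulLeft k (g.gen i)) LinearMap.id +
    TensorProduct.map (g.chi C q (Finsupp.single i 1)).toLinearMap (LinearMap.mulLeft k (g.gen i))

theorem comulStep_tmul (i : I) (v w : V) : g.comulStep C q i (v ⊗ₜ w) =
    (g.gen i * v) ⊗ₜ w + (g.chi C q (Finsupp.single i 1) v) ⊗ₜ (g.gen i * w) := by
  simp [comulStep]

section Antipode

variable (s : ℤ) {S S' : V →ₗ[k] V}

/-- The hypothesis strips a letter from the front of a word; here it is stripped from the back.
Stripping `j` in front and `i` at the back gives the same power of `q` in either order because the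
form is symmetric. The sign `s` is `1` for the braided antipode and `-1` for its inverse. -/
theorem antipode_mul_gen (S_one : S 1 = 1)
    (S_gen_mul : ∀ i v, S (g.gen i * v) =
      -(g.chi C q (s • Finsupp.single i 1) (S v) * g.gen i)) (i : I) (v : V) :
    S (v * g.gen i) = -(g.gen i * g.chi C q (s • Finsupp.single i 1) (S v)) := by
  induction v using g.induction with
  | one => simpa [S_one] using S_gen_mul i 1
  | gen_mul j v hv =>
    rw [mul_assoc, S_gen_mul, hv, S_gen_mul, map_neg, map_mul, chi_gen, map_neg, map_mul, chi_gen,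
      g.twist_comm]
    simp only [map_smul, LinearMap.smul_apply, C.symm (Finsupp.single i 1)]
    simp [mul_assoc]
  | add v w hv hw => simp only [add_mul, map_add, hv, hw, mul_add, neg_add]
  | smul a v hv => simp [hv]

theorem antipode_covariant_of (S_one : S 1 = 1)
    (S_gen_mul : ∀ i v, S (g.gen i * v) =
      -(g.chi C q (s • Finsupp.single i 1) (S v) * g.gen i)) :
    g.coact.toLinearMap ∘ₗ S = LinearMap.lTensor _ S ∘ₗ g.coact.toLinearMap := by
  apply g.coact_comp
  · rw [S_one]; exact g.isWt_one
  · intro i β v hv _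
    rw [S_gen_mul, add_comm]
    exact ((g.isWt_chi C q hv _).mul (g.isWt_gen i)).neg

/-- `S'` moves the first letter to the end with the twist `-s`; `S` brings it back from the end with
the twist `s`, and both signs and twists cancel. -/
theorem antipode_comp_antipode (S_one : S 1 = 1)
    (S_gen_mul : ∀ i v, S (g.gen i * v) =
      -(g.chi C q (s • Finsupp.single i 1) (S v) * g.gen i))
    (S'_one : S' 1 = 1)
    (S'_gen_mul : ∀ i v, S' (g.gen i * v) =
      -(g.chi C q (-s • Finsupp.single i 1) (S' v) * g.gen i)) :
    S ∘ₗ S' = LinearMap.id := by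
  apply g.linearMap_ext
  · simp [S_one, S'_one]
  · intro i v hv
    simp only [LinearMap.comp_apply, LinearMap.id_apply] at hv ⊢
    rw [S'_gen_mul, map_neg, g.antipode_mul_gen C q s S_one S_gen_mul, neg_neg,
      g.twist_map (g.antipode_covariant_of C q s S_one S_gen_mul), g.chi_chi]
    simp [hv]

end Antipode

end GradedGen

/-- A graded algebra with the braided coproduct, counit and antipode prescribed on words: the
generators are primitive. -/
structure BraidedWords (C : LusztigCartanDatum I) (q : kˣ) (V : Type*) [Ring V] [Algebra k V]
    extends GradedGen k I V where
  comul : V →ₗ[k] V ⊗[k] V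
  comul_one : comul 1 = 1 ⊗ₜ 1
  comul_gen_mul : ∀ i v, comul (gen i * v) = toGradedGen.comulStep C q i (comul v)
  counit : V →ₐ[k] k
  counit_gen : ∀ i, counit (gen i) = 0
  antipode : V →ₗ[k] V
  antipode_one : antipode 1 = 1
  antipode_gen_mul : ∀ i v, antipode (gen i * v) =
    -(toGradedGen.chi C q (Finsupp.single i 1) (antipode v) * gen i)
  antipodeInv : V →ₗ[k] V
  antipodeInv_one : antipodeInv 1 = 1
  antipodeInv_gen_mul : ∀ i v, antipodeInv (gen i * v) =
    -(toGradedGen.chi C q (-Finsupp.single i 1) (antipodeInv v) * gen i)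

namespace BraidedWords

variable {C : LusztigCartanDatum I} {q : kˣ} (b : BraidedWords C q V)

theorem comul_gen (i : I) : b.comul (b.gen i) = b.gen i ⊗ₜ 1 + 1 ⊗ₜ b.gen i := by
  have := b.comul_gen_mul i 1
  rw [b.comul_one, b.comulStep_tmul] at this
  simpa using this

theorem antipode_gen (i : I) : b.antipode (b.gen i) = -b.gen i := by
  simpa [b.antipode_one] using b.antipode_gen_mul i 1

theorem antipode_covariant :
    b.coact.toLinearMap ∘ₗ b.antipode = LinearMap.lTensor _ b.antipode ∘ₗ b.coact.toLinearMap :=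
  b.antipode_covariant_of C q 1 b.antipode_one (by simpa using b.antipode_gen_mul)

theorem antipodeInv_covariant :
    b.coact.toLinearMap ∘ₗ b.antipodeInv =
      LinearMap.lTensor _ b.antipodeInv ∘ₗ b.coact.toLinearMap :=
  b.antipode_covariant_of C q (-1) b.antipodeInv_one (by simpa using b.antipodeInv_gen_mul)

theorem antipode_comp_antipodeInv : b.antipode ∘ₗ b.antipodeInv = LinearMap.id :=
  b.antipode_comp_antipode C q 1 b.antipode_one (by simpa using b.antipode_gen_mul)
    b.antipodeInv_one (by simpa using b.antipodeInv_gen_mul)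

theorem antipodeInv_comp_antipode : b.antipodeInv ∘ₗ b.antipode = LinearMap.id :=
  b.antipode_comp_antipode C q (-1) b.antipodeInv_one (by simpa using b.antipodeInv_gen_mul)
    b.antipode_one (by simpa using b.antipode_gen_mul)

theorem comul_twist (φ : AddMonoidAlgebra k (I →₀ ℤ) →ₐ[k] k) (v : V) :
    b.comul (b.twist φ v) =
      TensorProduct.map (b.twist φ).toLinearMap (b.twist φ).toLinearMap (b.comul v) := by
  have : b.comul ∘ₗ (b.twist φ).toLinearMap =
      TensorProduct.map (b.twist φ).toLinearMap (b.twist φ).toLinearMap ∘ₗ b.comul := by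
    apply b.linearMap_ext
    · simp [b.comul_one]
    · intro i v hv
      simp only [LinearMap.comp_apply, AlgHom.toLinearMap_apply] at hv ⊢
      rw [map_mul, b.twist_gen, smul_mul_assoc, map_smul, b.comul_gen_mul, b.comul_gen_mul, hv]
      generalize b.comul v = z
      induction z with
      | zero => simp
      | add x y hx hy => simp only [map_add, smul_add, hx, hy]
      | tmul x y =>
        simp [b.comulStep_tmul, TensorProduct.smul_tmul', b.twist_comm φ]
  exact LinearMap.congr_fun this v

theorem comul_chi (β : I →₀ ℤ) (v : V) : b.comul (b.chi C q β v) =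
    TensorProduct.map (b.chi C q β).toLinearMap (b.chi C q β).toLinearMap (b.comul v) :=
  b.comul_twist _ v

/-- With either bracketing, the two-fold coproduct of a word arises from `1 ⊗ 1 ⊗ 1` by the same
operators: each new letter enters one of three legs and twists the legs which it passes. -/
theorem coassoc : (TensorProduct.assoc k V V V).toLinearMap ∘ₗ LinearMap.rTensor V b.comul ∘ₗ
    b.comul = LinearMap.lTensor V b.comul ∘ₗ b.comul := by
  have key : ∀ (i : I) (z : V ⊗[k] V),
      TensorProduct.assoc k V V V (LinearMap.rTensor V b.comul z) =
        LinearMap.lTensor V b.comul z →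
      TensorProduct.assoc k V V V (LinearMap.rTensor V b.comul (b.comulStep C q i z)) =
        LinearMap.lTensor V b.comul (b.comulStep C q i z) := by
    intro i z hz
    have h1 : ∀ z : V ⊗[k] V, LinearMap.lTensor V b.comul (b.comulStep C q i z) =
      (TensorProduct.map (LinearMap.mulLeft k (b.gen i)) LinearMap.id +
        TensorProduct.map (b.chi C q (Finsupp.single i 1)).toLinearMap (b.comulStep C q i) :
          V ⊗[k] (V ⊗[k] V) →ₗ[k] V ⊗[k] (V ⊗[k] V))
          (LinearMap.lTensor V b.comul z) := by
      intro z
      induction z with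
      | zero => simp
      | add x y hx hy => simp only [map_add, hx, hy]
      | tmul x y => simp [b.comulStep_tmul, b.comul_gen_mul]
    rw [h1, ← hz]
    clear h1 hz
    induction z with
    | zero => simp
    | add x y hx hy => simp only [map_add, hx, hy]
    | tmul x y =>
      simp only [b.comulStep_tmul, map_add, LinearMap.rTensor_tmul, b.comul_gen_mul, b.comul_chi]
      generalize b.comul x = u
      induction u with
      | zero => simp
      | add x y hx hy =>
        simp only [map_add, TensorProduct.add_tmul, LinearMap.add_apply] at hx hy ⊢
        rw [add_add_add_comm, hx, hy, add_add_add_comm]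
      | tmul u v =>
        simp [b.comulStep_tmul, TensorProduct.add_tmul, TensorProduct.tmul_add, add_assoc]
  apply b.linearMap_ext
  · simp [b.comul_one]
  · intro i v hv
    simp only [LinearMap.comp_apply, LinearEquiv.coe_coe, b.comul_gen_mul] at hv ⊢
    exact key i _ hv

@[simp] theorem counit_twist (φ : AddMonoidAlgebra k (I →₀ ℤ) →ₐ[k] k) (v : V) :
    b.counit (b.twist φ v) = b.counit v := by
  have : b.counit.comp (b.twist φ) = b.counit := by
    apply b.algHom_ext
    intro i
    simp [b.counit_gen]
  exact AlgHom.congr_fun this v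

theorem counit_left : (TensorProduct.lid k V).toLinearMap
    ∘ₗ LinearMap.rTensor V b.counit.toLinearMap ∘ₗ b.comul = LinearMap.id := by
  apply b.linearMap_ext
  · simp [b.comul_one]
  · intro i v hv
    simp only [LinearMap.comp_apply, LinearEquiv.coe_coe, b.comul_gen_mul,
      LinearMap.id_apply] at hv ⊢
    conv_rhs => rw [← hv]
    generalize b.comul v = z
    induction z with
    | zero => simp
    | add x y hx hy => simp only [map_add, hx, hy, mul_add]
    | tmul x y => simp [b.comulStep_tmul, b.counit_gen]

theorem counit_right : (TensorProduct.rid k V).toLinearMap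
    ∘ₗ LinearMap.lTensor V b.counit.toLinearMap ∘ₗ b.comul = LinearMap.id := by
  apply b.linearMap_ext
  · simp [b.comul_one]
  · intro i v hv
    simp only [LinearMap.comp_apply, LinearEquiv.coe_coe, b.comul_gen_mul,
      LinearMap.id_apply] at hv ⊢
    conv_rhs => rw [← hv]
    generalize b.comul v = z
    induction z with
    | zero => simp
    | add x y hx hy => simp only [map_add, hx, hy, mul_add]
    | tmul x y => simp [b.comulStep_tmul, b.counit_gen]

/-- The two terms of `comulStep` cancel on every pure tensor because `S (g x) = -χ(S x) g`, so no
inductive hypothesis is needed. -/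
theorem antipode_left : LinearMap.mul' k V ∘ₗ LinearMap.rTensor V b.antipode ∘ₗ b.comul =
    Algebra.linearMap k V ∘ₗ b.counit.toLinearMap := by
  apply b.linearMap_ext
  · simp [b.comul_one, b.antipode_one]
  · intro i v _
    simp only [LinearMap.comp_apply, b.comul_gen_mul, AlgHom.toLinearMap_apply, map_mul,
      b.counit_gen, zero_mul, map_zero]
    generalize b.comul v = z
    induction z with
    | zero => simp
    | add x y hx hy => simp only [map_add, hx, hy, add_zero]
    | tmul x y =>
      simp [b.comulStep_tmul, b.antipode_gen_mul, b.twist_map b.antipode_covariant, mul_assoc]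

theorem antipode_right : LinearMap.mul' k V ∘ₗ LinearMap.lTensor V b.antipode ∘ₗ b.comul =
    Algebra.linearMap k V ∘ₗ b.counit.toLinearMap := by
  apply b.linearMap_ext
  · simp [b.comul_one, b.antipode_one]
  · intro i v hv
    simp only [LinearMap.comp_apply, b.comul_gen_mul, AlgHom.toLinearMap_apply, map_mul,
      b.counit_gen, zero_mul, map_zero, Algebra.linearMap_apply] at hv ⊢
    -- Here the two terms do not cancel by themselves: a letter turns `w` into `g w - χ(w) g`, which
    -- vanishes once `w` is known to be a scalar.
    have : ∀ z : V ⊗[k] V, LinearMap.mul' k V (LinearMap.lTensor V b.antipode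
        (b.comulStep C q i z)) = b.gen i * LinearMap.mul' k V (LinearMap.lTensor V b.antipode z) -
        b.chi C q (Finsupp.single i 1) (LinearMap.mul' k V (LinearMap.lTensor V b.antipode z)) *
          b.gen i := by
      intro z
      induction z with
      | zero => simp
      | add x y hx hy => simp only [map_add, hx, hy, mul_add, add_mul]; abel
      | tmul x y =>
        simp [b.comulStep_tmul, b.antipode_gen_mul, mul_assoc]
        abel
    rw [this, hv]
    simp [Algebra.commutes]

/-- The braiding on homogeneous elements. -/
def IsBraiding (b : BraidedWords C q V) (Ψ : V ⊗[k] V →ₗ[k] V ⊗[k] V) : Prop :=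
  ∀ β γ v w, b.IsWt β v → b.IsWt γ w → Ψ (v ⊗ₜ w) = (q : k) ^ C.form β γ • w ⊗ₜ v

theorem comul_mul {Ψ : V ⊗[k] V →ₗ[k] V ⊗[k] V} (hΨ : b.IsBraiding Ψ) (v w : V) :
    b.comul (v * w) = crossMul Ψ (b.comul v ⊗ₜ b.comul w) := by
  have one : ∀ z : V ⊗[k] V, crossMul Ψ ((1 ⊗ₜ 1) ⊗ₜ z) = z := by
    intro z
    have : crossMul Ψ ∘ₗ TensorProduct.mk k _ _ ((1 : V) ⊗ₜ[k] (1 : V)) = LinearMap.id := by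
      apply b.linearMap_ext_wt₂ b.toGradedGen
      intro β γ v w hv hw
      simp [crossMul, hΨ 0 β 1 v b.isWt_one hv]
    exact LinearMap.congr_fun this z
  -- This is associativity with the primitive element as left factor. Carrying `g w` past `v'` costs
  -- the power of `q` for `w` times that for `g`, and the second power is the twist in `comulStep`.
  have step : ∀ i (z z' : V ⊗[k] V), b.comulStep C q i (crossMul Ψ (z ⊗ₜ z')) =
      crossMul Ψ (b.comulStep C q i z ⊗ₜ z') := by
    intro i z z'
    have : (TensorProduct.mk k _ _).compr₂ (b.comulStep C q i ∘ₗ crossMul Ψ) =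
        (TensorProduct.mk k _ _).compr₂
          (crossMul Ψ ∘ₗ LinearMap.rTensor (V ⊗[k] V) (b.comulStep C q i)) := by
      apply b.linearMap_ext_wt₂ b.toGradedGen
      intro β γ v w hv hw
      apply b.linearMap_ext_wt₂ b.toGradedGen
      intro β' γ' v' w' hv' hw'
      simp [crossMul, hΨ γ β' w v' hw hv', b.comulStep_tmul, TensorProduct.add_tmul,
        hΨ _ β' _ v' ((b.isWt_gen i).mul hw) hv', zpow_add₀, hv'.chi, mul_smul, mul_assoc,
        ← TensorProduct.smul_tmul']
      rw [smul_comm]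
    exact LinearMap.congr_fun (LinearMap.congr_fun this z) z'
  induction v using b.induction with
  | one => rw [one_mul, b.comul_one, one]
  | gen_mul i v hv => rw [mul_assoc, b.comul_gen_mul, hv, b.comul_gen_mul, step]
  | add v w hv hw => rw [add_mul, map_add, hv, hw, map_add, TensorProduct.add_tmul, map_add]
  | smul a v hv =>
    rw [smul_mul_assoc, map_smul, hv, map_smul, ← TensorProduct.smul_tmul', map_smul]

/-- The braided Hopf structure, for every map that is the braiding on homogeneous elements. -/
def braidedHopf (Ψ : V ⊗[k] V →ₗ[k] V ⊗[k] V) (hΨ : b.IsBraiding Ψ) : BraidedHopf k V Ψ where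
  comul := b.comul
  counit := b.counit
  antipode := b.antipode
  coassoc := b.coassoc
  counit_left := b.counit_left
  counit_right := b.counit_right
  comul_one := b.comul_one
  comul_mul := b.comul_mul hΨ
  antipode_left := b.antipode_left
  antipode_right := b.antipode_right

/-- The codiagonal coaction on `V ⊗ V`. -/
def coact₂ : V ⊗[k] V →ₗ[k] AddMonoidAlgebra k (I →₀ ℤ) ⊗[k] (V ⊗[k] V) :=
  LinearMap.rTensor (V ⊗[k] V) (LinearMap.mul' k _)
      ∘ₗ (TensorProduct.tensorTensorTensorComm k _ V _ V).toLinearMap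
      ∘ₗ TensorProduct.map b.coact.toLinearMap b.coact.toLinearMap

theorem comul_covariant : b.coact₂ ∘ₗ b.comul =
    LinearMap.lTensor _ b.comul ∘ₗ b.coact.toLinearMap := by
  -- `comulStep` raises the total degree by `i`: it adds a letter to one leg, and twists preserve
  -- degree.
  have step : ∀ i (z : V ⊗[k] V), b.coact₂ (b.comulStep C q i z) =
      TensorProduct.map (LinearMap.mulLeft k (gElt k i)) (b.comulStep C q i) (b.coact₂ z) := by
    intro i z
    have : b.coact₂ ∘ₗ b.comulStep C q i =
        TensorProduct.map (LinearMap.mulLeft k (gElt k i)) (b.comulStep C q i) ∘ₗ b.coact₂ := by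
      apply b.linearMap_ext_wt₂ b.toGradedGen
      intro β γ v w hv hw
      have h1 := (b.isWt_gen i).mul hv
      have h2 := (b.isWt_gen i).mul hw
      have h3 := b.isWt_chi C q hv (Finsupp.single i 1)
      simp only [GradedGen.IsWt] at hv hw h1 h2 h3
      simp only [coact₂, LinearMap.comp_apply, b.comulStep_tmul, map_add, TensorProduct.map_tmul,
        AlgHom.toLinearMap_apply, hv, hw, h1, h2, h3, LinearEquiv.coe_coe,
        TensorProduct.tensorTensorTensorComm_tmul, LinearMap.rTensor_tmul, LinearMap.mul'_apply,
        AddMonoidAlgebra.single_mul_single, LinearMap.mulLeft_apply, TensorProduct.tmul_add,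
        one_mul, add_assoc, add_left_comm β]
    exact LinearMap.congr_fun this z
  apply b.linearMap_ext_words
  · have h := b.isWt_one
    simp only [GradedGen.IsWt] at h
    simp [b.comul_one, coact₂, h]
  · intro i β v hv h
    have h1 := (b.isWt_gen i).mul hv
    simp only [GradedGen.IsWt] at hv h1
    simp only [LinearMap.comp_apply, AlgHom.toLinearMap_apply, hv, h1, LinearMap.lTensor_tmul,
      b.comul_gen_mul, step] at h ⊢
    rw [h]
    simp [AddMonoidAlgebra.single_mul_single]

theorem counit_covariant (v : V) :
    LinearMap.lTensor _ b.counit.toLinearMap (b.coact v) = (1 : AddMonoidAlgebra k (I →₀ ℤ)) ⊗ₜ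
      b.counit v := by
  have : (Algebra.TensorProduct.map (AlgHom.id k _) b.counit).comp b.coact =
      Algebra.TensorProduct.includeRight.comp b.counit := by
    apply b.algHom_ext
    intro i
    simp [b.coact_gen, b.counit_gen]
  exact AlgHom.congr_fun this v

end BraidedWords

end Words

/-! ### Skew derivations -/

section Derivations

variable {k : Type*} [Field k] {I : Type*} {V : Type*} [Ring V] [Algebra k V]
  {C : LusztigCartanDatum I} {q : kˣ}

namespace BraidedWords

variable (b : BraidedWords C q V)

/-- A functional which vanishes on all words but the letter `i`. -/
structure IsLetter (φ : V →ₗ[k] k) (i : I) : Prop where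
  one : φ 1 = 0
  gen_mul : ∀ j v, φ (b.gen j * v) = φ (b.gen j) * b.counit v
  gen_ne : ∀ j, j ≠ i → φ (b.gen j) = 0

/-- The left skew derivation `v ↦ φ(v₁) v₂`. -/
def lder (φ : V →ₗ[k] k) : V →ₗ[k] V :=
  (TensorProduct.lid k V).toLinearMap ∘ₗ LinearMap.rTensor V φ ∘ₗ b.comul

/-- The right skew derivation `v ↦ v₁ φ(v₂)`. -/
def rder (φ : V →ₗ[k] k) : V →ₗ[k] V :=
  (TensorProduct.rid k V).toLinearMap ∘ₗ LinearMap.lTensor V φ ∘ₗ b.comul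

variable {b} {φ : V →ₗ[k] k} {i : I} (hφ : b.IsLetter φ i)

theorem counit_smul (v : V) : TensorProduct.lid k V
    (LinearMap.rTensor V b.counit.toLinearMap (b.comul v)) = v :=
  LinearMap.congr_fun b.counit_left v

theorem smul_counit (v : V) : TensorProduct.rid k V
    (LinearMap.lTensor V b.counit.toLinearMap (b.comul v)) = v :=
  LinearMap.congr_fun b.counit_right v

namespace IsLetter

include hφ

theorem twist (ψ : AddMonoidAlgebra k (I →₀ ℤ) →ₐ[k] k) (v : V) :
    φ (b.twist ψ v) = ψ (gElt k i) * φ v := by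
  have : φ ∘ₗ (b.twist ψ).toLinearMap = ψ (gElt k i) • φ := by
    apply b.linearMap_ext
    · simp [hφ.one]
    · intro j v _
      by_cases h : j = i
      · subst h
        simp [hφ.gen_mul _ v, hφ.gen_mul]
      · simp [hφ.gen_mul _ v, hφ.gen_mul, hφ.gen_ne j h]
  exact LinearMap.congr_fun this v

theorem chi (β : I →₀ ℤ) (v : V) :
    φ (b.chi C q β v) = (q : k) ^ C.form β (Finsupp.single i 1) * φ v := by
  rw [hφ.twist, C.formChar_single]

theorem lder_one : b.lder φ 1 = 0 := by
  simp [lder, b.comul_one, hφ.one]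

theorem rder_one : b.rder φ 1 = 0 := by
  simp [rder, b.comul_one, hφ.one]

/-- In the first term of `comulStep`, `φ` sees the new letter only if that letter is the whole first
leg. In the second term the twist of the first leg contributes `q ^ (j · i)`, as `φ` is supported in
degree `i`. -/
theorem lder_gen_mul (j : I) (v : V) : b.lder φ (b.gen j * v) = φ (b.gen j) • v +
    (q : k) ^ C.form (Finsupp.single j 1) (Finsupp.single i 1) • (b.gen j * b.lder φ v) := by
  simp only [lder, LinearMap.comp_apply, LinearEquiv.coe_coe, b.comul_gen_mul]
  nth_rewrite 2 [← b.counit_smul v]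
  generalize b.comul v = z
  induction z with
  | zero => simp
  | add x y hx hy => simp only [map_add, hx, hy, mul_add, smul_add]; abel
  | tmul x y => simp [b.comulStep_tmul, hφ.gen_mul _ x, hφ.chi, mul_smul]

theorem rder_gen_mul (j : I) (v : V) : b.rder φ (b.gen j * v) = b.gen j * b.rder φ v +
    φ (b.gen j) • b.chi C q (Finsupp.single i 1) v := by
  have h : b.rder φ (b.gen j * v) = b.gen j * b.rder φ v +
      φ (b.gen j) • b.chi C q (Finsupp.single j 1) v := by
    simp only [rder, LinearMap.comp_apply, LinearEquiv.coe_coe, b.comul_gen_mul]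
    nth_rewrite 3 [← b.smul_counit v]
    generalize b.comul v = z
    induction z with
    | zero => simp
    | add x y hx hy => simp only [map_add, hx, hy, mul_add, smul_add]; abel
    | tmul x y => simp [b.comulStep_tmul, hφ.gen_mul _ y, mul_smul]
  -- The coproduct yields the twist by `j`; it may be written with `i` because `φ` kills all other
  -- letters.
  by_cases hj : j = i
  · rw [h, hj]
  · rw [h, hφ.gen_ne j hj, zero_smul, zero_smul]

theorem lder_twist (ψ : AddMonoidAlgebra k (I →₀ ℤ) →ₐ[k] k) (v : V) :
    b.lder φ (b.twist ψ v) = ψ (gElt k i) • b.twist ψ (b.lder φ v) := by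
  simp only [lder, LinearMap.comp_apply, LinearEquiv.coe_coe, b.comul_twist]
  generalize b.comul v = z
  induction z with
  | zero => simp
  | add x y hx hy => simp only [map_add, hx, hy, smul_add]
  | tmul x y => simp [hφ.twist, mul_smul]

theorem rder_twist (ψ : AddMonoidAlgebra k (I →₀ ℤ) →ₐ[k] k) (v : V) :
    b.rder φ (b.twist ψ v) = ψ (gElt k i) • b.twist ψ (b.rder φ v) := by
  simp only [rder, LinearMap.comp_apply, LinearEquiv.coe_coe, b.comul_twist]
  generalize b.comul v = z
  induction z with
  | zero => simp
  | add x y hx hy => simp only [map_add, hx, hy, smul_add]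
  | tmul x y => simp [hφ.twist, mul_smul]

theorem lder_chi (β : I →₀ ℤ) (v : V) : b.lder φ (b.chi C q β v) =
    (q : k) ^ C.form β (Finsupp.single i 1) • b.chi C q β (b.lder φ v) := by
  rw [hφ.lder_twist, C.formChar_single]

theorem rder_chi (β : I →₀ ℤ) (v : V) : b.rder φ (b.chi C q β v) =
    (q : k) ^ C.form β (Finsupp.single i 1) • b.chi C q β (b.rder φ v) := by
  rw [hφ.rder_twist, C.formChar_single]

/-- The Leibniz rule at the other end of a word, needed because the antipodes append letters at the
end. -/
theorem lder_mul_gen (j : I) (v : V) : b.lder φ (v * b.gen j) = b.lder φ v * b.gen j +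
    φ (b.gen j) • b.chi C q (Finsupp.single i 1) v := by
  induction v using b.induction with
  | one => simpa [hφ.lder_one] using hφ.lder_gen_mul j 1
  | gen_mul m v hv =>
    rw [mul_assoc, hφ.lder_gen_mul, hv, hφ.lder_gen_mul, map_mul, b.chi_gen,
      C.symm (Finsupp.single m 1)]
    simp only [mul_add, add_mul, smul_add, smul_mul_assoc, mul_smul_comm, mul_assoc, add_assoc]
    rw [smul_comm (φ (b.gen j))]
  | add v w hv hw => simp only [add_mul, map_add, hv, hw, smul_add]; abel
  | smul a v hv => simp only [smul_mul_assoc, map_smul, hv, smul_add, smul_comm a]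

/-- `antipodeInv` reverses words, so removing a first letter after it amounts to removing a last
letter before it, up to a sign and a power of `q`. -/
theorem lder_antipodeInv (v : V) : b.lder φ (b.antipodeInv v) =
    -b.chi C q (-Finsupp.single i 1) (b.antipodeInv (b.rder φ v)) := by
  induction v using b.induction with
  | one => simp [b.antipodeInv_one, hφ.lder_one, hφ.rder_one]
  | gen_mul j v hv =>
    rw [b.antipodeInv_gen_mul, map_neg, hφ.lder_mul_gen, hφ.lder_chi, hv, hφ.rder_gen_mul,
      map_add, map_smul, b.antipodeInv_gen_mul, ← b.twist_map b.antipodeInv_covariant]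
    by_cases hj : j = i
    · subst hj
      simp only [map_neg, map_add, map_mul, map_smul, b.chi_gen, b.chi_chi, neg_add_cancel,
        add_neg_cancel, b.chi_zero, LinearMap.neg_apply]
      simp
    · simp only [map_neg, map_mul, b.chi_gen, b.chi_chi, hφ.gen_ne j hj,
        zero_smul, add_zero, LinearMap.neg_apply, C.symm (Finsupp.single j 1),
        add_comm (-Finsupp.single j (1 : ℤ))]
      simp
  | add v w hv hw => simp only [map_add, hv, hw, neg_add]
  | smul a v hv => simp [hv]

/-- A derivation lowers the degree by `i`. Placing `gElt k i` on the side of the derivative avoids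
its inverse and suits an induction on words. -/
theorem coact_lder (v : V) : LinearMap.lTensor _ (b.lder φ) (b.coact v) =
    gElt k i ⊗ₜ 1 * b.coact (b.lder φ v) := by
  have : LinearMap.lTensor _ (b.lder φ) ∘ₗ b.coact.toLinearMap =
      LinearMap.mulLeft k (gElt k i ⊗ₜ 1) ∘ₗ b.coact.toLinearMap ∘ₗ b.lder φ := by
    apply b.linearMap_ext_words
    · simp [hφ.lder_one, Algebra.TensorProduct.one_def]
    · intro j β v hv h
      have h1 := (b.isWt_gen j).mul hv
      simp only [GradedGen.IsWt] at hv h1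
      simp only [LinearMap.comp_apply, AlgHom.toLinearMap_apply, h1, hv, LinearMap.lTensor_tmul,
        LinearMap.mulLeft_apply, hφ.lder_gen_mul, map_add, map_smul, map_mul, b.coact_gen,
        TensorProduct.tmul_add, TensorProduct.tmul_smul] at h ⊢
      congr 1
      · by_cases hj : j = i
        · simp [hj, AddMonoidAlgebra.single_mul_single]
        · simp [hφ.gen_ne j hj]
      · congr 1
        rw [← mul_assoc, Algebra.TensorProduct.tmul_mul_tmul, mul_comm (gElt k i),
          one_mul, ← mul_one (b.gen j), ← one_mul (gElt k i),
          ← Algebra.TensorProduct.tmul_mul_tmul, mul_one, one_mul, mul_assoc, ← h]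
        simp [AddMonoidAlgebra.single_mul_single]
  exact LinearMap.congr_fun this v

omit hφ in
-- Coassociativity: on both sides `φ` is applied to the first leg of the two-fold coproduct.
theorem comul_lder (v : V) :
    b.comul (b.lder φ v) = LinearMap.rTensor V (b.lder φ) (b.comul v) := by
  have h1 : ∀ z, b.comul (TensorProduct.lid k V (LinearMap.rTensor V φ z)) =
      TensorProduct.lid k _ (LinearMap.rTensor _ φ (LinearMap.lTensor V b.comul z)) := fun z =>
    LinearMap.congr_fun (f := b.comul ∘ₗ (TensorProduct.lid k V).toLinearMap ∘ₗ
      LinearMap.rTensor V φ) (g := (TensorProduct.lid k _).toLinearMap ∘ₗ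
        LinearMap.rTensor _ φ ∘ₗ LinearMap.lTensor V b.comul) (by ext; simp) z
  have h2 : ∀ z, TensorProduct.lid k _ (LinearMap.rTensor _ φ (TensorProduct.assoc k V V V z)) =
      LinearMap.rTensor V ((TensorProduct.lid k V).toLinearMap ∘ₗ LinearMap.rTensor V φ) z :=
    fun z => LinearMap.congr_fun (f := (TensorProduct.lid k _).toLinearMap ∘ₗ
      LinearMap.rTensor _ φ ∘ₗ (TensorProduct.assoc k V V V).toLinearMap)
        (by ext; simp [TensorProduct.smul_tmul']) z
  have h := LinearMap.congr_fun b.coassoc v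
  simp only [LinearMap.comp_apply, LinearEquiv.coe_coe] at h
  simp only [lder, LinearMap.comp_apply, LinearEquiv.coe_coe, h1, ← h, h2,
    ← LinearMap.rTensor_comp_apply, LinearMap.comp_assoc]

omit hφ in
-- Coassociativity with `φ` on the middle leg. By this identity a derivation moves between
-- neighbouring factors in the cross relation.
theorem lTensor_lder_comul (v : V) : LinearMap.lTensor V (b.lder φ) (b.comul v) =
    LinearMap.rTensor V (b.rder φ) (b.comul v) := by
  have h2 : ∀ z, LinearMap.lTensor V ((TensorProduct.lid k V).toLinearMap ∘ₗ
        LinearMap.rTensor V φ) (TensorProduct.assoc k V V V z) =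
      LinearMap.rTensor V ((TensorProduct.rid k V).toLinearMap ∘ₗ LinearMap.lTensor V φ) z :=
    fun z => LinearMap.congr_fun (f := LinearMap.lTensor V ((TensorProduct.lid k V).toLinearMap ∘ₗ
      LinearMap.rTensor V φ) ∘ₗ (TensorProduct.assoc k V V V).toLinearMap)
      (by ext; simp [TensorProduct.smul_tmul]) z
  have h := LinearMap.congr_fun b.coassoc v
  simp only [LinearMap.comp_apply, LinearEquiv.coe_coe] at h
  simp only [lder, rder, ← LinearMap.comp_assoc]
  rw [LinearMap.lTensor_comp_apply, ← h, h2, ← LinearMap.rTensor_comp_apply]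

theorem isWt_lder {β : I →₀ ℤ} {v : V} (hv : b.IsWt β v) :
    b.IsWt (β - Finsupp.single i 1) (b.lder φ v) := by
  have h := hφ.coact_lder v
  rw [GradedGen.IsWt] at hv ⊢
  rw [hv, LinearMap.lTensor_tmul] at h
  have h2 := congrArg (fun z => grp k (-Finsupp.single i (1 : ℤ)) ⊗ₜ[k] (1 : V) * z) h
  simp only [← mul_assoc, Algebra.TensorProduct.tmul_mul_tmul, one_mul,
    AddMonoidAlgebra.single_mul_single, neg_add_cancel, mul_one] at h2
  rw [← AddMonoidAlgebra.one_def, ← Algebra.TensorProduct.one_def, one_mul] at h2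
  rw [← h2, neg_add_eq_sub]

theorem coact_rder (v : V) : LinearMap.lTensor _ (b.rder φ) (b.coact v) =
    gElt k i ⊗ₜ 1 * b.coact (b.rder φ v) := by
  have : LinearMap.lTensor _ (b.rder φ) ∘ₗ b.coact.toLinearMap =
      LinearMap.mulLeft k (gElt k i ⊗ₜ 1) ∘ₗ b.coact.toLinearMap ∘ₗ b.rder φ := by
    apply b.linearMap_ext_words
    · simp [hφ.rder_one, Algebra.TensorProduct.one_def]
    · intro j β v hv h
      have h1 := (b.isWt_gen j).mul hv
      have h2 := b.isWt_chi C q hv (Finsupp.single i 1)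
      simp only [GradedGen.IsWt] at hv h1 h2
      simp only [LinearMap.comp_apply, AlgHom.toLinearMap_apply, h1, h2, hv,
        LinearMap.lTensor_tmul,
        LinearMap.mulLeft_apply, hφ.rder_gen_mul, map_add, map_smul, map_mul, b.coact_gen,
        TensorProduct.tmul_add, TensorProduct.tmul_smul] at h ⊢
      congr 1
      · rw [← mul_assoc, Algebra.TensorProduct.tmul_mul_tmul, mul_comm (gElt k i),
          one_mul, ← mul_one (b.gen j), ← one_mul (gElt k i),
          ← Algebra.TensorProduct.tmul_mul_tmul, mul_one, one_mul, mul_assoc, ← h]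
        simp [AddMonoidAlgebra.single_mul_single]
      · by_cases hj : j = i
        · simp [hj, AddMonoidAlgebra.single_mul_single]
        · simp [hφ.gen_ne j hj]
  exact LinearMap.congr_fun this v

theorem isWt_rder {β : I →₀ ℤ} {v : V} (hv : b.IsWt β v) :
    b.IsWt (β - Finsupp.single i 1) (b.rder φ v) := by
  have h := hφ.coact_rder v
  rw [GradedGen.IsWt] at hv ⊢
  rw [hv, LinearMap.lTensor_tmul] at h
  have h2 := congrArg (fun z => grp k (-Finsupp.single i (1 : ℤ)) ⊗ₜ[k] (1 : V) * z) h
  simp only [← mul_assoc, Algebra.TensorProduct.tmul_mul_tmul, one_mul,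
    AddMonoidAlgebra.single_mul_single, neg_add_cancel, mul_one] at h2
  rw [← AddMonoidAlgebra.one_def, ← Algebra.TensorProduct.one_def, one_mul] at h2
  rw [← h2, neg_add_eq_sub]

end IsLetter

end BraidedWords
end Derivations

/-! ### The pairing on the free algebra -/

section FreeWords

variable {k : Type*} [Field k] {I : Type*}

/-- The character of `k ℤ[I]` with prescribed values on the `gᵢ`. -/
def scaleChar (s : I → kˣ) : AddMonoidAlgebra k (I →₀ ℤ) →ₐ[k] k :=
  AddMonoidAlgebra.lift k k (I →₀ ℤ) ((Units.coeHom k).comp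
    (AddMonoidHom.toMultiplicativeLeft
      (Finsupp.liftAddHom fun i => zmultiplesHom (Additive kˣ) (Additive.ofMul (s i)))))

@[simp] theorem scaleChar_gElt (s : I → kˣ) (i : I) : scaleChar s (gElt k i) = s i := by
  simp [scaleChar]

variable (k I) in
/-- The free algebra, graded by content. -/
def freeGraded : GradedGen k I (FreeAlgebra k I) where
  gen := FreeAlgebra.ι k
  adjoin_gen := FreeAlgebra.adjoin_range_ι k I
  coact := FreeAlgebra.lift k fun i => gElt k i ⊗ₜ FreeAlgebra.ι k i
  coact_gen := fun _ => FreeAlgebra.lift_ι_apply _ _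

/-- The braided antipode on words, for the braiding given by powers of `q ^ s`. -/
def freeAntipode (C : LusztigCartanDatum I) (q : kˣ) (s : ℤ) :
    FreeAlgebra k I →ₗ[k] FreeAlgebra k I :=
  LinearMap.applyₗ 1 ∘ₗ
    (FreeAlgebra.lift k fun i : I =>
      (-(LinearMap.mulRight k (FreeAlgebra.ι k i) ∘ₗ
        ((freeGraded k I).chi C q (s • Finsupp.single i 1)).toLinearMap) :
        Module.End k (FreeAlgebra k I))).toLinearMap

variable (C : LusztigCartanDatum I) (q : kˣ)

/-- The free algebra with its braided coproduct. -/
def freeWords : BraidedWords C q (FreeAlgebra k I) where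
  toGradedGen := freeGraded k I
  comul := freeComul C (q : k)
  comul_one := by simp [freeComul]
  comul_gen_mul := by
    intro i v
    have h : FreeAlgebra.lift k (fun j : I => (q : k) ^ C.dot i j • FreeAlgebra.ι k j) =
        (freeGraded k I).chi C q (Finsupp.single i 1) := by
      apply (freeGraded k I).algHom_ext
      intro j
      rw [GradedGen.chi_gen]
      simp [freeGraded, LusztigCartanDatum.dot]
    have hg : (freeGraded k I).gen i = FreeAlgebra.ι k i := rfl
    simp [freeComul, h, GradedGen.comulStep, hg]
  counit := freeCounit
  counit_gen := fun i => by simp [freeGraded, freeCounit]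
  antipode := freeAntipode C q 1
  antipode_one := by simp [freeAntipode]
  antipode_gen_mul := fun i v => by
    have hg : (freeGraded k I).gen i = FreeAlgebra.ι k i := rfl
    simp [freeAntipode, hg]
  antipodeInv := freeAntipode C q (-1)
  antipodeInv_one := by simp [freeAntipode]
  antipodeInv_gen_mul := fun i v => by
    have hg : (freeGraded k I).gen i = FreeAlgebra.ι k i := rfl
    simp [freeAntipode, hg]

theorem freeWords_comul : (freeWords C q).comul = freeComul C (q : k) := rfl

theorem freeWords_counit : (freeWords C q).counit = freeCounit := rfl

theorem freeWords_gen (i : I) : (freeWords C q).gen i = FreeAlgebra.ι k i := rfl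

variable [DecidableEq I]

/-- The first component of the map to the dual numbers is the counit, so multiplication of dual
numbers gives the rule for `gen j * v`. -/
theorem freeCoord_isLetter (i : I) : (freeWords C q).IsLetter (freeCoord i) i where
  one := by simp [freeCoord]
  gen_mul := fun j v => by
    have h : (TrivSqZeroExt.fstHom k k k).comp (FreeAlgebra.lift k fun j : I =>
        if j = i then DualNumber.eps else (0 : DualNumber k)) = freeCounit := by
      ext j
      by_cases hj : j = i <;> simp [hj, freeCounit]
    have h2 := AlgHom.congr_fun h v
    simp only [AlgHom.comp_apply, TrivSqZeroExt.fstHom_apply] at h2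
    by_cases hj : j = i <;> simp [freeCoord, freeWords_gen, freeWords_counit, hj, h2]
  gen_ne := fun j hj => by simp [freeCoord, freeWords_gen, hj]

variable (c : I → k)

theorem freePairing_one_left : freePairing C (q : k) c 1 = freeCounit.toLinearMap := by
  simp [freePairing]

/-- Prepending a letter is adjoint to removing it from the front. Together with the value at `1`
this determines the pairing, and all its properties are deduced by induction from it. -/
theorem freePairing_gen_mul (i : I) (x b : FreeAlgebra k I) :
    freePairing C (q : k) c (FreeAlgebra.ι k i * x) b =
      c i * freePairing C (q : k) c x ((freeWords C q).lder (freeCoord i) b) := by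
  simp only [freePairing, LinearMap.comp_apply, AlgHom.toLinearMap_apply, map_mul,
    FreeAlgebra.lift_ι_apply, LinearMap.applyₗ_apply_apply, Module.End.mul_apply,
    BraidedWords.lder, freeWords_comul, LinearEquiv.coe_coe, LinearMap.dualMap_apply,
    TensorProduct.mk_apply]
  generalize freeComul C (q : k) b = z
  induction z with
  | zero => simp
  | add x y hx hy => simp only [map_add, hx, hy, mul_add]
  | tmul x y => simp [mul_assoc]

/-- The definition treats the two arguments differently; this restores the balance. After a letter
is stripped on each side, the two expansions agree because `i · j = j · i` and because letters
contract only with equal letters, where the factors `c` coincide. -/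
theorem freePairing_gen_mul_right (i : I) (x b : FreeAlgebra k I) :
    freePairing C (q : k) c x (FreeAlgebra.ι k i * b) =
      c i * freePairing C (q : k) c ((freeWords C q).lder (freeCoord i) x) b := by
  have hi := fun i => freeCoord_isLetter C q (k := k) i
  induction x using (freeWords C q).induction generalizing b with
  | one => simp [freePairing_one_left, (hi i).lder_one, freeCounit]
  | gen_mul j x hx =>
    rw [(hi i).lder_gen_mul, freeWords_gen, freePairing_gen_mul, ← freeWords_gen C q i,
      (hi j).lder_gen_mul]
    simp only [map_add, map_smul, LinearMap.add_apply, LinearMap.smul_apply, smul_eq_mul,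
      freeWords_gen, hx, freePairing_gen_mul, C.symm (Finsupp.single i 1)]
    by_cases hj : j = i
    · subst hj; ring
    · have h1 := (hi i).gen_ne j hj
      have h2 := (hi j).gen_ne i (Ne.symm hj)
      rw [freeWords_gen] at h1 h2
      rw [h1, h2]; ring
  | add x y hx hy => simp only [map_add, LinearMap.add_apply, hx, hy, mul_add]
  | smul a x hx =>
    simp only [map_smul, LinearMap.smul_apply, hx, smul_eq_mul]; ring

theorem freePairing_symm (x y : FreeAlgebra k I) :
    freePairing C (q : k) c x y = freePairing C (q : k) c y x := by
  induction x using (freeWords C q).induction generalizing y with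
  | one =>
    induction y using (freeWords C q).induction with
    | one => rfl
    | gen_mul j y _ =>
      rw [freeWords_gen, freePairing_gen_mul_right, freePairing_gen_mul,
        (freeCoord_isLetter C q j).lder_one]
      simp
    | add x y hx hy => simp only [map_add, LinearMap.add_apply, hx, hy]
    | smul a x hx => simp only [map_smul, LinearMap.smul_apply, hx]
  | gen_mul j x hx =>
    rw [freeWords_gen, freePairing_gen_mul_right, freePairing_gen_mul, hx]
  | add x y hx hy => simp only [map_add, LinearMap.add_apply, hx, hy]
  | smul a x hx => simp only [map_smul, LinearMap.smul_apply, hx]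

/-- The definition gives this when `x` is a letter. In the induction a letter of `x` becomes `lder`
on `b`, which passes to the first leg of the coproduct by `comul_lder`. -/
theorem freePairing_mul_left (x y b : FreeAlgebra k I) :
    freePairing C (q : k) c (x * y) b = LinearMap.mul' k k (TensorProduct.map
      (freePairing C (q : k) c x) (freePairing C (q : k) c y) (freeComul C (q : k) b)) := by
  induction x using (freeWords C q).induction generalizing b with
  | one =>
    rw [one_mul, freePairing_one_left]
    nth_rewrite 1 [← (freeWords C q).counit_smul b]
    rw [freeWords_comul, freeWords_counit]
    generalize freeComul C (q : k) b = z
    induction z with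
    | zero => simp
    | add x y hx hy => simp only [map_add, hx, hy]
    | tmul x y => simp
  | gen_mul j x hx =>
    rw [mul_assoc, freeWords_gen, freePairing_gen_mul, hx, ← freeWords_comul,
      BraidedWords.IsLetter.comul_lder]
    generalize (freeWords C q).comul b = z
    induction z with
    | zero => simp
    | add x y hx hy => simp only [map_add, hx, hy, mul_add]
    | tmul x y => simp [freePairing_gen_mul, mul_assoc]
  | add x y hx hy =>
    simp only [map_add, LinearMap.add_apply, hx, hy, add_mul, TensorProduct.map_add_left]
  | smul a x hx =>
    simp only [map_smul, LinearMap.smul_apply, hx, smul_mul_assoc, TensorProduct.map_smul_left]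

theorem freePairing_mul_right (x a b : FreeAlgebra k I) :
    freePairing C (q : k) c x (a * b) = LinearMap.mul' k k (TensorProduct.map
      ((freePairing C (q : k) c).flip a) ((freePairing C (q : k) c).flip b)
        (freeComul C (q : k) x)) := by
  have h : (freePairing C (q : k) c).flip = freePairing C (q : k) c := by
    exact LinearMap.ext₂ fun x y => freePairing_symm C q c y x
  rw [freePairing_symm, freePairing_mul_left, h]

theorem freePairing_twist (ψ : AddMonoidAlgebra k (I →₀ ℤ) →ₐ[k] k) (x b : FreeAlgebra k I) :
    freePairing C (q : k) c ((freeWords C q).twist ψ x) b =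
      freePairing C (q : k) c x ((freeWords C q).twist ψ b) := by
  induction x using (freeWords C q).induction generalizing b with
  | one => rw [map_one, freePairing_one_left]; exact ((freeWords C q).counit_twist ψ b).symm
  | gen_mul j x hx =>
    rw [map_mul, GradedGen.twist_gen, smul_mul_assoc, freeWords_gen, freePairing_gen_mul,
      (freeCoord_isLetter C q j).lder_twist, map_smul, map_smul, LinearMap.smul_apply,
      freePairing_gen_mul, hx]
    simp only [smul_eq_mul]; ring
  | add x y hx hy => simp only [map_add, LinearMap.add_apply, hx, hy]
  | smul a x hx => simp only [map_smul, LinearMap.smul_apply, hx]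

theorem freePairing_gen (i : I) :
    freePairing C (q : k) c (FreeAlgebra.ι k i) = c i • freeCoord i := by
  ext1 b
  rw [← mul_one (FreeAlgebra.ι k i), freePairing_gen_mul, freePairing_one_left,
    ← freeWords_counit C q]
  nth_rewrite 2 [← (freeWords C q).smul_counit b]
  simp only [BraidedWords.lder, LinearMap.comp_apply]
  generalize (freeWords C q).comul b = z
  induction z with
  | zero => simp
  | add x y hx hy => simp only [map_add, hx, hy, mul_add]
  | tmul x y => simp; ring

theorem freePairing_mul_gen (i : I) (x b : FreeAlgebra k I) :
    freePairing C (q : k) c (x * FreeAlgebra.ι k i) b =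
      c i * freePairing C (q : k) c x ((freeWords C q).rder (freeCoord i) b) := by
  rw [freePairing_mul_left, freePairing_gen]
  simp only [BraidedWords.rder, LinearMap.comp_apply, freeWords_comul]
  generalize freeComul C (q : k) b = z
  induction z with
  | zero => simp
  | add x y hx hy => simp only [map_add, hx, hy, mul_add]
  | tmul x y => simp; ring

/-- A letter in front of `x` ends up behind `antipodeInv x`, where it is adjoint to `rder`. By
`lder_antipodeInv` this matches `lder` applied to `antipodeInv b`, which is adjoint to a letter in
front. -/
theorem freePairing_antipodeInv (x b : FreeAlgebra k I) :
    freePairing C (q : k) c ((freeWords C q).antipodeInv x) b =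
      freePairing C (q : k) c x ((freeWords C q).antipodeInv b) := by
  induction x using (freeWords C q).induction generalizing b with
  | one =>
    rw [BraidedWords.antipodeInv_one, freePairing_one_left, ← freeWords_counit C q]
    induction b using (freeWords C q).induction with
    | one => simp [BraidedWords.antipodeInv_one]
    | gen_mul i b _ => simp [BraidedWords.antipodeInv_gen_mul, (freeWords C q).counit_gen]
    | add x y hx hy => simp only [map_add, hx, hy]
    | smul a x hx => simp only [map_smul, hx]
  | gen_mul j x hx =>
    rw [BraidedWords.antipodeInv_gen_mul, map_neg, LinearMap.neg_apply, freeWords_gen,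
      freePairing_mul_gen, freePairing_twist, hx, freePairing_gen_mul,
      (freeCoord_isLetter C q j).lder_antipodeInv, map_neg,
      GradedGen.twist_map _ (freeWords C q).antipodeInv_covariant, mul_neg]
  | add x y hx hy => simp only [map_add, LinearMap.add_apply, hx, hy]
  | smul a x hx => simp only [map_smul, LinearMap.smul_apply, hx]

/-- Components of different degrees are orthogonal. In the form with coactions this is an induction
on words: a letter contributes `gElt k j` on the left, and `coact_lder` contributes the same factor
on the right. -/
theorem freePairing_covariant (x b : FreeAlgebra k I) :
    TensorProduct.rid k _ (LinearMap.lTensor (AddMonoidAlgebra k (I →₀ ℤ))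
      ((freePairing C (q : k) c).flip b) ((freeWords C q).coact x)) =
    TensorProduct.rid k _ (LinearMap.lTensor (AddMonoidAlgebra k (I →₀ ℤ))
      (freePairing C (q : k) c x) ((freeWords C q).coact b)) := by
  induction x using (freeWords C q).induction generalizing b with
  | one =>
    rw [map_one, freePairing_one_left, ← freeWords_counit C q, BraidedWords.counit_covariant,
      freeWords_counit, Algebra.TensorProduct.one_def]
    simp [freePairing_one_left]
  | gen_mul j x hx =>
    have h1 : ∀ z, TensorProduct.rid k _ (LinearMap.lTensor (AddMonoidAlgebra k (I →₀ ℤ))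
      ((freePairing C (q : k) c).flip b) ((gElt k j ⊗ₜ FreeAlgebra.ι k j) * z)) =
        gElt k j * c j • TensorProduct.rid k _ (LinearMap.lTensor (AddMonoidAlgebra k (I →₀ ℤ))
          ((freePairing C (q : k) c).flip ((freeWords C q).lder (freeCoord j) b)) z) := by
      intro z
      induction z with
      | zero => simp
      | add x y hx hy => simp only [map_add, mul_add, smul_add, hx, hy]
      | tmul x y => simp [freePairing_gen_mul, smul_smul]
    have h2 : freePairing C (q : k) c (FreeAlgebra.ι k j * x) =
        c j • freePairing C (q : k) c x ∘ₗ (freeWords C q).lder (freeCoord j) := by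
      ext1 b; simp [freePairing_gen_mul]
    have h3 : ∀ z, TensorProduct.rid k _ (LinearMap.lTensor (AddMonoidAlgebra k (I →₀ ℤ))
      (freePairing C (q : k) c x) ((gElt k j ⊗ₜ 1) * z)) =
        gElt k j * TensorProduct.rid k _ (LinearMap.lTensor (AddMonoidAlgebra k (I →₀ ℤ))
          (freePairing C (q : k) c x) z) := by
      intro z
      induction z with
      | zero => simp
      | add x y hx hy => simp only [map_add, mul_add, hx, hy]
      | tmul x y => simp
    rw [map_mul, GradedGen.coact_gen, freeWords_gen, h1, h2, hx, LinearMap.lTensor_smul,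
      LinearMap.smul_apply, LinearMap.lTensor_comp_apply,
      (freeCoord_isLetter C q j).coact_lder, map_smul, h3, mul_smul_comm]
  | add x y hx hy =>
    simp only [map_add, hx, hy, LinearMap.lTensor_add, LinearMap.add_apply]
  | smul a x hx =>
    simp only [map_smul, hx, LinearMap.lTensor_smul, LinearMap.smul_apply]

/-- Changing the values on letters by units amounts to an automorphism of the second argument, which
is why the radical does not depend on such a change. -/
theorem freePairing_rescale (s : I → kˣ) (x b : FreeAlgebra k I) :
    freePairing C (q : k) (fun i => s i * c i) x b =
      freePairing C (q : k) c x ((freeWords C q).twist (scaleChar s) b) := by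
  induction x using (freeWords C q).induction generalizing b with
  | one =>
    rw [freePairing_one_left, freePairing_one_left]
    exact ((freeWords C q).counit_twist _ b).symm
  | gen_mul j x hx =>
    rw [freeWords_gen, freePairing_gen_mul, hx, freePairing_gen_mul,
      (freeCoord_isLetter C q j).lder_twist, map_smul, scaleChar_gElt, smul_eq_mul]
    ring
  | add x y hx hy => simp only [map_add, LinearMap.add_apply, hx, hy]
  | smul a x hx => simp only [map_smul, LinearMap.smul_apply, hx]

theorem radical_rescale (s : I → kˣ) (x : FreeAlgebra k I) :
    (∀ b, freePairing C (q : k) (fun i => s i * c i) x b = 0) ↔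
      ∀ b, freePairing C (q : k) c x b = 0 := by
  constructor
  · intro h b
    -- The original pairing is recovered from the rescaled one by the inverse units.
    have := freePairing_rescale C q (fun i => s i * c i) (fun i => (s i)⁻¹) x b
    simp only [← mul_assoc, Units.inv_mul, one_mul] at this
    rw [this, h]
  · intro h b
    rw [freePairing_rescale, h]

end FreeWords

/-! ### Kernels in tensor products detected by functionals -/

section Separation

variable {k : Type*} [Field k] {F V X : Type*} [AddCommGroup F] [Module k F] [AddCommGroup V]
  [Module k V] [AddCommGroup X] [Module k X] {ι : Type*} {π : F →ₗ[k] V} {p : ι → F →ₗ[k] k}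

theorem equivFinsuppOfBasisLeft_lTensor {κ : Type*} [DecidableEq κ] (ℬ : Module.Basis κ k X)
    (f : F →ₗ[k] V) (z : X ⊗[k] F) (i : κ) :
    TensorProduct.equivFinsuppOfBasisLeft ℬ (LinearMap.lTensor X f z) i =
      f (TensorProduct.equivFinsuppOfBasisLeft ℬ z i) := by
  induction z with
  | zero => simp
  | add x y hx hy => simp only [map_add, Finsupp.add_apply, hx, hy]
  | tmul x y => simp

/-- Functionals which detect the kernel of `π` also detect the kernel of `X ⊗ π`. -/
theorem lTensor_eq_zero_of_forall (hπ : ∀ x, (∀ b, p b x = 0) → π x = 0) (z : X ⊗[k] F)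
    (hz : ∀ b, LinearMap.lTensor X (p b) z = 0) : LinearMap.lTensor X π z = 0 := by
  classical
  -- A basis of `X` turns `X ⊗ F` into finitely supported families in `F`, on which the claim is
  -- checked coefficient by coefficient.
  let ℬ := Module.Basis.ofVectorSpace k X
  apply (TensorProduct.equivFinsuppOfBasisLeft (N := V) ℬ).injective
  ext i
  rw [equivFinsuppOfBasisLeft_lTensor, map_zero, Finsupp.zero_apply]
  apply hπ
  intro b
  rw [← equivFinsuppOfBasisLeft_lTensor, hz, map_zero, Finsupp.zero_apply]

/-- One leg is treated at a time: contracting the second leg with `p b` leaves a vector which all `p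
a` kill, hence one in the kernel of `π`. This is how the radical is seen to be a coideal. -/
theorem map_eq_zero_of_forall (hπ : ∀ x, π x = 0 ↔ ∀ b, p b x = 0) (z : F ⊗[k] F)
    (hz : ∀ a b, LinearMap.mul' k k (TensorProduct.map (p a) (p b) z) = 0) :
    TensorProduct.map π π z = 0 := by
  have h : TensorProduct.map π π z = LinearMap.lTensor V π (LinearMap.rTensor F π z) := by
    rw [← LinearMap.comp_apply, LinearMap.lTensor_comp_rTensor]
  rw [h]
  apply lTensor_eq_zero_of_forall (fun x => (hπ x).2)
  intro b
  have h1 : π (TensorProduct.rid k F (LinearMap.lTensor F (p b) z)) = 0 := by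
    rw [hπ]
    intro a
    rw [← hz a b]
    generalize z = z
    induction z with
    | zero => simp
    | add x y hx hy => simp only [map_add, hx, hy]
    | tmul x y => simp [mul_comm]
  apply (TensorProduct.rid k V).injective
  rw [map_zero, ← h1]
  generalize z = z
  induction z with
  | zero => simp
  | add x y hx hy => simp only [map_add, hx, hy]
  | tmul x y => simp

end Separation

/-! ### Quotients by the radical -/

section Nichols

variable {k : Type*} [Field k] {I : Type*} [DecidableEq I] {C : LusztigCartanDatum I} {q : kˣ}
  {c : I → k} {V : Type*} [Ring V] [Algebra k V]

/-- A quotient of the free algebra by the radical of the pairing. -/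
structure Nichols (C : LusztigCartanDatum I) (q : kˣ) (c : I → k) (V : Type*) [Ring V]
    [Algebra k V] where
  π : FreeAlgebra k I →ₐ[k] V
  surjective : Function.Surjective π
  ker : ∀ x, π x = 0 ↔ ∀ b, freePairing C (q : k) c x b = 0

namespace Nichols

variable (N : Nichols C q c V)

open Classical in
/-- The linear map induced on the quotient (zero if `f` does not vanish on the kernel). -/
def descend {M : Type*} [AddCommGroup M] [Module k M] (f : FreeAlgebra k I →ₗ[k] M) : V →ₗ[k] M :=
  if h : LinearMap.ker N.π.toLinearMap ≤ LinearMap.ker f then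
    (LinearMap.ker N.π.toLinearMap).liftQ f h ∘ₗ
      (N.π.toLinearMap.quotKerEquivOfSurjective N.surjective).symm.toLinearMap
  else 0

theorem descend_π {M : Type*} [AddCommGroup M] [Module k M] {f : FreeAlgebra k I →ₗ[k] M}
    (h : ∀ x, N.π x = 0 → f x = 0) (x : FreeAlgebra k I) : N.descend f (N.π x) = f x := by
  have h' : LinearMap.ker N.π.toLinearMap ≤ LinearMap.ker f := fun x hx => h x hx
  have : (N.π.toLinearMap.quotKerEquivOfSurjective N.surjective).symm (N.π x) =
      Submodule.Quotient.mk x := by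
    rw [LinearEquiv.symm_apply_eq]; rfl
  rw [descend, dif_pos h', LinearMap.comp_apply, LinearEquiv.coe_coe, this]
  rfl

/-- The algebra map induced on the quotient. -/
def descendAlg {M : Type*} [Ring M] [Algebra k M] (f : FreeAlgebra k I →ₐ[k] M)
    (h : ∀ x, N.π x = 0 → f x = 0) : V →ₐ[k] M :=
  AlgHom.ofLinearMap (N.descend f.toLinearMap)
    (by rw [← map_one N.π, N.descend_π h]; simp)
    (fun x y => by
      obtain ⟨x, rfl⟩ := N.surjective x
      obtain ⟨y, rfl⟩ := N.surjective y
      rw [← map_mul, N.descend_π h, N.descend_π h, N.descend_π h]; simp)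

theorem descendAlg_π {M : Type*} [Ring M] [Algebra k M] {f : FreeAlgebra k I →ₐ[k] M}
    (h : ∀ x, N.π x = 0 → f x = 0) (x : FreeAlgebra k I) : N.descendAlg f h (N.π x) = f x :=
  N.descend_π (f := f.toLinearMap) h x

/-- By covariance the coaction can be moved to the other argument of the pairing, where `x` itself
pairs to zero. -/
theorem coact_ker (x : FreeAlgebra k I) (hx : N.π x = 0) :
    ((Algebra.TensorProduct.map (AlgHom.id k (AddMonoidAlgebra k (I →₀ ℤ))) N.π).comp
      (freeWords C q).coact) x = 0 := by
  apply lTensor_eq_zero_of_forall (π := N.π.toLinearMap)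
    (p := fun b => (freePairing C (q : k) c).flip b) (fun x h => (N.ker x).2 h)
  intro b
  apply (TensorProduct.rid k _).injective
  have h0 : freePairing C (q : k) c x = 0 := LinearMap.ext ((N.ker x).1 hx)
  refine (freePairing_covariant C q c x b).trans ?_
  simp [h0]

/-- The grading of the quotient. -/
def graded : GradedGen k I V where
  gen := fun i => N.π (FreeAlgebra.ι k i)
  adjoin_gen := by
    have h : (Set.range fun i => N.π (FreeAlgebra.ι k i)) = N.π '' Set.range (FreeAlgebra.ι k) := by
      rw [← Set.range_comp]; rfl
    rw [h, ← N.π.map_adjoin, FreeAlgebra.adjoin_range_ι, Algebra.map_top]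
    exact (AlgHom.range_eq_top _).2 N.surjective
  coact := N.descendAlg _ N.coact_ker
  coact_gen := fun i => by
    rw [N.descendAlg_π N.coact_ker, AlgHom.comp_apply, ← freeWords_gen C q, GradedGen.coact_gen]
    simp

theorem coact_π (x : FreeAlgebra k I) : N.graded.coact (N.π x) =
    LinearMap.lTensor _ N.π.toLinearMap ((freeWords C q).coact x) :=
  N.descendAlg_π N.coact_ker x

theorem twist_π (φ : AddMonoidAlgebra k (I →₀ ℤ) →ₐ[k] k) (x : FreeAlgebra k I) :
    N.graded.twist φ (N.π x) = N.π ((freeWords C q).twist φ x) := by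
  have : (N.graded.twist φ).comp N.π = N.π.comp ((freeWords C q).twist φ) := by
    apply (freeWords C q).algHom_ext
    intro i
    rw [AlgHom.comp_apply, AlgHom.comp_apply, GradedGen.twist_gen, freeWords_gen, map_smul]
    exact N.graded.twist_gen φ i
  exact AlgHom.congr_fun this x

theorem antipodeInv_ker (x : FreeAlgebra k I) (hx : N.π x = 0) :
    N.π ((freeWords C q).antipodeInv x) = 0 := by
  rw [N.ker] at hx ⊢
  intro b
  rw [freePairing_antipodeInv, hx]

/-- The antipode is inverse to the self-adjoint map `antipodeInv`, so it preserves the radical as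
well. -/
theorem antipode_ker (x : FreeAlgebra k I) (hx : N.π x = 0) :
    N.π ((freeWords C q).antipode x) = 0 := by
  rw [N.ker] at hx ⊢
  intro b
  have h1 : (freeWords C q).antipodeInv ((freeWords C q).antipode b) = b :=
    LinearMap.congr_fun (freeWords C q).antipodeInv_comp_antipode b
  have h2 : (freeWords C q).antipodeInv ((freeWords C q).antipode x) = x :=
    LinearMap.congr_fun (freeWords C q).antipodeInv_comp_antipode x
  rw [← h1, ← freePairing_antipodeInv, h2, hx]

/-- Pairing `x` with a product `a b` evaluates its coproduct on `a ⊗ b`; for `x` in the radical all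
these values vanish. -/
theorem comul_ker (x : FreeAlgebra k I) (hx : N.π x = 0) :
    TensorProduct.map N.π.toLinearMap N.π.toLinearMap ((freeWords C q).comul x) = 0 := by
  apply map_eq_zero_of_forall (p := fun b => (freePairing C (q : k) c).flip b) N.ker
  intro a b
  rw [freeWords_comul, ← freePairing_mul_right]
  exact (N.ker x).1 hx _

/-- By symmetry the counit is the pairing with `1`. -/
theorem counit_ker (x : FreeAlgebra k I) (hx : N.π x = 0) : (freeWords C q).counit x = 0 := by
  have := (N.ker x).1 hx 1
  rw [freePairing_symm, freePairing_one_left] at this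
  exact this

/-- The braided structure of the quotient. -/
def words : BraidedWords C q V where
  toGradedGen := N.graded
  comul := N.descend (TensorProduct.map N.π.toLinearMap N.π.toLinearMap ∘ₗ (freeWords C q).comul)
  comul_one := by
    rw [← map_one N.π, N.descend_π N.comul_ker]
    simp [(freeWords C q).comul_one]
  comul_gen_mul := fun i v => by
    obtain ⟨v, rfl⟩ := N.surjective v
    have : N.graded.gen i * N.π v = N.π ((freeWords C q).gen i * v) := (map_mul N.π _ _).symm
    rw [this, N.descend_π N.comul_ker, N.descend_π N.comul_ker, LinearMap.comp_apply,
      LinearMap.comp_apply, BraidedWords.comul_gen_mul]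
    generalize (freeWords C q).comul v = z
    induction z with
    | zero => simp
    | add x y hx hy => simp only [map_add, hx, hy]
    | tmul x y =>
      simp only [GradedGen.comulStep_tmul, map_add, TensorProduct.map_tmul,
        AlgHom.toLinearMap_apply, map_mul, N.twist_π]
      rfl
  counit := N.descendAlg _ N.counit_ker
  counit_gen := fun i => (N.descendAlg_π N.counit_ker _).trans ((freeWords C q).counit_gen i)
  antipode := N.descend (N.π.toLinearMap ∘ₗ (freeWords C q).antipode)
  antipode_one := by
    rw [← map_one N.π, N.descend_π N.antipode_ker]
    simp [(freeWords C q).antipode_one]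
  antipode_gen_mul := fun i v => by
    obtain ⟨v, rfl⟩ := N.surjective v
    have : N.graded.gen i * N.π v = N.π ((freeWords C q).gen i * v) := (map_mul N.π _ _).symm
    rw [this, N.descend_π N.antipode_ker, N.descend_π N.antipode_ker, LinearMap.comp_apply,
      LinearMap.comp_apply, BraidedWords.antipode_gen_mul, AlgHom.toLinearMap_apply, map_neg,
      map_mul, ← N.twist_π]
    rfl
  antipodeInv := N.descend (N.π.toLinearMap ∘ₗ (freeWords C q).antipodeInv)
  antipodeInv_one := by
    rw [← map_one N.π, N.descend_π N.antipodeInv_ker]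
    simp [(freeWords C q).antipodeInv_one]
  antipodeInv_gen_mul := fun i v => by
    obtain ⟨v, rfl⟩ := N.surjective v
    have : N.graded.gen i * N.π v = N.π ((freeWords C q).gen i * v) := (map_mul N.π _ _).symm
    rw [this, N.descend_π N.antipodeInv_ker, N.descend_π N.antipodeInv_ker, LinearMap.comp_apply,
      LinearMap.comp_apply, BraidedWords.antipodeInv_gen_mul, AlgHom.toLinearMap_apply, map_neg,
      map_mul, ← N.twist_π]
    rfl

theorem words_gen (i : I) : N.words.gen i = N.π (FreeAlgebra.ι k i) := rfl

theorem words_coact (x : FreeAlgebra k I) : N.words.coact (N.π x) =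
    LinearMap.lTensor _ N.π.toLinearMap ((freeWords C q).coact x) :=
  N.coact_π x

theorem words_comul (x : FreeAlgebra k I) : N.words.comul (N.π x) =
    TensorProduct.map N.π.toLinearMap N.π.toLinearMap (freeComul C (q : k) x) :=
  N.descend_π N.comul_ker x

theorem words_counit (x : FreeAlgebra k I) : N.words.counit (N.π x) = freeCounit x :=
  N.descendAlg_π N.counit_ker x

variable {D B : Type*} [Ring D] [Algebra k D] [Ring B] [Algebra k B]
  (ND : Nichols C q c D) (NB : Nichols C q c B)

/-- The nondegenerate pairing of two copies of the quotient. -/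
def ev : D →ₗ[k] B →ₗ[k] k :=
  ND.descend (NB.descend (freePairing C (q : k) c).flip).flip

@[simp] theorem ev_π (x y : FreeAlgebra k I) :
    ND.ev NB (ND.π x) (NB.π y) = freePairing C (q : k) c x y := by
  have h : ∀ x, NB.π x = 0 → (freePairing C (q : k) c).flip x = 0 := fun x hx => by
    ext1 y
    rw [LinearMap.flip_apply, freePairing_symm]
    exact (NB.ker x).1 hx y
  rw [ev, ND.descend_π, LinearMap.flip_apply, NB.descend_π h, LinearMap.flip_apply]
  intro x hx
  ext1 y
  obtain ⟨y, rfl⟩ := NB.surjective y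
  rw [LinearMap.flip_apply, NB.descend_π h]
  exact (ND.ker x).1 hx y

theorem ev_symm (d : D) (b : B) : ND.ev NB d b = NB.ev ND b d := by
  obtain ⟨d, rfl⟩ := ND.surjective d
  obtain ⟨b, rfl⟩ := NB.surjective b
  rw [ev_π, ev_π, freePairing_symm]

theorem eq_zero_of_ev (d : D) (h : ∀ b, ND.ev NB d b = 0) : d = 0 := by
  obtain ⟨d, rfl⟩ := ND.surjective d
  rw [ND.ker]
  intro b
  rw [← ND.ev_π NB, h]

theorem ev_one_left (b : B) : ND.ev NB 1 b = NB.words.counit b := by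
  obtain ⟨b, rfl⟩ := NB.surjective b
  rw [← map_one ND.π, ev_π, freePairing_one_left, words_counit]
  rfl

theorem ev_mul_left (c' d : D) (b : B) : ND.ev NB (c' * d) b =
    LinearMap.mul' k k (TensorProduct.map (ND.ev NB c') (ND.ev NB d) (NB.words.comul b)) := by
  obtain ⟨b, rfl⟩ := NB.surjective b
  obtain ⟨c', rfl⟩ := ND.surjective c'
  obtain ⟨d, rfl⟩ := ND.surjective d
  rw [← map_mul, ev_π, freePairing_mul_left, words_comul]
  generalize freeComul C (q : k) b = z
  induction z with
  | zero => simp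
  | add x y hx hy => simp only [map_add, hx, hy]
  | tmul x y => simp

theorem ev_mul_right (d : D) (a b : B) : ND.ev NB d (a * b) =
    LinearMap.mul' k k (TensorProduct.map ((ND.ev NB).flip a) ((ND.ev NB).flip b)
      (ND.words.comul d)) := by
  have h : (ND.ev NB).flip = NB.ev ND := LinearMap.ext₂ fun x y => ev_symm ND NB y x
  rw [ev_symm, ev_mul_left, h]

theorem ev_covariant (d : D) (b : B) :
    TensorProduct.rid k _ (LinearMap.lTensor (AddMonoidAlgebra k (I →₀ ℤ))
      ((ND.ev NB).flip b) (ND.words.coact d)) =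
    TensorProduct.rid k _ (LinearMap.lTensor (AddMonoidAlgebra k (I →₀ ℤ))
      (ND.ev NB d) (NB.words.coact b)) := by
  obtain ⟨b, rfl⟩ := NB.surjective b
  obtain ⟨d, rfl⟩ := ND.surjective d
  have h1 : (ND.ev NB).flip (NB.π b) ∘ₗ ND.π.toLinearMap = (freePairing C (q : k) c).flip b := by
    ext1 x; simp
  have h2 : ND.ev NB (ND.π d) ∘ₗ NB.π.toLinearMap = freePairing C (q : k) c d := by
    ext1 x; simp
  rw [words_coact, words_coact, ← LinearMap.lTensor_comp_apply, ← LinearMap.lTensor_comp_apply,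
    h1, h2, freePairing_covariant]

/-- `c ↦ ⟨c, eᵢ⟩` vanishes on all words but `fᵢ`. -/
theorem ev_isLetter (i : I) : ND.words.IsLetter ((ND.ev NB).flip (NB.words.gen i)) i := by
  have h : ∀ x, (ND.ev NB).flip (NB.words.gen i) (ND.π x) = c i * freeCoord i x := by
    intro x
    rw [words_gen, LinearMap.flip_apply, ev_π, freePairing_symm, freePairing_gen]
    rfl
  have hg : ∀ j, ND.words.gen j = ND.π ((freeWords C q).gen j) := fun j => rfl
  have hi := freeCoord_isLetter C q (k := k) i
  refine ⟨?_, ?_, ?_⟩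
  · rw [← map_one ND.π, h, hi.one, mul_zero]
  · intro j v
    obtain ⟨v, rfl⟩ := ND.surjective v
    rw [hg, ← map_mul, h, h, hi.gen_mul, words_counit, mul_assoc]
    rfl
  · intro j hj
    rw [hg, h, hi.gen_ne j hj, mul_zero]

end Nichols

end Nichols

/-! ### Root data and the dual pair `(kY, k ℤ[I])` -/

section RootDatum

variable {k : Type*} [Field k] {I : Type*} {C : LusztigCartanDatum I}
  {Y X : Type*} [AddCommGroup Y] [AddCommGroup X]

/-- The identity by which the torus elements `K_i ^ (i · i / 2)` reproduce the symmetric form. Both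
divisions are exact, so they cancel. -/
theorem LusztigCartanDatum.half_mul_a (C : LusztigCartanDatum I) (i j : I) :
    C.half i * C.a i j = C.dot i j := by
  obtain ⟨m, hm⟩ := C.even i
  have hpos := C.pos i
  have hdvd : C.dot i i ∣ 2 * C.dot i j := by
    -- The divisibility axiom covers only `i ≠ j`; on the diagonal it is evident.
    by_cases h : i = j
    · subst h; exact Dvd.intro_left 2 rfl
    · exact C.dvd i j h
  obtain ⟨d, hd⟩ := hdvd
  have hm' : C.dot i i = 2 * m := hm
  have h0 : C.dot i i ≠ 0 := hpos.ne'
  rw [LusztigCartanDatum.half, LusztigCartanDatum.a, hd, Int.mul_ediv_cancel_left _ h0, hm',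
    Int.mul_ediv_cancel_left _ two_ne_zero]
  rw [hm', mul_assoc] at hd
  exact (mul_left_cancel₀ two_ne_zero hd).symm

namespace LusztigRootDatum

variable (T : LusztigRootDatum C Y X)

/-- The extension of `i ↦ i'` to `ℤ[I]`. -/
def rootHom : (I →₀ ℤ) →ₗ[ℤ] X := Finsupp.linearCombination ℤ T.root

/-- The extension of `i ↦ (i · i / 2) i` to `ℤ[I]`. -/
def tildeHom : (I →₀ ℤ) →ₗ[ℤ] Y := Finsupp.linearCombination ℤ T.tilde

@[simp] theorem rootHom_single (i : I) : T.rootHom (Finsupp.single i 1) = T.root i := by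
  simp [rootHom]

@[simp] theorem tildeHom_single (i : I) : T.tildeHom (Finsupp.single i 1) = T.tilde i := by
  simp [tildeHom]

theorem pairing_tilde_root (i j : I) : T.pairing (T.tilde i) (T.root j) =
    C.form (Finsupp.single i 1) (Finsupp.single j 1) := by
  rw [tilde, map_smul, LinearMap.smul_apply, T.pairing_coroot_root, smul_eq_mul, C.half_mul_a]
  rfl

theorem pairing_tildeHom_rootHom (β γ : I →₀ ℤ) :
    T.pairing (T.tildeHom β) (T.rootHom γ) = C.form β γ := by
  have : T.pairing.compl₁₂ T.tildeHom T.rootHom = C.form := by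
    ext i j
    simp [T.pairing_tilde_root]
  exact LinearMap.congr_fun₂ this β γ

/-- The character `g_β ↦ q ^ ⟨μ, β'⟩` of `k ℤ[I]`. -/
def weightChar (q : kˣ) (μ : Y) : AddMonoidAlgebra k (I →₀ ℤ) →ₐ[k] k :=
  AddMonoidAlgebra.lift k k (I →₀ ℤ)
    { toFun := fun γ => ((q ^ T.pairing μ (T.rootHom γ.toAdd) : kˣ) : k)
      map_one' := by simp
      map_mul' := fun a b => by simp [zpow_add] }

theorem weightChar_single (q : kˣ) (μ : Y) (β : I →₀ ℤ) :
    T.weightChar q μ (AddMonoidAlgebra.single β 1) = (q : k) ^ T.pairing μ (T.rootHom β) := by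
  simp [weightChar]

/-- This turns each action through `R` or `Rbar` into one of the automorphisms `chi`. -/
theorem weightChar_tildeHom (q : kˣ) (β : I →₀ ℤ) :
    T.weightChar q (T.tildeHom β) = C.formChar q β := by
  ext γ
  simp [T.weightChar_single, C.formChar_single, T.pairing_tildeHom_rootHom]

end LusztigRootDatum

theorem groupAlgebra_induction {G : Type*} {p : AddMonoidAlgebra k G → Prop}
    (x : AddMonoidAlgebra k G) (zero : p 0) (single : ∀ μ, p (AddMonoidAlgebra.single μ 1))
    (add : ∀ x y, p x → p y → p (x + y)) (smul : ∀ (a : k) x, p x → p (a • x)) : p x := by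
  induction x using AddMonoidAlgebra.induction_linear with
  | zero => exact zero
  | add x y hx hy => exact add x y hx hy
  | single μ r =>
    have := smul r _ (single μ)
    rwa [AddMonoidAlgebra.smul_single, smul_eq_mul, mul_one] at this

section DiffLinear

variable {H A : Type*} [Ring H] [HopfAlgebra k H] [Ring A] [HopfAlgebra k A]
  (pair : H →ₗ[k] A →ₗ[k] k) (a : k) (x y : H)

theorem diffL_add : diffL pair (x + y) = diffL pair x + diffL pair y := by
  simp only [diffL, map_add, LinearMap.comp_add]

theorem diffR_add : diffR pair (x + y) = diffR pair x + diffR pair y := by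
  simp only [diffR, map_add, LinearMap.comp_add]

theorem diffL_smul : diffL pair (a • x) = a • diffL pair x := by
  simp only [diffL, map_smul, LinearMap.comp_smul]

theorem diffR_smul : diffR pair (a • x) = a • diffR pair x := by
  simp only [diffR, map_smul, LinearMap.comp_smul]

end DiffLinear

theorem diffL_single {H A : Type*} [AddCommGroup H] [Ring A] [HopfAlgebra k A]
    (pair : AddMonoidAlgebra k H →ₗ[k] A →ₗ[k] k) (μ : H) (a : A) :
    diffL pair (AddMonoidAlgebra.single μ 1) a =
      pair (AddMonoidAlgebra.single μ 1) a • AddMonoidAlgebra.single μ 1 := by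
  simp [diffL]

theorem diffR_single {H A : Type*} [AddCommGroup H] [Ring A] [HopfAlgebra k A]
    (pair : AddMonoidAlgebra k H →ₗ[k] A →ₗ[k] k) (μ : H) (a : A) :
    diffR pair (AddMonoidAlgebra.single μ 1) a =
      pair (AddMonoidAlgebra.single μ 1) a • AddMonoidAlgebra.single μ 1 := by
  simp [diffR]

theorem conv_single {G H : Type*} [AddCommGroup G] [Ring H] [HopfAlgebra k H]
    (f g : AddMonoidAlgebra k G →ₗ[k] H) (β : G) : conv f g (AddMonoidAlgebra.single β 1) =
      f (AddMonoidAlgebra.single β 1) * g (AddMonoidAlgebra.single β 1) := by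
  simp [conv]

/-- The algebra map `g_β ↦ K_{s β}`. -/
abbrev groupHom (k : Type*) [Field k] {G Y : Type*} [AddCommGroup G] [AddCommGroup Y]
    (s : G →ₗ[ℤ] Y) : AddMonoidAlgebra k G →ₐ[k] AddMonoidAlgebra k Y :=
  AddMonoidAlgebra.mapDomainAlgHom k k s.toAddMonoidHom

theorem groupHom_comul {G Y : Type*} [AddCommGroup G] [AddCommGroup Y] (s : G →ₗ[ℤ] Y)
    (a : AddMonoidAlgebra k G) : Coalgebra.comul (R := k) (groupHom k s a) =
      TensorProduct.map (groupHom k s).toLinearMap (groupHom k s).toLinearMap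
        (TensorProduct.comm k _ _ (Coalgebra.comul a)) := by
  induction a using groupAlgebra_induction with
  | zero => simp
  | single μ => simp
  | add x y hx hy => simp only [map_add, hx, hy]
  | smul a x hx => simp only [map_smul, hx]

theorem groupHom_counit {G Y : Type*} [AddCommGroup G] [AddCommGroup Y] (s : G →ₗ[ℤ] Y)
    (a : AddMonoidAlgebra k G) : Coalgebra.counit (R := k) (groupHom k s a) =
      Coalgebra.counit (R := k) a := by
  induction a using groupAlgebra_induction with
  | zero => simp
  | single μ => simp
  | add x y hx hy => simp only [map_add, hx, hy]
  | smul a x hx => simp only [map_smul, hx]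

theorem groupHom_conv_neg {G Y : Type*} [AddCommGroup G] [AddCommGroup Y] (s : G →ₗ[ℤ] Y) :
    conv (groupHom k s).toLinearMap (groupHom k (-s)).toLinearMap = convOne := by
  ext β
  simp [conv, convOne, AddMonoidAlgebra.single_mul_single]

theorem groupHom_neg_conv {G Y : Type*} [AddCommGroup G] [AddCommGroup Y] (s : G →ₗ[ℤ] Y) :
    conv (groupHom k (-s)).toLinearMap (groupHom k s).toLinearMap = convOne := by
  simpa using groupHom_conv_neg (k := k) (-s)

/-- On a group-like element convolution is the product in the commutative algebra `kY`, so
conjugation does nothing; and the left and right differentials of a group-like element coincide. -/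
theorem diff_groupHom {G Y : Type*} [AddCommGroup G] [AddCommGroup Y] (s : G →ₗ[ℤ] Y)
    (pair : AddMonoidAlgebra k Y →ₗ[k] AddMonoidAlgebra k G →ₗ[k] k) (h : AddMonoidAlgebra k Y) :
    diffR pair h = conv (conv (groupHom k s).toLinearMap (diffL pair h))
      (groupHom k (-s)).toLinearMap := by
  apply AddMonoidAlgebra.lhom_ext'
  intro β
  ext1
  simp only [LinearMap.comp_apply, AddMonoidAlgebra.lsingle_apply, conv_single]
  induction h using groupAlgebra_induction with
  | zero => simp [diffL, diffR]
  | single μ =>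
    simp [diffL_single, diffR_single, AddMonoidAlgebra.single_mul_single]
  | add x y hx hy =>
    simp only [diffL_add, diffR_add, LinearMap.add_apply, hx, hy, mul_add, add_mul]
  | smul a x hx =>
    simp only [diffL_smul, diffR_smul, LinearMap.smul_apply, hx, mul_smul_comm, smul_mul_assoc]

variable (T : LusztigRootDatum C Y X) (q : kˣ)

/-- The pairing `⟨K_μ, g_β⟩ = q ^ ⟨μ, β'⟩`. -/
def groupPair : AddMonoidAlgebra k Y →ₗ[k] AddMonoidAlgebra k (I →₀ ℤ) →ₗ[k] k :=
  (AddMonoidAlgebra.basis Y k).constr k fun μ => (T.weightChar q μ).toLinearMap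

@[simp] theorem groupPair_single (μ : Y) :
    groupPair T q (AddMonoidAlgebra.single μ 1) = (T.weightChar q μ).toLinearMap := by
  rw [← AddMonoidAlgebra.basis_apply, groupPair, Module.Basis.constr_basis]

/-- The weakly quasitriangular dual pair `(kY, k ℤ[I])`. -/
def groupPairing : WeaklyQuasitriangular k (AddMonoidAlgebra k Y)
    (AddMonoidAlgebra k (I →₀ ℤ)) where
  pair := groupPair T q
  pair_one_left a := by
    rw [AddMonoidAlgebra.one_def, groupPair_single]
    induction a using groupAlgebra_induction with
    | zero => simp
    | single μ => simp [T.weightChar_single]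
    | add x y hx hy => simp only [map_add, hx, hy]
    | smul a x hx => simp only [map_smul, hx]
  pair_one_right h := by
    induction h using groupAlgebra_induction with
    | zero => simp
    | single μ => simp
    | add x y hx hy => simp only [map_add, LinearMap.add_apply, hx, hy]
    | smul a x hx => simp only [map_smul, LinearMap.smul_apply, hx]
  pair_mul_left g h a := by
    induction a using groupAlgebra_induction with
    | zero => simp
    | single β =>
      simp only [AddMonoidAlgebra.comul_single, CommSemiring.comul_apply, TensorProduct.map_tmul,
        AddMonoidAlgebra.lsingle_apply, LinearMap.mul'_apply]
      induction g using groupAlgebra_induction with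
      | zero => simp
      | single μ =>
        induction h using groupAlgebra_induction with
        | zero => simp
        | single ν =>
          simp [AddMonoidAlgebra.single_mul_single, T.weightChar_single, zpow_add₀]
        | add x y hx hy => simp only [map_add, mul_add, LinearMap.add_apply, hx, hy]
        | smul a x hx => simp only [map_smul, mul_smul_comm, LinearMap.smul_apply, hx]
      | add x y hx hy => simp only [map_add, add_mul, LinearMap.add_apply, hx, hy]
      | smul a x hx => simp only [map_smul, smul_mul_assoc, LinearMap.smul_apply, hx]
    | add x y hx hy => simp only [map_add, hx, hy]
    | smul a x hx => simp only [map_smul, hx]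
  pair_mul_right h a b := by
    induction h using groupAlgebra_induction with
    | zero => simp
    | single μ => simp
    | add x y hx hy => simp only [map_add, LinearMap.add_apply, hx, hy]
    | smul a x hx => simp only [map_smul, LinearMap.smul_apply, hx]
  R := groupHom k T.tildeHom
  Rbar := groupHom k (-T.tildeHom)
  R_counit := groupHom_counit _
  Rbar_counit := groupHom_counit _
  R_comul := groupHom_comul _
  Rbar_comul := groupHom_comul _
  -- On group-like elements the convolution inverse is obtained by negating the exponent. So it is
  -- the same map as `Rbar`, and `pair_Rbar` becomes the symmetry of the form.
  Rinv := (groupHom k (-T.tildeHom)).toLinearMap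
  Rbarinv := (groupHom k T.tildeHom).toLinearMap
  R_conv_Rinv := groupHom_conv_neg _
  Rinv_conv_R := groupHom_neg_conv _
  Rbar_conv_Rbarinv := groupHom_neg_conv _
  Rbarinv_conv_Rbar := groupHom_conv_neg _
  pair_Rbar a b := by
    induction a using groupAlgebra_induction with
    | zero => simp
    | single β =>
      induction b using groupAlgebra_induction with
      | zero => simp
      | single γ => simp [T.weightChar_single, T.pairing_tildeHom_rootHom, C.symm β]
      | add x y hx hy => simp only [map_add, LinearMap.add_apply, hx, hy]
      | smul a x hx => simp only [map_smul, LinearMap.smul_apply, hx]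
    | add x y hx hy => simp only [map_add, LinearMap.add_apply, hx, hy]
    | smul a x hx => simp only [map_smul, LinearMap.smul_apply, hx]
  diff_R := diff_groupHom _ _
  diff_Rbar h := by
    have := diff_groupHom (k := k) (-T.tildeHom) (groupPair T q) h
    rwa [neg_neg] at this

/-! ### Actions and twists on homogeneous elements -/

section Actions

variable {V : Type*} [Ring V] [Algebra k V] (g : GradedGen k I V)

/-- The right coaction obtained by flipping the left coaction. -/
def GradedGen.coactR : V →ₐ[k] V ⊗[k] AddMonoidAlgebra k (I →₀ ℤ) :=
  (Algebra.TensorProduct.comm k _ V).toAlgHom.comp g.coact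

theorem GradedGen.coactR_apply (v : V) :
    g.coactR v = TensorProduct.comm k _ V (g.coact v) := rfl

variable {g} in
theorem GradedGen.IsWt.coactR {β : I →₀ ℤ} {v : V} (hv : g.IsWt β v) :
    g.coactR v = v ⊗ₜ grp k β := by
  rw [GradedGen.IsWt] at hv
  rw [g.coactR_apply, hv]; rfl

theorem rightAct_single (v : V) (μ : Y) :
    rightAct (groupPairing T q) g.coact.toLinearMap (v ⊗ₜ AddMonoidAlgebra.single μ 1) =
      g.twist (T.weightChar q μ) v := by
  simp only [rightAct, LinearMap.comp_apply, LinearEquiv.coe_coe, TensorProduct.comm_tmul,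
    LinearMap.lTensor_tmul, AlgHom.toLinearMap_apply, GradedGen.twist, AlgHom.comp_apply]
  generalize g.coact v = z
  induction z with
  | zero => simp
  | add x y hx hy => simp only [TensorProduct.tmul_add, map_add, hx, hy]
  | tmul x y => simp [groupPairing]

theorem leftAct_single (v : V) (μ : Y) :
    leftAct (groupPairing T q) g.coactR.toLinearMap (AddMonoidAlgebra.single μ 1 ⊗ₜ v) =
      g.twist (T.weightChar q μ) v := by
  simp only [leftAct, LinearMap.comp_apply, LinearEquiv.coe_coe, TensorProduct.comm_tmul,
    LinearMap.rTensor_tmul, AlgHom.toLinearMap_apply, GradedGen.twist, AlgHom.comp_apply,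
    g.coactR_apply]
  generalize g.coact v = z
  induction z with
  | zero => simp
  | add x y hx hy => simp only [TensorProduct.add_tmul, map_add, hx, hy]
  | tmul x y => simp [groupPairing]

variable {g}

theorem twistL_tmul (s : (I →₀ ℤ) →ₗ[ℤ] Y) (v : V) {γ : I →₀ ℤ} {w : V} (hw : g.IsWt γ w) :
    twistL (groupPairing T q) g.coact.toLinearMap (groupHom k s).toLinearMap (v ⊗ₜ w) =
      g.twist (T.weightChar q (s γ)) v ⊗ₜ w := by
  rw [GradedGen.IsWt] at hw
  simp [twistL, hw, rightAct_single]

theorem twistR_tmul (s : (I →₀ ℤ) →ₗ[ℤ] Y) {β : I →₀ ℤ} {v : V} (hv : g.IsWt β v) (w : V) :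
    twistR (groupPairing T q) g.coactR.toLinearMap (groupHom k s).toLinearMap (v ⊗ₜ w) =
      v ⊗ₜ g.twist (T.weightChar q (s β)) w := by
  simp [twistR, hv.coactR, leftAct_single]

end Actions

/-! ### The braided groups and the input of the construction -/

section Input

variable {T q} {V : Type*} [Ring V] [Algebra k V] (b : BraidedWords C q V)

/-- `R` sends degree `γ` to the torus element `K̃_γ`, which acts on degree `β` by `q ^ (γ · β)`; the
left- and right-handed braidings agree because the form is symmetric. -/
theorem isBraiding_braidL (T : LusztigRootDatum C Y X) :
    b.IsBraiding (braidL (groupPairing T q) b.coact.toLinearMap) := by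
  intro β γ v w hv hw
  have := twistL_tmul T q T.tildeHom v hw
  rw [braidL, LinearMap.comp_apply]
  erw [this]
  rw [T.weightChar_tildeHom, hv.twist, C.formChar_single, C.symm]
  simp

theorem isBraiding_braidR (T : LusztigRootDatum C Y X) :
    b.IsBraiding (braidR (groupPairing T q) b.coactR.toLinearMap) := by
  intro β γ v w hv hw
  have := twistR_tmul T q T.tildeHom hv w
  rw [braidR, LinearMap.comp_apply]
  erw [this]
  rw [T.weightChar_tildeHom, hw.twist, C.formChar_single]
  simp

/-- The braided group in left comodules. -/
def BraidedWords.leftBraidedGroup (T : LusztigRootDatum C Y X) :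
    LeftBraidedGroup (groupPairing T q) V where
  coact := b.coact
  coact_coassoc := b.coact_coassoc
  coact_counit := b.coact_counit
  hopf := b.braidedHopf _ (isBraiding_braidL b T)
  comul_covariant := b.comul_covariant
  counit_covariant := b.counit_covariant
  antipode_covariant := b.antipode_covariant

/-- The braided group in right comodules. -/
def BraidedWords.rightBraidedGroup (T : LusztigRootDatum C Y X) :
    RightBraidedGroup (groupPairing T q) V where
  coact := b.coactR
  coact_coassoc := by
    apply b.linearMap_ext_wt
    intro β v hv
    simp [hv.coactR]
  coact_counit := by
    apply b.linearMap_ext_wt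
    intro β v hv
    simp [hv.coactR]
  hopf := b.braidedHopf _ (isBraiding_braidR b T)
  comul_covariant := by
    -- The right codiagonal coaction is the flip of the left one, so the right-handed axioms follow
    -- from the left-handed ones by flipping.
    have h1 : LinearMap.lTensor (V ⊗[k] V) (LinearMap.mul' k (AddMonoidAlgebra k (I →₀ ℤ)))
        ∘ₗ (TensorProduct.tensorTensorTensorComm k V _ V _).toLinearMap
        ∘ₗ TensorProduct.map b.coactR.toLinearMap b.coactR.toLinearMap =
        (TensorProduct.comm k _ _).toLinearMap ∘ₗ b.coact₂ := by
      apply b.linearMap_ext_wt₂ b.toGradedGen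
      intro β γ v w hv hw
      have hv' := hv.coactR
      have hw' := hw.coactR
      rw [GradedGen.IsWt] at hv hw
      simp [BraidedWords.coact₂, hv, hw, hv', hw']
    ext v
    have h2 := LinearMap.congr_fun b.comul_covariant v
    have h3 := LinearMap.congr_fun h1 (b.comul v)
    simp only [LinearMap.comp_apply] at h2 h3 ⊢
    refine h3.trans ?_
    rw [h2, AlgHom.toLinearMap_apply, AlgHom.toLinearMap_apply, b.coactR_apply]
    generalize b.coact v = z
    induction z with
    | zero => simp
    | add x y hx hy => simp only [map_add, hx, hy]
    | tmul x y => simp [BraidedWords.braidedHopf]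
  counit_covariant v := by
    rw [b.coactR_apply]
    have h := congrArg (TensorProduct.comm k _ _) (b.counit_covariant v)
    rw [TensorProduct.comm_tmul] at h
    refine Eq.trans ?_ h
    generalize b.coact v = z
    induction z with
    | zero => simp
    | add x y hx hy => simp only [map_add, hx, hy]
    | tmul x y => simp [BraidedWords.braidedHopf]
  antipode_covariant := by
    ext v
    have h := congrArg (TensorProduct.comm k _ _) (LinearMap.congr_fun b.antipode_covariant v)
    refine Eq.trans h ?_
    simp only [LinearMap.comp_apply, AlgHom.toLinearMap_apply, b.coactR_apply]
    generalize b.coact v = z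
    induction z with
    | zero => simp
    | add x y hx hy => simp only [map_add, hx, hy]
    | tmul x y => simp [BraidedWords.braidedHopf]

variable [DecidableEq I] {c : I → k} {D B : Type*} [Ring D] [Algebra k D] [Ring B] [Algebra k B]

/-- The input of the double-bosonisation, for two copies of the quotient by the radical. -/
def lusztigInput (T : LusztigRootDatum C Y X) (ND : Nichols C q c D) (NB : Nichols C q c B) :
    DoubleInput k (AddMonoidAlgebra k Y) (AddMonoidAlgebra k (I →₀ ℤ)) D B where
  W := groupPairing T q
  bg := NB.words.leftBraidedGroup T
  dg := ND.words.rightBraidedGroup T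
  antipodeInv := ND.words.antipodeInv
  antipodeInv_comp := ND.words.antipodeInv_comp_antipode
  comp_antipodeInv := ND.words.antipode_comp_antipodeInv
  ev := ND.ev NB
  ev_one_left := ND.ev_one_left NB
  ev_one_right := fun d => by rw [ND.ev_symm, NB.ev_one_left]; rfl
  ev_mul_left := ND.ev_mul_left NB
  ev_mul_right := ND.ev_mul_right NB
  ev_covariant := fun d b => by
    refine Eq.trans ?_ (ND.ev_covariant NB d b)
    change TensorProduct.lid k _ (LinearMap.rTensor _ _ (ND.words.coactR d)) = _
    rw [GradedGen.coactR_apply]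
    generalize ND.words.coact d = z
    induction z with
    | zero => simp
    | add x y hx hy => simp only [map_add, hx, hy]
    | tmul x y => simp

end Input

end RootDatum

/-! ### The cross relation -/

section Reorder

variable {k : Type*} [Field k] {I : Type*}

theorem GradedGen.linearMap_ext_wt₃ {V : Type*} [Ring V] [Algebra k V] (g : GradedGen k I V)
    {M : Type*} [AddCommMonoid M] [Module k M] {φ ψ : V ⊗[k] (V ⊗[k] V) →ₗ[k] M}
    (h : ∀ α β γ u v w, g.IsWt α u → g.IsWt β v → g.IsWt γ w →
      φ (u ⊗ₜ (v ⊗ₜ w)) = ψ (u ⊗ₜ (v ⊗ₜ w))) : φ = ψ := by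
  apply TensorProduct.ext
  apply g.linearMap_ext_wt
  intro α u hu
  apply g.linearMap_ext_wt₂ g
  intro β γ v w hv hw
  exact h α β γ u v w hu hv hw

variable {C : LusztigCartanDatum I} {q : kˣ} {Y X : Type*} [AddCommGroup Y] [AddCommGroup X]
  (T : LusztigRootDatum C Y X)

/-- The automorphism `K_μ ↦ q ^ ⟨μ, i'⟩ K_μ` of `kY`. -/
def rootTwist (q : kˣ) (i : I) : AddMonoidAlgebra k Y →ₐ[k] AddMonoidAlgebra k Y :=
  AddMonoidAlgebra.lift k _ Y
    { toFun := fun μ => (q : k) ^ T.pairing μ.toAdd (T.root i) •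
        AddMonoidAlgebra.single μ.toAdd 1
      map_one' := by simp [AddMonoidAlgebra.one_def]
      map_mul' := fun a b => by
        simp [zpow_add₀, AddMonoidAlgebra.single_mul_single] }

theorem rootTwist_single (i : I) (μ : Y) :
    rootTwist T q i (AddMonoidAlgebra.single μ 1) =
      (q : k) ^ T.pairing μ (T.root i) • AddMonoidAlgebra.single μ 1 := by
  simp [rootTwist]

theorem LusztigRootDatum.pairing_tildeHom_root (β : I →₀ ℤ) (i : I) :
    T.pairing (T.tildeHom β) (T.root i) = C.form β (Finsupp.single i 1) := by
  rw [← T.rootHom_single, T.pairing_tildeHom_rootHom]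

section SideB

variable {V : Type*} [Ring V] [Algebra k V] (b : BraidedWords C q V)

theorem BraidedWords.lTensor_comul_comulStep (i : I) (z : V ⊗[k] V) :
    LinearMap.lTensor V b.comul (b.comulStep C q i z) =
      (TensorProduct.map (LinearMap.mulLeft k (b.gen i)) LinearMap.id +
        TensorProduct.map (b.chi C q (Finsupp.single i 1)).toLinearMap (b.comulStep C q i) :
          V ⊗[k] (V ⊗[k] V) →ₗ[k] V ⊗[k] (V ⊗[k] V))
          (LinearMap.lTensor V b.comul z) := by
  induction z with
  | zero => simp
  | add x y hx hy => simp only [map_add, hx, hy]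
  | tmul x y => simp [b.comulStep_tmul, b.comul_gen_mul]

/-- `b₁ ⊗ b₂ ⊗ b₃ ↦ (R(b₁⁽¹⁾) ⊗ b₁⁽²⁾) ⊗ ((b₂ ◁ Rbar(b₃⁽¹⁾)) ⊗ b₃⁽²⁾)`. -/
def BraidedWords.spread : V ⊗[k] (V ⊗[k] V) →ₗ[k]
    (AddMonoidAlgebra k Y ⊗[k] V) ⊗[k] (V ⊗[k] V) :=
  TensorProduct.map (LinearMap.rTensor V (groupHom k T.tildeHom).toLinearMap ∘ₗ
      b.coact.toLinearMap)
    (twistL (groupPairing T q) b.coact.toLinearMap (groupHom k (-T.tildeHom)).toLinearMap)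

theorem BraidedWords.spread_tmul {α γ : I →₀ ℤ} {u w : V} (hu : b.IsWt α u) (v : V)
    (hw : b.IsWt γ w) : b.spread T (u ⊗ₜ (v ⊗ₜ w)) =
      (AddMonoidAlgebra.single (T.tildeHom α) 1 ⊗ₜ u) ⊗ₜ (b.chi C q (-γ) v ⊗ₜ w) := by
  rw [BraidedWords.spread, TensorProduct.map_tmul, twistL_tmul T q _ v hw,
    LinearMap.neg_apply, ← map_neg, T.weightChar_tildeHom]
  rw [GradedGen.IsWt] at hu
  simp [hu]

/-- The effect on `reorderB` of multiplication by a generator. -/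
def BraidedWords.spreadStep (i : I) :
    (AddMonoidAlgebra k Y ⊗[k] V) ⊗[k] (V ⊗[k] V) →ₗ[k]
      (AddMonoidAlgebra k Y ⊗[k] V) ⊗[k] (V ⊗[k] V) :=
  -- The letter falls into `b₁`, `b₂` or `b₃`. In `b₁` it adds `K̃_i` through `R`. In `b₂` it has
  -- passed `b₁`, and the action of `Rbar(b₃)` on it costs a scalar recorded as a twist of `b₃`. In
  -- `b₃` it has passed `b₁` and `b₂`, but the twist of `b₂` is cancelled by its own `Rbar`.
  TensorProduct.map (TensorProduct.map
      (LinearMap.mulLeft k (AddMonoidAlgebra.single (T.tilde i) 1)) (LinearMap.mulLeft k (b.gen i)))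
      LinearMap.id +
    TensorProduct.map (TensorProduct.map LinearMap.id (b.chi C q (Finsupp.single i 1)).toLinearMap)
      (TensorProduct.map (LinearMap.mulLeft k (b.gen i))
        (b.chi C q (-Finsupp.single i 1)).toLinearMap) +
    TensorProduct.map (TensorProduct.map LinearMap.id (b.chi C q (Finsupp.single i 1)).toLinearMap)
      (TensorProduct.map LinearMap.id (LinearMap.mulLeft k (b.gen i)))

theorem BraidedWords.spread_gen_mul (i : I) (v : V) :
    b.spread T (LinearMap.lTensor V b.comul (b.comul (b.gen i * v))) =
      b.spreadStep T i (b.spread T (LinearMap.lTensor V b.comul (b.comul v))) := by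
  rw [b.comul_gen_mul, b.lTensor_comul_comulStep]
  generalize LinearMap.lTensor V b.comul (b.comul v) = z
  have : b.spread T ∘ₗ (TensorProduct.map (LinearMap.mulLeft k (b.gen i)) LinearMap.id +
        TensorProduct.map (b.chi C q (Finsupp.single i 1)).toLinearMap (b.comulStep C q i) :
          V ⊗[k] (V ⊗[k] V) →ₗ[k] V ⊗[k] (V ⊗[k] V)) = b.spreadStep T i ∘ₗ b.spread T := by
    apply b.linearMap_ext_wt₃
    intro α β γ u v w hu hv hw
    have h1 := (b.isWt_gen i).mul hu
    have h2 := b.isWt_chi C q hu (Finsupp.single i 1)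
    have h3 := (b.isWt_gen i).mul hw
    simp only [LinearMap.comp_apply, LinearMap.add_apply, TensorProduct.map_tmul,
      LinearMap.mulLeft_apply, LinearMap.id_apply, AlgHom.toLinearMap_apply,
      b.comulStep_tmul, TensorProduct.tmul_add, map_add, b.spread_tmul T h1 _ hw,
      b.spread_tmul T h2 _ hw, b.spread_tmul T h2 _ h3, b.spread_tmul T hu _ hw,
      BraidedWords.spreadStep, AddMonoidAlgebra.single_mul_single, T.tildeHom_single, mul_one,
      add_assoc, b.chi_chi, map_mul, b.chi_gen, hw.chi, C.symm _ (Finsupp.single i 1)]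
    congr 2
    · simp [TensorProduct.smul_tmul']
    · simp
  exact LinearMap.congr_fun this z

/-- The torus factor is `K̃_α` with `α` the degree of `b₁`, so the same power of `q` can be read off
from either factor. -/
theorem BraidedWords.rootTwist_spread (i : I) (z : V ⊗[k] (V ⊗[k] V)) :
    TensorProduct.map (TensorProduct.map (rootTwist T q i).toLinearMap LinearMap.id) LinearMap.id
        (b.spread T z) =
      TensorProduct.map (TensorProduct.map LinearMap.id
        (b.chi C q (Finsupp.single i 1)).toLinearMap) LinearMap.id (b.spread T z) := by
  refine LinearMap.congr_fun (f := TensorProduct.map (TensorProduct.map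
    (rootTwist T q i).toLinearMap LinearMap.id) LinearMap.id ∘ₗ b.spread T)
    (g := TensorProduct.map (TensorProduct.map LinearMap.id
        (b.chi C q (Finsupp.single i 1)).toLinearMap) LinearMap.id ∘ₗ b.spread T) ?_ z
  apply b.linearMap_ext_wt₃
  intro α β γ u v w hu hv hw
  simp only [LinearMap.comp_apply, b.spread_tmul T hu _ hw, TensorProduct.map_tmul,
    AlgHom.toLinearMap_apply, LinearMap.id_apply, rootTwist_single, T.pairing_tildeHom_root, hu.chi,
    C.symm (Finsupp.single i 1), TensorProduct.smul_tmul', TensorProduct.tmul_smul]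

end SideB

section SideD

variable {V : Type*} [Ring V] [Algebra k V] (b : BraidedWords C q V)

/-- The coproduct `Ψ⁻¹ ∘ Δ`. -/
def BraidedWords.comulBar : V →ₗ[k] V ⊗[k] V :=
  braidRInv (groupPairing T q) b.coactR.toLinearMap ∘ₗ b.comul

theorem braidRInv_tmul (v : V) {γ : I →₀ ℤ} {w : V} (hw : b.IsWt γ w) :
    braidRInv (groupPairing T q) b.coactR.toLinearMap (v ⊗ₜ w) = w ⊗ₜ b.chi C q (-γ) v := by
  have := twistR_tmul T q (-T.tildeHom) hw v
  rw [LinearMap.neg_apply, ← map_neg, T.weightChar_tildeHom] at this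
  exact this

/-- The action of `R` undoes the inverse braiding in `comulBar`. What remains in the first two legs
of `reorderD` is the flipped coproduct of `D`, without powers of `q`. -/
theorem BraidedWords.twistR_comulBar :
    twistR (groupPairing T q) b.coactR.toLinearMap (groupHom k T.tildeHom).toLinearMap ∘ₗ
      b.comulBar T = (TensorProduct.comm k V V).toLinearMap ∘ₗ b.comul := by
  rw [BraidedWords.comulBar, ← LinearMap.comp_assoc]
  congr 1
  apply b.linearMap_ext_wt₂ b.toGradedGen
  intro β γ v w hv hw
  rw [LinearMap.comp_apply, braidRInv_tmul T b v hw, twistR_tmul T q _ hw, T.weightChar_tildeHom,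
    b.chi_chi]
  simp

/-- `c ↦ (S̄ c)⁽¹⁾ ⊗ Rbar((S̄ c)⁽²⁾)`. -/
def BraidedWords.antipodeR : V →ₗ[k] V ⊗[k] AddMonoidAlgebra k Y :=
  LinearMap.lTensor V (groupHom k (-T.tildeHom)).toLinearMap ∘ₗ b.coactR.toLinearMap ∘ₗ
    b.antipodeInv

theorem BraidedWords.antipodeR_apply {β : I →₀ ℤ} {v : V} (hv : b.IsWt β v) :
    b.antipodeR T v = b.antipodeInv v ⊗ₜ AddMonoidAlgebra.single (-T.tildeHom β) 1 := by
  have h := (hv.map b.antipodeInv_covariant).coactR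
  simp [BraidedWords.antipodeR, h]

theorem BraidedWords.rootTwist_antipodeR (i : I) (v : V) :
    TensorProduct.map LinearMap.id (rootTwist T q i).toLinearMap (b.antipodeR T v) =
      TensorProduct.map (b.chi C q (-Finsupp.single i 1)).toLinearMap LinearMap.id
        (b.antipodeR T v) := by
  refine LinearMap.congr_fun (f := TensorProduct.map LinearMap.id
    (rootTwist T q i).toLinearMap ∘ₗ b.antipodeR T) (g := TensorProduct.map
      (b.chi C q (-Finsupp.single i 1)).toLinearMap LinearMap.id ∘ₗ b.antipodeR T) ?_ v
  apply b.linearMap_ext_wt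
  intro β v hv
  simp only [LinearMap.comp_apply, b.antipodeR_apply T hv, TensorProduct.map_tmul,
    AlgHom.toLinearMap_apply, LinearMap.id_apply, rootTwist_single, map_neg, LinearMap.neg_apply,
    T.pairing_tildeHom_root, (hv.map b.antipodeInv_covariant).chi, C.symm (Finsupp.single i 1),
    TensorProduct.smul_tmul', TensorProduct.tmul_smul]

theorem BraidedWords.counit_antipodeInv (v : V) : b.counit (b.antipodeInv v) = b.counit v := by
  refine LinearMap.congr_fun (f := b.counit.toLinearMap ∘ₗ b.antipodeInv)
    (g := b.counit.toLinearMap) (b.linearMap_ext ?_ ?_) v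
  · simp [b.antipodeInv_one]
  · intro i v hv
    simp [b.antipodeInv_gen_mul, b.counit_gen]

theorem BraidedWords.counit_antipodeR (v : V) :
    TensorProduct.lid k _ (LinearMap.rTensor _ b.counit.toLinearMap (b.antipodeR T v)) =
      b.counit v • (1 : AddMonoidAlgebra k Y) := by
  have h := (b.rightBraidedGroup T).counit_covariant (b.antipodeInv v)
  change LinearMap.rTensor _ b.counit.toLinearMap (b.coactR (b.antipodeInv v)) =
    b.counit (b.antipodeInv v) ⊗ₜ 1 at h
  rw [BraidedWords.counit_antipodeInv] at h
  have h2 : LinearMap.rTensor _ b.counit.toLinearMap (b.antipodeR T v) =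
      LinearMap.lTensor k (groupHom k (-T.tildeHom)).toLinearMap
        (LinearMap.rTensor _ b.counit.toLinearMap (b.coactR (b.antipodeInv v))) := by
    rw [BraidedWords.antipodeR]
    simp only [LinearMap.comp_apply, AlgHom.toLinearMap_apply]
    rw [← LinearMap.comp_apply, ← LinearMap.comp_apply, LinearMap.rTensor_comp_lTensor,
      LinearMap.lTensor_comp_rTensor]
  rw [h2, h, LinearMap.lTensor_tmul, AlgHom.toLinearMap_apply, map_one, TensorProduct.lid_tmul]

variable {φ : V →ₗ[k] k} {i : I} (hφ : b.IsLetter φ i)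
include hφ

/-- This is `lder_antipodeInv` with the torus factor included: the derivative has its degree lowered
by `i`, and the missing part of the exponent is the factor at `-T.tilde i`. -/
theorem BraidedWords.IsLetter.lder_antipodeR (v : V) :
    TensorProduct.map (b.lder φ) LinearMap.id (b.antipodeR T v) =
      -TensorProduct.map LinearMap.id
        (LinearMap.mulLeft k (AddMonoidAlgebra.single (-T.tilde i) 1))
        (b.antipodeR T (b.chi C q (-Finsupp.single i 1) (b.rder φ v))) := by
  refine LinearMap.congr_fun (f := TensorProduct.map (b.lder φ) LinearMap.id ∘ₗ b.antipodeR T)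
    (g := -(TensorProduct.map LinearMap.id
        (LinearMap.mulLeft k (AddMonoidAlgebra.single (-T.tilde i) 1)) ∘ₗ b.antipodeR T ∘ₗ
          (b.chi C q (-Finsupp.single i 1)).toLinearMap ∘ₗ b.rder φ)) ?_ v
  apply b.linearMap_ext_wt
  intro β v hv
  have h := b.isWt_chi C q (hφ.isWt_rder hv) (-Finsupp.single i 1)
  simp [b.antipodeR_apply T hv, b.antipodeR_apply T h, hφ.lder_antipodeInv,
    AddMonoidAlgebra.single_mul_single, b.twist_map b.antipodeInv_covariant,
    TensorProduct.neg_tmul, show ∀ a b : Y, -a + (a - b) = -b by intros; abel]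

/-- The analogue of `lTensor_lder_comul` for the coproduct of `C̄`. It carries a derivation from the
third factor of the cross relation back to the other two. -/
theorem BraidedWords.IsLetter.comulBar_der (v : V) :
    TensorProduct.map LinearMap.id
      ((b.chi C q (-Finsupp.single i 1)).toLinearMap ∘ₗ b.rder φ) (b.comulBar T v) =
    TensorProduct.map ((b.chi C q (-Finsupp.single i 1)).toLinearMap ∘ₗ b.lder φ)
      LinearMap.id (b.comulBar T v) := by
  -- `h1` and `h2` push the derivations through the inverse braiding onto the legs of the ordinary
  -- coproduct, leaving the same twists outside; there `lTensor_lder_comul` applies.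
  have h1 : ∀ z, TensorProduct.map LinearMap.id
      ((b.chi C q (-Finsupp.single i 1)).toLinearMap ∘ₗ b.rder φ)
        (braidRInv (groupPairing T q) b.coactR.toLinearMap z) =
      TensorProduct.map (b.chi C q (-Finsupp.single i 1)).toLinearMap
        (b.chi C q (-Finsupp.single i 1)).toLinearMap
        (braidRInv (groupPairing T q) b.coactR.toLinearMap (LinearMap.rTensor V (b.rder φ) z)) :=
    fun z => by
      refine LinearMap.congr_fun (f := TensorProduct.map LinearMap.id
        ((b.chi C q (-Finsupp.single i 1)).toLinearMap ∘ₗ b.rder φ) ∘ₗ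
          braidRInv (groupPairing T q) b.coactR.toLinearMap)
        (g := TensorProduct.map (b.chi C q (-Finsupp.single i 1)).toLinearMap
          (b.chi C q (-Finsupp.single i 1)).toLinearMap ∘ₗ
          braidRInv (groupPairing T q) b.coactR.toLinearMap ∘ₗ LinearMap.rTensor V (b.rder φ)) ?_ z
      apply b.linearMap_ext_wt₂ b.toGradedGen
      intro β γ v w hv hw
      simp only [LinearMap.comp_apply, LinearMap.rTensor_tmul, braidRInv_tmul T b _ hw,
        TensorProduct.map_tmul, AlgHom.toLinearMap_apply, LinearMap.id_apply, hφ.rder_chi,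
        map_smul, hw.chi, TensorProduct.tmul_smul, ← TensorProduct.smul_tmul', map_neg,
        LinearMap.neg_apply, C.symm (Finsupp.single i 1)]
  have h2 : ∀ z, TensorProduct.map ((b.chi C q (-Finsupp.single i 1)).toLinearMap ∘ₗ b.lder φ)
        LinearMap.id (braidRInv (groupPairing T q) b.coactR.toLinearMap z) =
      TensorProduct.map (b.chi C q (-Finsupp.single i 1)).toLinearMap
        (b.chi C q (-Finsupp.single i 1)).toLinearMap
        (braidRInv (groupPairing T q) b.coactR.toLinearMap (LinearMap.lTensor V (b.lder φ) z)) :=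
    fun z => by
      refine LinearMap.congr_fun (f := TensorProduct.map
        ((b.chi C q (-Finsupp.single i 1)).toLinearMap ∘ₗ b.lder φ) LinearMap.id ∘ₗ
          braidRInv (groupPairing T q) b.coactR.toLinearMap)
        (g := TensorProduct.map (b.chi C q (-Finsupp.single i 1)).toLinearMap
          (b.chi C q (-Finsupp.single i 1)).toLinearMap ∘ₗ
          braidRInv (groupPairing T q) b.coactR.toLinearMap ∘ₗ LinearMap.lTensor V (b.lder φ)) ?_ z
      apply b.linearMap_ext_wt₂ b.toGradedGen
      intro β γ v w hv hw
      simp only [LinearMap.comp_apply, LinearMap.lTensor_tmul, braidRInv_tmul T b _ hw,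
        braidRInv_tmul T b _ (hφ.isWt_lder hw), TensorProduct.map_tmul, AlgHom.toLinearMap_apply,
        LinearMap.id_apply, b.chi_chi, show ∀ a b : I →₀ ℤ, -b + -(a - b) = -a by intros; abel]
  rw [BraidedWords.comulBar, LinearMap.comp_apply, h1, h2,
    BraidedWords.IsLetter.lTensor_lder_comul]

end SideD

/-! ### Contraction with the pairing, and the recursion for the reordering -/

section Contraction

theorem tensor_map_map {M₁ M₂ N₁ N₂ P₁ P₂ : Type*} [AddCommMonoid M₁] [Module k M₁]
    [AddCommMonoid M₂] [Module k M₂] [AddCommMonoid N₁] [Module k N₁] [AddCommMonoid N₂]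
    [Module k N₂] [AddCommMonoid P₁] [Module k P₁] [AddCommMonoid P₂] [Module k P₂]
    (f : N₁ →ₗ[k] P₁) (g : N₂ →ₗ[k] P₂) (f' : M₁ →ₗ[k] N₁) (g' : M₂ →ₗ[k] N₂) (z : M₁ ⊗[k] M₂) :
    TensorProduct.map f g (TensorProduct.map f' g' z) = TensorProduct.map (f ∘ₗ f') (g ∘ₗ g') z :=
  (LinearMap.congr_fun (TensorProduct.map_comp f g f' g') z).symm

variable [DecidableEq I] {c : I → k} {D B : Type*} [Ring D] [Algebra k D] [Ring B] [Algebra k B]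
  (ND : Nichols C q c D) (NB : Nichols C q c B)

/-- The contraction of `(h ⊗ b₁) ⊗ (b₂ ⊗ b₃)` with `(c₁ ⊗ c₂) ⊗ (c₃ ⊗ h')` to
`⟨c₁, b₁⟩ ⟨c₃, b₃⟩ c₂ ⊗ h h' ⊗ b₂`. -/
def contraction :
    ((AddMonoidAlgebra k Y ⊗[k] B) ⊗[k] (B ⊗[k] B)) ⊗[k]
      ((D ⊗[k] D) ⊗[k] (D ⊗[k] AddMonoidAlgebra k Y)) →ₗ[k]
      D ⊗[k] (AddMonoidAlgebra k Y ⊗[k] B) :=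
  LinearMap.lTensor D
      (LinearMap.rTensor B (LinearMap.mul' k _)
        ∘ₗ (TensorProduct.assoc k _ _ B).symm.toLinearMap)
    ∘ₗ (TensorProduct.assoc k D _ (_ ⊗[k] B)).toLinearMap
    ∘ₗ TensorProduct.map (TensorProduct.comm k _ D).toLinearMap
        (TensorProduct.comm k B _).toLinearMap
    ∘ₗ TensorProduct.map ((lusztigInput T ND NB).contract (AddMonoidAlgebra k Y) D)
      ((lusztigInput T ND NB).contract B (AddMonoidAlgebra k Y))
    ∘ₗ (TensorProduct.tensorTensorTensorComm k (_ ⊗[k] B) (B ⊗[k] B)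
        (D ⊗[k] D) (D ⊗[k] _)).toLinearMap

theorem contraction_tmul (h h' : AddMonoidAlgebra k Y) (b₁ b₂ b₃ : B) (c₁ c₂ c₃ : D) :
    contraction T ND NB (((h ⊗ₜ b₁) ⊗ₜ (b₂ ⊗ₜ b₃)) ⊗ₜ ((c₁ ⊗ₜ c₂) ⊗ₜ (c₃ ⊗ₜ h'))) =
      (ND.ev NB c₁ b₁ * ND.ev NB c₃ b₃) • c₂ ⊗ₜ ((h * h') ⊗ₜ b₂) := by
  simp [contraction, DoubleInput.contract, lusztigInput, ← TensorProduct.smul_tmul',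
    smul_smul, mul_comm]

omit [AddCommGroup Y] in
theorem contraction_ext {M : Type*} [AddCommMonoid M] [Module k M]
    {φ ψ : ((AddMonoidAlgebra k Y ⊗[k] B) ⊗[k] (B ⊗[k] B)) ⊗[k]
      ((D ⊗[k] D) ⊗[k] (D ⊗[k] AddMonoidAlgebra k Y)) →ₗ[k] M}
    (H : ∀ h h' b₁ b₂ b₃ c₁ c₂ c₃,
      φ (((h ⊗ₜ b₁) ⊗ₜ (b₂ ⊗ₜ b₃)) ⊗ₜ ((c₁ ⊗ₜ c₂) ⊗ₜ (c₃ ⊗ₜ h'))) =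
        ψ (((h ⊗ₜ b₁) ⊗ₜ (b₂ ⊗ₜ b₃)) ⊗ₜ ((c₁ ⊗ₜ c₂) ⊗ₜ (c₃ ⊗ₜ h')))) : φ = ψ := by
  apply TensorProduct.ext
  apply TensorProduct.ext_fourfold'
  intro h b₁ b₂ b₃
  apply TensorProduct.ext_fourfold'
  intro c₁ c₂ c₃ h'
  exact H h h' b₁ b₂ b₃ c₁ c₂ c₃

/-- `c ↦ ⟨c, eᵢ⟩`. -/
abbrev evGen (i : I) : D →ₗ[k] k := (ND.ev NB).flip (NB.words.gen i)

theorem ev_gen_mul (i : I) (d : D) (b : B) : ND.ev NB d (NB.words.gen i * b) =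
    ND.ev NB (ND.words.lder (evGen ND NB i) d) b := by
  rw [ND.ev_mul_right]
  simp only [BraidedWords.lder, LinearMap.comp_apply, LinearEquiv.coe_coe]
  generalize ND.words.comul d = z
  induction z with
  | zero => simp
  | add x y hx hy => simp only [map_add, LinearMap.add_apply, hx, hy]
  | tmul x y => simp

theorem ev_twist (ψ : AddMonoidAlgebra k (I →₀ ℤ) →ₐ[k] k) (d : D) (b : B) :
    ND.ev NB d (NB.words.twist ψ b) = ND.ev NB (ND.words.twist ψ d) b := by
  obtain ⟨b, rfl⟩ := NB.surjective b
  obtain ⟨d, rfl⟩ := ND.surjective d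
  have h1 : NB.words.twist ψ (NB.π b) = NB.π ((freeWords C q).twist ψ b) := NB.twist_π ψ b
  have h2 : ND.words.twist ψ (ND.π d) = ND.π ((freeWords C q).twist ψ d) := ND.twist_π ψ d
  rw [h1, h2, ND.ev_π, ND.ev_π, freePairing_twist]

/-- `reorderD`, in terms of the coproduct of `D`. -/
theorem reorderD_eq : (lusztigInput T ND NB).reorderD =
    TensorProduct.map ((TensorProduct.comm k D D).toLinearMap ∘ₗ ND.words.comul)
      (ND.words.antipodeR T) ∘ₗ ND.words.comulBar T := by
  have h : (lusztigInput T ND NB).reorderD = TensorProduct.map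
      (twistR (groupPairing T q) ND.words.coactR.toLinearMap (groupHom k T.tildeHom).toLinearMap)
      (ND.words.antipodeR T) ∘ₗ LinearMap.rTensor D (ND.words.comulBar T) ∘ₗ
        ND.words.comulBar T := rfl
  rw [h, ← BraidedWords.twistR_comulBar T ND.words, ← LinearMap.comp_assoc, LinearMap.map_comp_rTensor]

theorem reorderB_eq : (lusztigInput T ND NB).reorderB =
    NB.words.spread T ∘ₗ LinearMap.lTensor B NB.words.comul ∘ₗ NB.words.comul := rfl

theorem reorder_tmul (b : B) (d : D) : (lusztigInput T ND NB).reorder (b ⊗ₜ d) =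
    contraction T ND NB ((lusztigInput T ND NB).reorderB b ⊗ₜ
      (lusztigInput T ND NB).reorderD d) := rfl

theorem rootTwist_reorderB (i : I) (b : B) :
    TensorProduct.map (TensorProduct.map (rootTwist T q i).toLinearMap LinearMap.id) LinearMap.id
        ((lusztigInput T ND NB).reorderB b) =
      TensorProduct.map (TensorProduct.map LinearMap.id
        (NB.words.chi C q (Finsupp.single i 1)).toLinearMap) LinearMap.id
          ((lusztigInput T ND NB).reorderB b) :=
  NB.words.rootTwist_spread T i _

/-- The first pair in `reorderD` is the flipped coproduct, so `lTensor_lder_comul` exchanges the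
derivations of its two legs. The derivation thereby leaves the leg that is paired off and reaches
the one that survives. -/
theorem lder_reorderD (i : I) (d : D) :
    TensorProduct.map (TensorProduct.map (ND.words.lder (evGen ND NB i)) LinearMap.id)
        LinearMap.id ((lusztigInput T ND NB).reorderD d) =
      TensorProduct.map (TensorProduct.map LinearMap.id (ND.words.rder (evGen ND NB i)))
        LinearMap.id ((lusztigInput T ND NB).reorderD d) := by
  rw [reorderD_eq, LinearMap.comp_apply, tensor_map_map, tensor_map_map]
  congr 2
  ext d
  have h := congrArg (TensorProduct.comm k D D)
    (BraidedWords.IsLetter.lTensor_lder_comul (b := ND.words) (φ := evGen ND NB i) d)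
  simp only [LinearMap.comp_apply, LinearEquiv.coe_coe]
  generalize ND.words.comul d = z at h
  have h1 : ∀ (f : D →ₗ[k] D) (z : D ⊗[k] D), TensorProduct.comm k D D (LinearMap.lTensor D f z) =
      TensorProduct.map f LinearMap.id (TensorProduct.comm k D D z) := fun f z =>
    LinearMap.congr_fun (f := (TensorProduct.comm k D D).toLinearMap ∘ₗ LinearMap.lTensor D f)
      (g := TensorProduct.map f LinearMap.id ∘ₗ (TensorProduct.comm k D D).toLinearMap)
      (by ext; simp) z
  have h2 : ∀ (f : D →ₗ[k] D) (z : D ⊗[k] D), TensorProduct.comm k D D (LinearMap.rTensor D f z) =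
      TensorProduct.map LinearMap.id f (TensorProduct.comm k D D z) := fun f z =>
    LinearMap.congr_fun (f := (TensorProduct.comm k D D).toLinearMap ∘ₗ LinearMap.rTensor D f)
      (g := TensorProduct.map LinearMap.id f ∘ₗ (TensorProduct.comm k D D).toLinearMap)
      (by ext; simp) z
  rw [← h1, ← h2, h]

theorem rootTwist_reorderD (i : I) (d : D) :
    TensorProduct.map LinearMap.id (TensorProduct.map LinearMap.id
        (rootTwist T q i).toLinearMap) ((lusztigInput T ND NB).reorderD d) =
      TensorProduct.map LinearMap.id (TensorProduct.map
        (ND.words.chi C q (-Finsupp.single i 1)).toLinearMap LinearMap.id)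
          ((lusztigInput T ND NB).reorderD d) := by
  rw [reorderD_eq, LinearMap.comp_apply, tensor_map_map, tensor_map_map]
  congr 2
  ext d
  exact ND.words.rootTwist_antipodeR T i d

/-- The derivative of `S̄ c₃` is transferred to `c₂`. `lder_antipodeR` moves it inside `S̄`, giving
the sign and the torus factor; `comulBar_der` moves it to the leg containing `c₁` and `c₂`;
`comul_lder` then places it on `c₂`, and the twist on `c₁` cancels. -/
theorem chi_lder_reorderD (i : I) (d : D) :
    TensorProduct.map (TensorProduct.map (ND.words.chi C q (Finsupp.single i 1)).toLinearMap
        LinearMap.id) (TensorProduct.map (ND.words.lder (evGen ND NB i)) LinearMap.id)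
        ((lusztigInput T ND NB).reorderD d) =
      -TensorProduct.map (TensorProduct.map LinearMap.id
          ((ND.words.chi C q (-Finsupp.single i 1)).toLinearMap ∘ₗ
            ND.words.lder (evGen ND NB i)))
        (TensorProduct.map LinearMap.id
          (LinearMap.mulLeft k (AddMonoidAlgebra.single (-T.tilde i) 1)))
        ((lusztigInput T ND NB).reorderD d) := by
  have hφ := ND.ev_isLetter NB i
  have h1 : TensorProduct.map (ND.words.lder (evGen ND NB i)) LinearMap.id ∘ₗ
      ND.words.antipodeR T = -(TensorProduct.map LinearMap.id
        (LinearMap.mulLeft k (AddMonoidAlgebra.single (-T.tilde i) 1)) ∘ₗ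
        ND.words.antipodeR T ∘ₗ (ND.words.chi C q (-Finsupp.single i 1)).toLinearMap ∘ₗ
          ND.words.rder (evGen ND NB i)) := LinearMap.ext fun v => hφ.lder_antipodeR T _ v
  have h2 : TensorProduct.map (LinearMap.id : D →ₗ[k] D)
        ((ND.words.chi C q (-Finsupp.single i 1)).toLinearMap ∘ₗ
          ND.words.lder (evGen ND NB i)) ∘ₗ
        ((TensorProduct.comm k D D).toLinearMap ∘ₗ ND.words.comul) =
      TensorProduct.map (ND.words.chi C q (Finsupp.single i 1)).toLinearMap LinearMap.id ∘ₗ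
        ((TensorProduct.comm k D D).toLinearMap ∘ₗ ND.words.comul) ∘ₗ
          ((ND.words.chi C q (-Finsupp.single i 1)).toLinearMap ∘ₗ
            ND.words.lder (evGen ND NB i)) := by
    ext d
    simp only [LinearMap.comp_apply, AlgHom.toLinearMap_apply, ND.words.comul_chi,
      BraidedWords.IsLetter.comul_lder]
    generalize ND.words.comul d = z
    induction z with
    | zero => simp
    | add x y hx hy => simp only [map_add, hx, hy]
    | tmul x y => simp [ND.words.chi_chi]
  rw [reorderD_eq, LinearMap.comp_apply, tensor_map_map, tensor_map_map, h1, h2]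
  have h3 := congrArg (TensorProduct.map
    (TensorProduct.map (ND.words.chi C q (Finsupp.single i 1)).toLinearMap LinearMap.id ∘ₗ
        ((TensorProduct.comm k D D).toLinearMap ∘ₗ ND.words.comul))
    (TensorProduct.map LinearMap.id
        (LinearMap.mulLeft k (AddMonoidAlgebra.single (-T.tilde i) 1)) ∘ₗ
        ND.words.antipodeR T)) (hφ.comulBar_der T _ d)
  rw [tensor_map_map, tensor_map_map] at h3
  have h4 : ∀ (f : D →ₗ[k] D ⊗[k] D) (g : D →ₗ[k] D ⊗[k] AddMonoidAlgebra k Y) (z : D ⊗[k] D),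
      TensorProduct.map f (-g) z = -TensorProduct.map f g z := fun f g z => by
    rw [← neg_one_smul k g, TensorProduct.map_smul_right, LinearMap.smul_apply, neg_one_smul]
  rw [h4, neg_inj]
  exact h3

/-- The operator by which `eᵢ` acts from the left on `U(C̄, H, B)`. -/
def crossOp (i : I) : D ⊗[k] (AddMonoidAlgebra k Y ⊗[k] B) →ₗ[k]
    D ⊗[k] (AddMonoidAlgebra k Y ⊗[k] B) :=
  -- The first term is `e_i` passing `d` and `K_μ` to reach `b`; the other two are the commutator of
  -- `e_i` with `d`, with `K̃_i` and `K̃_i⁻¹` placed to the right of `D`.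
  TensorProduct.map LinearMap.id (TensorProduct.map (rootTwist T q i).toLinearMap
      (LinearMap.mulLeft k (NB.words.gen i))) +
    TensorProduct.map (ND.words.rder (evGen ND NB i)) (TensorProduct.map
      (LinearMap.mulLeft k (AddMonoidAlgebra.single (T.tilde i) 1)) LinearMap.id) -
    TensorProduct.map ((ND.words.chi C q (-Finsupp.single i 1)).toLinearMap ∘ₗ
        ND.words.lder (evGen ND NB i)) (TensorProduct.map
      (LinearMap.mulLeft k (AddMonoidAlgebra.single (-T.tilde i) 1)) LinearMap.id)

section Moves

variable (x : (AddMonoidAlgebra k Y ⊗[k] B) ⊗[k] (B ⊗[k] B))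
  (z : (D ⊗[k] D) ⊗[k] (D ⊗[k] AddMonoidAlgebra k Y))

/-- A letter in front of `b₁` is adjoint to a derivation of `c₁`, while its torus element already
stands leftmost. -/
theorem contraction_gen_left (i : I) : contraction T ND NB (TensorProduct.map (TensorProduct.map
      (LinearMap.mulLeft k (AddMonoidAlgebra.single (T.tilde i) 1))
      (LinearMap.mulLeft k (NB.words.gen i))) LinearMap.id x ⊗ₜ z) =
    TensorProduct.map LinearMap.id (TensorProduct.map
      (LinearMap.mulLeft k (AddMonoidAlgebra.single (T.tilde i) 1)) LinearMap.id)
      (contraction T ND NB (x ⊗ₜ TensorProduct.map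
        (TensorProduct.map (ND.words.lder (evGen ND NB i)) LinearMap.id) LinearMap.id z)) := by
  have key := LinearMap.congr_fun (f := contraction T ND NB ∘ₗ TensorProduct.map (TensorProduct.map
    (TensorProduct.map (LinearMap.mulLeft k (AddMonoidAlgebra.single (T.tilde i) 1))
      (LinearMap.mulLeft k (NB.words.gen i))) LinearMap.id) LinearMap.id)
    (g := TensorProduct.map LinearMap.id (TensorProduct.map
      (LinearMap.mulLeft k (AddMonoidAlgebra.single (T.tilde i) 1)) LinearMap.id) ∘ₗ
      contraction T ND NB ∘ₗ TensorProduct.map LinearMap.id (TensorProduct.map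
        (TensorProduct.map (ND.words.lder (evGen ND NB i)) LinearMap.id) LinearMap.id))
    (contraction_ext fun h h' b₁ b₂ b₃ c₁ c₂ c₃ => by
      simp only [LinearMap.comp_apply, TensorProduct.map_tmul, contraction_tmul, LinearMap.id_apply,
        LinearMap.mulLeft_apply, ev_gen_mul, map_smul, mul_assoc]) (x ⊗ₜ z)
  simpa only [LinearMap.comp_apply, TensorProduct.map_tmul, LinearMap.id_apply] using key

theorem contraction_rder (f : D →ₗ[k] D) :
    contraction T ND NB (x ⊗ₜ TensorProduct.map (TensorProduct.map LinearMap.id f) LinearMap.id z) =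
      TensorProduct.map f LinearMap.id (contraction T ND NB (x ⊗ₜ z)) := by
  have key := LinearMap.congr_fun (f := contraction T ND NB ∘ₗ TensorProduct.map LinearMap.id
      (TensorProduct.map (TensorProduct.map LinearMap.id f) LinearMap.id))
    (g := TensorProduct.map f LinearMap.id ∘ₗ contraction T ND NB)
    (contraction_ext fun h h' b₁ b₂ b₃ c₁ c₂ c₃ => by
      simp only [LinearMap.comp_apply, TensorProduct.map_tmul, contraction_tmul, LinearMap.id_apply,
        map_smul]) (x ⊗ₜ z)
  simpa only [LinearMap.comp_apply, TensorProduct.map_tmul, LinearMap.id_apply] using key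

/-- The torus element next to `c₃` can be brought to the front because `kY` is commutative. -/
theorem contraction_single_mul (μ : Y) :
    contraction T ND NB (x ⊗ₜ TensorProduct.map LinearMap.id (TensorProduct.map LinearMap.id
      (LinearMap.mulLeft k (AddMonoidAlgebra.single μ 1))) z) =
      TensorProduct.map LinearMap.id (TensorProduct.map
        (LinearMap.mulLeft k (AddMonoidAlgebra.single μ 1)) LinearMap.id)
        (contraction T ND NB (x ⊗ₜ z)) := by
  have key := LinearMap.congr_fun (f := contraction T ND NB ∘ₗ TensorProduct.map LinearMap.id
      (TensorProduct.map LinearMap.id (TensorProduct.map LinearMap.id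
        (LinearMap.mulLeft k (AddMonoidAlgebra.single μ 1)))))
    (g := TensorProduct.map LinearMap.id (TensorProduct.map
        (LinearMap.mulLeft k (AddMonoidAlgebra.single μ 1)) LinearMap.id) ∘ₗ contraction T ND NB)
    (contraction_ext fun h h' b₁ b₂ b₃ c₁ c₂ c₃ => by
      simp only [LinearMap.comp_apply, TensorProduct.map_tmul, contraction_tmul, LinearMap.id_apply,
        map_smul, LinearMap.mulLeft_apply, mul_left_comm]) (x ⊗ₜ z)
  simpa only [LinearMap.comp_apply, TensorProduct.map_tmul, LinearMap.id_apply] using key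

/-- `b₂` is not paired, so its letter comes out. The twist of `b₃` passes to `c₃` by adjointness,
and the two remaining twists sit next to the two torus factors, ready to be read as `rootTwist`. -/
theorem contraction_gen_middle (i : I) :
    contraction T ND NB (TensorProduct.map (TensorProduct.map LinearMap.id
        (NB.words.chi C q (Finsupp.single i 1)).toLinearMap)
      (TensorProduct.map (LinearMap.mulLeft k (NB.words.gen i))
        (NB.words.chi C q (-Finsupp.single i 1)).toLinearMap) x ⊗ₜ z) =
      TensorProduct.map LinearMap.id (TensorProduct.map LinearMap.id
        (LinearMap.mulLeft k (NB.words.gen i))) (contraction T ND NB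
          (TensorProduct.map (TensorProduct.map LinearMap.id
            (NB.words.chi C q (Finsupp.single i 1)).toLinearMap) LinearMap.id x ⊗ₜ
          TensorProduct.map LinearMap.id (TensorProduct.map
            (ND.words.chi C q (-Finsupp.single i 1)).toLinearMap LinearMap.id) z)) := by
  have key := LinearMap.congr_fun (f := contraction T ND NB ∘ₗ TensorProduct.map (TensorProduct.map
      (TensorProduct.map LinearMap.id (NB.words.chi C q (Finsupp.single i 1)).toLinearMap)
      (TensorProduct.map (LinearMap.mulLeft k (NB.words.gen i))
        (NB.words.chi C q (-Finsupp.single i 1)).toLinearMap)) LinearMap.id)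
    (g := TensorProduct.map LinearMap.id (TensorProduct.map LinearMap.id
        (LinearMap.mulLeft k (NB.words.gen i))) ∘ₗ contraction T ND NB ∘ₗ
          TensorProduct.map (TensorProduct.map (TensorProduct.map LinearMap.id
            (NB.words.chi C q (Finsupp.single i 1)).toLinearMap) LinearMap.id)
          (TensorProduct.map LinearMap.id (TensorProduct.map
            (ND.words.chi C q (-Finsupp.single i 1)).toLinearMap LinearMap.id)))
    (contraction_ext fun h h' b₁ b₂ b₃ c₁ c₂ c₃ => by
      simp only [LinearMap.comp_apply, TensorProduct.map_tmul, contraction_tmul, LinearMap.id_apply,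
        map_smul, LinearMap.mulLeft_apply, AlgHom.toLinearMap_apply, ev_twist]) (x ⊗ₜ z)
  simpa only [LinearMap.comp_apply, TensorProduct.map_tmul, LinearMap.id_apply] using key

theorem contraction_rootTwist (i : I) :
    contraction T ND NB (TensorProduct.map (TensorProduct.map (rootTwist T q i).toLinearMap
        LinearMap.id) LinearMap.id x ⊗ₜ TensorProduct.map LinearMap.id
          (TensorProduct.map LinearMap.id (rootTwist T q i).toLinearMap) z) =
      TensorProduct.map LinearMap.id (TensorProduct.map (rootTwist T q i).toLinearMap
        LinearMap.id) (contraction T ND NB (x ⊗ₜ z)) := by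
  have key := LinearMap.congr_fun (f := contraction T ND NB ∘ₗ TensorProduct.map
      (TensorProduct.map (TensorProduct.map (rootTwist T q i).toLinearMap
        LinearMap.id) LinearMap.id) (TensorProduct.map LinearMap.id
          (TensorProduct.map LinearMap.id (rootTwist T q i).toLinearMap)))
    (g := TensorProduct.map LinearMap.id (TensorProduct.map (rootTwist T q i).toLinearMap
        LinearMap.id) ∘ₗ contraction T ND NB)
    (contraction_ext fun h h' b₁ b₂ b₃ c₁ c₂ c₃ => by
      simp only [LinearMap.comp_apply, TensorProduct.map_tmul, contraction_tmul, LinearMap.id_apply,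
        map_smul, AlgHom.toLinearMap_apply, map_mul]) (x ⊗ₜ z)
  simpa only [LinearMap.comp_apply, TensorProduct.map_tmul, LinearMap.id_apply] using key

/-- Both the letter on `b₃` and the twist on `b₁` pass to the `D` side by adjointness, which yields
the left-hand side of `chi_lder_reorderD`. -/
theorem contraction_gen_right (i : I) :
    contraction T ND NB (TensorProduct.map (TensorProduct.map LinearMap.id
        (NB.words.chi C q (Finsupp.single i 1)).toLinearMap)
      (TensorProduct.map LinearMap.id (LinearMap.mulLeft k (NB.words.gen i))) x ⊗ₜ z) =
      contraction T ND NB (x ⊗ₜ TensorProduct.map (TensorProduct.map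
        (ND.words.chi C q (Finsupp.single i 1)).toLinearMap LinearMap.id)
          (TensorProduct.map (ND.words.lder (evGen ND NB i)) LinearMap.id) z) := by
  have key := LinearMap.congr_fun (f := contraction T ND NB ∘ₗ TensorProduct.map (TensorProduct.map
      (TensorProduct.map LinearMap.id (NB.words.chi C q (Finsupp.single i 1)).toLinearMap)
      (TensorProduct.map LinearMap.id (LinearMap.mulLeft k (NB.words.gen i)))) LinearMap.id)
    (g := contraction T ND NB ∘ₗ TensorProduct.map LinearMap.id (TensorProduct.map
      (TensorProduct.map (ND.words.chi C q (Finsupp.single i 1)).toLinearMap LinearMap.id)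
          (TensorProduct.map (ND.words.lder (evGen ND NB i)) LinearMap.id)))
    (contraction_ext fun h h' b₁ b₂ b₃ c₁ c₂ c₃ => by
      simp only [LinearMap.comp_apply, TensorProduct.map_tmul, contraction_tmul, LinearMap.id_apply,
        LinearMap.mulLeft_apply, AlgHom.toLinearMap_apply, ev_twist, ev_gen_mul]) (x ⊗ₜ z)
  simpa only [LinearMap.comp_apply, TensorProduct.map_tmul, LinearMap.id_apply] using key

end Moves

/-- The three terms of `spreadStep` become those of `crossOp`. A letter in `b₁` differentiates `c₁`,
hence `c₂` by `lder_reorderD`, and gives the `K̃_i` term. A letter in `b₂` survives, with the scalar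
for passing the torus. A letter in `b₃` differentiates `S̄ c₃`, hence minus `c₂` by
`chi_lder_reorderD`, and gives the `K̃_i⁻¹` term. -/
theorem reorder_gen_mul (i : I) (b : B) (d : D) :
    (lusztigInput T ND NB).reorder ((NB.words.gen i * b) ⊗ₜ d) =
      crossOp T ND NB i ((lusztigInput T ND NB).reorder (b ⊗ₜ d)) := by
  have h0 : (lusztigInput T ND NB).reorderB (NB.words.gen i * b) =
      NB.words.spreadStep T i ((lusztigInput T ND NB).reorderB b) :=
    NB.words.spread_gen_mul T i b
  have h3 := chi_lder_reorderD T ND NB i d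
  have e : ∀ z : (D ⊗[k] D) ⊗[k] (D ⊗[k] AddMonoidAlgebra k Y), TensorProduct.map
      (TensorProduct.map LinearMap.id ((ND.words.chi C q (-Finsupp.single i 1)).toLinearMap ∘ₗ
        ND.words.lder (evGen ND NB i))) (TensorProduct.map LinearMap.id
          (LinearMap.mulLeft k (AddMonoidAlgebra.single (-T.tilde i) 1))) z =
      TensorProduct.map (TensorProduct.map LinearMap.id
        ((ND.words.chi C q (-Finsupp.single i 1)).toLinearMap ∘ₗ
          ND.words.lder (evGen ND NB i))) LinearMap.id
      (TensorProduct.map LinearMap.id (TensorProduct.map LinearMap.id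
          (LinearMap.mulLeft k (AddMonoidAlgebra.single (-T.tilde i) 1))) z) := fun z => by
    rw [tensor_map_map, LinearMap.comp_id, LinearMap.id_comp]
  rw [e] at h3
  have e' : ∀ x z, contraction T ND NB (x ⊗ₜ (-z)) = -contraction T ND NB (x ⊗ₜ z) := fun x z =>
    map_neg (contraction T ND NB ∘ₗ TensorProduct.mk k _ _ x) z
  simp only [reorder_tmul, h0, BraidedWords.spreadStep, LinearMap.add_apply,
    TensorProduct.add_tmul, map_add, contraction_gen_left, lder_reorderD, contraction_rder,
    contraction_gen_middle, ← rootTwist_reorderB, ← rootTwist_reorderD, contraction_rootTwist,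
    contraction_gen_right, h3, e', contraction_single_mul]
  simp only [tensor_map_map, crossOp, LinearMap.sub_apply, LinearMap.add_apply, LinearMap.id_comp,
    LinearMap.comp_id, ← TensorProduct.map_comp]
  abel

/-- For `b = 1` both pairings become counits. `S̄` preserves the counit, so `c₁` and `c₃` disappear
by the counit axioms. -/
theorem reorder_one (d : D) :
    (lusztigInput T ND NB).reorder (1 ⊗ₜ d) = d ⊗ₜ (1 ⊗ₜ 1) := by
  have h1 : (lusztigInput T ND NB).reorderB 1 = (1 ⊗ₜ 1) ⊗ₜ (1 ⊗ₜ 1) := by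
    rw [reorderB_eq]
    simp only [LinearMap.comp_apply, NB.words.comul_one, LinearMap.lTensor_tmul]
    rw [NB.words.spread_tmul T NB.words.isWt_one _ NB.words.isWt_one, map_one, map_zero,
      AddMonoidAlgebra.one_def]
  rw [reorder_tmul, h1, reorderD_eq, LinearMap.comp_apply]
  have h2 : ∀ z : D ⊗[k] D, contraction T ND NB (((1 ⊗ₜ 1) ⊗ₜ (1 ⊗ₜ 1)) ⊗ₜ
      TensorProduct.map ((TensorProduct.comm k D D).toLinearMap ∘ₗ ND.words.comul)
        (ND.words.antipodeR T) z) =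
      TensorProduct.rid k D (TensorProduct.map LinearMap.id ND.words.counit.toLinearMap z) ⊗ₜ
        (1 ⊗ₜ 1) := fun z => by
    have h4 : ∀ (c : D) (z : D ⊗[k] AddMonoidAlgebra k Y), contraction T ND NB
        (((1 ⊗ₜ 1) ⊗ₜ (1 ⊗ₜ 1)) ⊗ₜ (((TensorProduct.comm k D D) (ND.words.comul c)) ⊗ₜ z)) =
        c ⊗ₜ (TensorProduct.lid k _ (LinearMap.rTensor _ ND.words.counit.toLinearMap z) ⊗ₜ 1) :=
      fun c z => by
        have h5 : ∀ w : D ⊗[k] D, contraction T ND NB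
            (((1 ⊗ₜ 1) ⊗ₜ (1 ⊗ₜ 1)) ⊗ₜ (((TensorProduct.comm k D D) w) ⊗ₜ z)) =
            TensorProduct.rid k D (LinearMap.lTensor D ND.words.counit.toLinearMap w) ⊗ₜ
              (TensorProduct.lid k _ (LinearMap.rTensor _ ND.words.counit.toLinearMap z) ⊗ₜ
                1) := fun w => by
          induction w with
          | zero => simp
          | add x y hx hy =>
            simp only [map_add, TensorProduct.add_tmul, TensorProduct.tmul_add, hx, hy]
          | tmul x y =>
            induction z with
            | zero => simp
            | add x y hx hy =>
              simp only [map_add, TensorProduct.add_tmul, TensorProduct.tmul_add, hx, hy]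
            | tmul u h =>
              rw [TensorProduct.comm_tmul, contraction_tmul, ND.ev_symm, ND.ev_symm,
                NB.ev_one_left, NB.ev_one_left]
              simp [← TensorProduct.smul_tmul', TensorProduct.tmul_smul, smul_smul, mul_comm]
        rw [h5]
        congr 1
        exact LinearMap.congr_fun ND.words.counit_right c
    induction z with
    | zero => simp
    | add x y hx hy => simp only [map_add, TensorProduct.add_tmul, TensorProduct.tmul_add, hx, hy]
    | tmul x y =>
      rw [TensorProduct.map_tmul, LinearMap.comp_apply, LinearEquiv.coe_coe, h4,
        ND.words.counit_antipodeR]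
      simp [← TensorProduct.smul_tmul']
  rw [h2]
  congr 1
  -- The counit does not see twists, so the inverse braiding acts here as the flip.
  have h3 : ∀ z : D ⊗[k] D, TensorProduct.rid k D (TensorProduct.map LinearMap.id
      ND.words.counit.toLinearMap (braidRInv (groupPairing T q) ND.words.coactR.toLinearMap z)) =
      TensorProduct.lid k D (LinearMap.rTensor D ND.words.counit.toLinearMap z) := fun z => by
    refine LinearMap.congr_fun (f := (TensorProduct.rid k D).toLinearMap ∘ₗ TensorProduct.map
      LinearMap.id ND.words.counit.toLinearMap ∘ₗ
        braidRInv (groupPairing T q) ND.words.coactR.toLinearMap)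
      (g := (TensorProduct.lid k D).toLinearMap ∘ₗ LinearMap.rTensor D
        ND.words.counit.toLinearMap) ?_ z
    apply ND.words.linearMap_ext_wt₂ ND.words.toGradedGen
    intro β γ v w hv hw
    simp [braidRInv_tmul T ND.words v hw]
  refine (h3 _).trans ?_
  exact LinearMap.congr_fun ND.words.counit_left d

end Contraction

end Reorder

/-! ### Left multiplications as operators on `D ⊗ kY ⊗ B` -/

section Operators

variable {k : Type*} [Field k]

theorem crossMul_tmul {X Y : Type*} [Ring X] [Algebra k X] [Ring Y] [Algebra k Y]
    (σ : Y ⊗[k] X →ₗ[k] X ⊗[k] Y) (x x' u : X) (y y' v : Y) (h : σ (y ⊗ₜ x') = u ⊗ₜ v) :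
    crossMul σ ((x ⊗ₜ y) ⊗ₜ (x' ⊗ₜ y')) = (x * u) ⊗ₜ (v * y') := by
  simp [crossMul, h]

variable {I : Type*} {C : LusztigCartanDatum I} {q : kˣ} {Y X : Type*} [AddCommGroup Y]
  [AddCommGroup X] (T : LusztigRootDatum C Y X) [DecidableEq I] {c : I → k} {D B : Type*}
  [Ring D] [Algebra k D] [Ring B] [Algebra k B] (ND : Nichols C q c D) (NB : Nichols C q c B)

theorem crossHD_single (μ : Y) (d : D) :
    crossHD (groupPairing T q) ND.words.coactR.toLinearMap
      ((AddMonoidAlgebra.single μ 1 : AddMonoidAlgebra k Y) ⊗ₜ d) =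
      ND.words.twist (T.weightChar q μ) d ⊗ₜ AddMonoidAlgebra.single μ 1 := by
  simp [crossHD, leftAct_single]

theorem crossBH_single (b : B) (μ : Y) :
    crossBH (groupPairing T q) NB.words.coact.toLinearMap
      (b ⊗ₜ (AddMonoidAlgebra.single μ 1 : AddMonoidAlgebra k Y)) =
      AddMonoidAlgebra.single μ 1 ⊗ₜ NB.words.twist (T.weightChar q μ) b := by
  simp [crossBH, rightAct_single]

/-- The operator by which `K_μ` acts from the left. -/
def torusOp (B : Type*) [Ring B] [Algebra k B] (μ : Y) : D ⊗[k] (AddMonoidAlgebra k Y ⊗[k] B) →ₗ[k]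
    D ⊗[k] (AddMonoidAlgebra k Y ⊗[k] B) :=
  TensorProduct.map (ND.words.twist (T.weightChar q μ)).toLinearMap (TensorProduct.map
    (LinearMap.mulLeft k (AddMonoidAlgebra.single μ 1)) LinearMap.id)

/-- The operator by which `K_ν a` acts from the right. -/
def rightOp (D : Type*) [Ring D] [Algebra k D] (ν : Y) (a : B) :
    D ⊗[k] (AddMonoidAlgebra k Y ⊗[k] B) →ₗ[k] D ⊗[k] (AddMonoidAlgebra k Y ⊗[k] B) :=
  TensorProduct.map LinearMap.id (TensorProduct.map
    (LinearMap.mulRight k (AddMonoidAlgebra.single ν 1))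
    (LinearMap.mulRight k a ∘ₗ (NB.words.twist (T.weightChar q ν)).toLinearMap))

/-- The operator by which `f ∈ D` acts from the left. -/
def lowerOp (Y : Type*) [AddCommGroup Y] (B : Type*) [Ring B] [Algebra k B] (f : D) :
    D ⊗[k] (AddMonoidAlgebra k Y ⊗[k] B) →ₗ[k] D ⊗[k] (AddMonoidAlgebra k Y ⊗[k] B) :=
  TensorProduct.map (LinearMap.mulLeft k f) LinearMap.id

omit [AddCommGroup Y] in
/-- Extensionality for maps on `D ⊗ kY ⊗ B`. -/
theorem triple_ext {M : Type*} [AddCommMonoid M] [Module k M]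
    {φ ψ : D ⊗[k] (AddMonoidAlgebra k Y ⊗[k] B) →ₗ[k] M}
    (h : ∀ d μ b, φ (d ⊗ₜ (AddMonoidAlgebra.single μ 1 ⊗ₜ b)) =
      ψ (d ⊗ₜ (AddMonoidAlgebra.single μ 1 ⊗ₜ b))) : φ = ψ := by
  apply TensorProduct.ext_threefold'
  intro d g b
  induction g using groupAlgebra_induction with
  | zero => simp
  | single μ => exact h d μ b
  | add x y hx hy => simp only [TensorProduct.add_tmul, TensorProduct.tmul_add, map_add, hx, hy]
  | smul a x hx => simp only [← TensorProduct.smul_tmul', TensorProduct.tmul_smul, map_smul, hx]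

/-- The product is `reorder` surrounded by operators which involve only the outer factors.
Statements about the product thus become commutation rules between operators. -/
theorem mulU_single (f d : D) (μ ν : Y) (b a : B) :
    (lusztigInput T ND NB).mulU ((f ⊗ₜ (AddMonoidAlgebra.single μ 1 ⊗ₜ b)) ⊗ₜ
      (d ⊗ₜ (AddMonoidAlgebra.single ν 1 ⊗ₜ a))) =
    lowerOp Y B f (torusOp T ND B μ (rightOp T NB D ν a
      ((lusztigInput T ND NB).reorder (b ⊗ₜ d)))) := by
  simp only [DoubleInput.mulU, LinearMap.comp_apply, LinearEquiv.coe_coe, LinearMap.rTensor_tmul,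
    TensorProduct.assoc_symm_tmul, TensorProduct.assoc_tmul, LinearMap.lTensor_tmul]
  generalize (lusztigInput T ND NB).reorder (b ⊗ₜ d) = z
  induction z with
  | zero => simp
  | add x y hx hy => simp only [map_add, TensorProduct.add_tmul, TensorProduct.tmul_add, hx, hy]
  | tmul x z =>
    induction z with
    | zero => simp
    | add x y hx hy => simp only [map_add, TensorProduct.add_tmul, TensorProduct.tmul_add, hx, hy]
    | tmul h y =>
      have h1 : crossMul (crossBH (lusztigInput T ND NB).W (lusztigInput T ND NB).ρB)
          ((h ⊗ₜ y) ⊗ₜ (AddMonoidAlgebra.single ν 1 ⊗ₜ a)) =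
          (h * AddMonoidAlgebra.single ν 1) ⊗ₜ (NB.words.twist (T.weightChar q ν) y * a) :=
        crossMul_tmul _ _ _ _ _ _ _ (crossBH_single T NB y ν)
      have h2 : crossMul (crossHD (lusztigInput T ND NB).W (lusztigInput T ND NB).ρD)
          ((f ⊗ₜ AddMonoidAlgebra.single μ 1) ⊗ₜ (x ⊗ₜ (h * AddMonoidAlgebra.single ν 1))) =
          (f * ND.words.twist (T.weightChar q μ) x) ⊗ₜ
            (AddMonoidAlgebra.single μ 1 * (h * AddMonoidAlgebra.single ν 1)) :=
        crossMul_tmul _ _ _ _ _ _ _ (crossHD_single T ND μ x)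
      rw [TensorProduct.assoc_tmul, LinearMap.lTensor_tmul, h1, TensorProduct.assoc_symm_tmul,
        TensorProduct.assoc_symm_tmul, LinearMap.rTensor_tmul, h2]
      simp [lowerOp, torusOp, rightOp]

theorem crossOp_tmul (i : I) (d : D) (ν : Y) (a : B) :
    crossOp T ND NB i (d ⊗ₜ (AddMonoidAlgebra.single ν 1 ⊗ₜ a)) =
      (q : k) ^ T.pairing ν (T.root i) • d ⊗ₜ (AddMonoidAlgebra.single ν 1 ⊗ₜ
        (NB.words.gen i * a)) +
      ND.words.rder (evGen ND NB i) d ⊗ₜ (AddMonoidAlgebra.single (T.tilde i + ν) 1 ⊗ₜ a) -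
      ND.words.chi C q (-Finsupp.single i 1) (ND.words.lder (evGen ND NB i) d) ⊗ₜ
        (AddMonoidAlgebra.single (-T.tilde i + ν) 1 ⊗ₜ a) := by
  simp only [crossOp, LinearMap.add_apply, LinearMap.sub_apply, TensorProduct.map_tmul,
    rootTwist_single, AddMonoidAlgebra.single_mul_single, ← TensorProduct.smul_tmul',
    TensorProduct.tmul_smul, AlgHom.toLinearMap_apply, LinearMap.mulLeft_apply, LinearMap.id_apply,
    LinearMap.comp_apply, mul_one]

theorem torusOp_tmul (μ : Y) (d : D) (ν : Y) (a : B) :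
    torusOp T ND B μ (d ⊗ₜ (AddMonoidAlgebra.single ν 1 ⊗ₜ a)) =
      ND.words.twist (T.weightChar q μ) d ⊗ₜ (AddMonoidAlgebra.single (μ + ν) 1 ⊗ₜ a) := by
  simp [torusOp, AddMonoidAlgebra.single_mul_single]

theorem rightOp_tmul (ν : Y) (a : B) (d : D) (μ : Y) (b : B) :
    rightOp T NB D ν a (d ⊗ₜ (AddMonoidAlgebra.single μ 1 ⊗ₜ b)) =
      d ⊗ₜ (AddMonoidAlgebra.single (μ + ν) 1 ⊗ₜ (NB.words.twist (T.weightChar q ν) b * a)) := by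
  simp [rightOp, AddMonoidAlgebra.single_mul_single]

@[simp] theorem lowerOp_tmul (f d : D) (z : AddMonoidAlgebra k Y ⊗[k] B) :
    lowerOp Y B f (d ⊗ₜ z) = (f * d) ⊗ₜ z := by
  simp [lowerOp]

theorem lowerOp_one : lowerOp Y B (1 : D) = (LinearMap.id :
    D ⊗[k] (AddMonoidAlgebra k Y ⊗[k] B) →ₗ[k] D ⊗[k] (AddMonoidAlgebra k Y ⊗[k] B)) := by
  rw [lowerOp, LinearMap.mulLeft_one, TensorProduct.map_id]

omit [DecidableEq I] in
theorem weightChar_gElt (μ : Y) (i : I) :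
    T.weightChar q μ (gElt k i) = (q : k) ^ T.pairing μ (T.root i) := by
  rw [T.weightChar_single, T.rootHom_single]

/-- A fragment of associativity, which lets the recursion for `reorder` pass through the right
factors of a product. -/
theorem crossOp_rightOp (i : I) (ν : Y) (a : B) :
    crossOp T ND NB i ∘ₗ rightOp T NB D ν a = rightOp T NB D ν a ∘ₗ crossOp T ND NB i := by
  apply triple_ext
  intro d μ b
  simp only [LinearMap.comp_apply, crossOp_tmul, rightOp_tmul, map_add, map_sub, map_smul, map_mul,
    GradedGen.twist_gen, weightChar_gElt, LinearMap.add_apply, zpow_add₀ q.ne_zero, mul_smul,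
    smul_mul_assoc, TensorProduct.tmul_smul, mul_assoc, add_assoc]

omit [DecidableEq I] in
theorem weightChar_zero : T.weightChar q 0 = C.formChar q 0 := by
  rw [← T.weightChar_tildeHom, map_zero]

omit [DecidableEq I] in
theorem twist_weightChar_add {V : Type*} [Ring V] [Algebra k V] (g : GradedGen k I V) (μ ν : Y)
    (v : V) : g.twist (T.weightChar q μ) (g.twist (T.weightChar q ν) v) =
      g.twist (T.weightChar q (μ + ν)) v := by
  refine LinearMap.congr_fun (f := (g.twist (T.weightChar q μ)).toLinearMap ∘ₗ
    (g.twist (T.weightChar q ν)).toLinearMap)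
    (g := (g.twist (T.weightChar q (μ + ν))).toLinearMap) (g.linearMap_ext_wt ?_) v
  intro β v hv
  simp [hv.twist, T.weightChar_single, zpow_add₀, mul_comm, smul_smul]

theorem torusOp_zero : torusOp T ND B 0 = (LinearMap.id :
    D ⊗[k] (AddMonoidAlgebra k Y ⊗[k] B) →ₗ[k] D ⊗[k] (AddMonoidAlgebra k Y ⊗[k] B)) := by
  apply triple_ext
  intro d μ b
  rw [torusOp_tmul, weightChar_zero, zero_add]
  simp

theorem torusOp_add (μ ν : Y) : torusOp T ND B μ ∘ₗ torusOp T ND B ν =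
    torusOp T ND B (μ + ν) := by
  apply triple_ext
  intro d κ b
  simp only [LinearMap.comp_apply, torusOp_tmul, twist_weightChar_add, add_assoc]

/-- The derivations lower the degree in `D` by `i`, so each term acquires the same power of `q` as
the term with `gen i`. -/
theorem crossOp_torusOp (i : I) (μ : Y) : crossOp T ND NB i ∘ₗ torusOp T ND B μ =
    (q : k) ^ T.pairing μ (T.root i) • (torusOp T ND B μ ∘ₗ crossOp T ND NB i) := by
  have hφ := ND.ev_isLetter NB i
  apply triple_ext
  intro d κ b
  simp only [LinearMap.comp_apply, torusOp_tmul, crossOp_tmul, LinearMap.smul_apply, map_add,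
    map_sub, map_smul, hφ.rder_twist, hφ.lder_twist, weightChar_gElt, LinearMap.add_apply,
    zpow_add₀ q.ne_zero, mul_smul, smul_add, smul_sub, ← TensorProduct.smul_tmul',
    add_left_comm _ μ, GradedGen.twist_comm _ (C.formChar q _)]

theorem torusOp_lowerOp (μ : Y) (i : I) : torusOp T ND B μ ∘ₗ lowerOp Y B (ND.words.gen i) =
    (q : k) ^ T.pairing μ (T.root i) •
      (lowerOp Y B (ND.words.gen i) ∘ₗ torusOp T ND B μ) := by
  apply triple_ext
  intro d κ b
  simp only [LinearMap.comp_apply, torusOp_tmul, lowerOp_tmul, LinearMap.smul_apply, map_mul,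
    GradedGen.twist_gen, weightChar_gElt, smul_mul_assoc, TensorProduct.smul_tmul']

theorem crossOp_lowerOp (i j : I) :
    crossOp T ND NB i ∘ₗ lowerOp Y B (ND.words.gen j) -
      lowerOp Y B (ND.words.gen j) ∘ₗ crossOp T ND NB i =
    ND.ev NB (ND.words.gen j) (NB.words.gen i) •
      (torusOp T ND B (T.tilde i) - torusOp T ND B (-T.tilde i)) := by
  have hφ := ND.ev_isLetter NB i
  apply triple_ext
  intro d κ b
  have h1 : T.weightChar q (T.tilde i) = C.formChar q (Finsupp.single i 1) := by
    rw [← T.weightChar_tildeHom, T.tildeHom_single]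
  have h2 : T.weightChar q (-T.tilde i) = C.formChar q (-Finsupp.single i 1) := by
    rw [← T.weightChar_tildeHom, map_neg, T.tildeHom_single]
  simp only [LinearMap.comp_apply, torusOp_tmul, lowerOp_tmul, LinearMap.smul_apply,
    LinearMap.sub_apply, crossOp_tmul, map_add, map_sub, map_smul, map_mul, hφ.rder_gen_mul,
    hφ.lder_gen_mul, TensorProduct.add_tmul, ← TensorProduct.smul_tmul', h1, h2,
    GradedGen.chi_gen, LinearMap.flip_apply, smul_sub, smul_mul_assoc, smul_smul]
  -- The factor from the Leibniz rule of `lder` and the one from twisting `gen j` are inverse to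
  -- each other. The terms which still contain a derivative of `d` therefore cancel and only the
  -- torus terms remain.
  rw [show (q : k) ^ C.form (Finsupp.single j 1) (Finsupp.single i 1) *
    (q : k) ^ C.form (-Finsupp.single i 1) (Finsupp.single j 1) = 1 by
      rw [← zpow_add₀ q.ne_zero, map_neg, LinearMap.neg_apply, C.symm (Finsupp.single j 1),
        add_neg_cancel, zpow_zero], one_smul]
  abel

/-- For `b = 1` this identifies `crossOp` with left multiplication by `e_i`; in general it shows
that words in `B` multiply as compositions of these operators. -/
theorem mulU_gen_mul (i : I) (b : B) (m : D ⊗[k] (AddMonoidAlgebra k Y ⊗[k] B)) :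
    (lusztigInput T ND NB).mulU ((1 ⊗ₜ (1 ⊗ₜ (NB.words.gen i * b))) ⊗ₜ m) =
      crossOp T ND NB i ((lusztigInput T ND NB).mulU ((1 ⊗ₜ (1 ⊗ₜ b)) ⊗ₜ m)) := by
  refine LinearMap.congr_fun (f := (lusztigInput T ND NB).mulU ∘ₗ
      TensorProduct.mk k _ _ (1 ⊗ₜ (1 ⊗ₜ (NB.words.gen i * b))))
    (g := crossOp T ND NB i ∘ₗ (lusztigInput T ND NB).mulU ∘ₗ
      TensorProduct.mk k _ _ (1 ⊗ₜ (1 ⊗ₜ b))) (triple_ext ?_) m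
  intro d ν a
  simp only [LinearMap.comp_apply, TensorProduct.mk_apply, AddMonoidAlgebra.one_def, mulU_single,
    reorder_gen_mul, torusOp_zero, lowerOp_one, LinearMap.id_apply]
  exact (LinearMap.congr_fun (crossOp_rightOp T ND NB i ν a) _).symm

theorem mulU_one (m : D ⊗[k] (AddMonoidAlgebra k Y ⊗[k] B)) :
    (lusztigInput T ND NB).mulU ((1 ⊗ₜ (1 ⊗ₜ 1)) ⊗ₜ m) = m := by
  refine LinearMap.congr_fun (f := (lusztigInput T ND NB).mulU ∘ₗ
      TensorProduct.mk k _ _ (1 ⊗ₜ (1 ⊗ₜ 1))) (g := LinearMap.id) (triple_ext ?_) m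
  intro d ν a
  simp only [LinearMap.comp_apply, TensorProduct.mk_apply]
  rw [AddMonoidAlgebra.one_def, mulU_single, reorder_one, torusOp_zero, lowerOp_one,
    AddMonoidAlgebra.one_def, rightOp_tmul]
  simp

theorem mulU_tmul (f : D) (μ : Y) (b : B) (m : D ⊗[k] (AddMonoidAlgebra k Y ⊗[k] B)) :
    (lusztigInput T ND NB).mulU ((f ⊗ₜ (AddMonoidAlgebra.single μ 1 ⊗ₜ b)) ⊗ₜ m) =
      lowerOp Y B f (torusOp T ND B μ
        ((lusztigInput T ND NB).mulU ((1 ⊗ₜ (1 ⊗ₜ b)) ⊗ₜ m))) := by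
  refine LinearMap.congr_fun (f := (lusztigInput T ND NB).mulU ∘ₗ
      TensorProduct.mk k _ _ (f ⊗ₜ (AddMonoidAlgebra.single μ 1 ⊗ₜ b)))
    (g := lowerOp Y B f ∘ₗ torusOp T ND B μ ∘ₗ (lusztigInput T ND NB).mulU ∘ₗ
      TensorProduct.mk k _ _ (1 ⊗ₜ (1 ⊗ₜ b))) (triple_ext ?_) m
  intro d ν a
  simp only [LinearMap.comp_apply, TensorProduct.mk_apply, AddMonoidAlgebra.one_def, mulU_single,
    torusOp_zero, lowerOp_one, LinearMap.id_apply]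

end Operators

/-! ### The algebras `f`, `B` and `D` as quotients by one radical -/

section Quotients

variable {k : Type*} [Field k] {I : Type*} [DecidableEq I] {C : LusztigCartanDatum I} {q : kˣ}

/-- Equality modulo the radical is a congruence. -/
def radCon (C : LusztigCartanDatum I) (q : kˣ) (c : I → k) : RingCon (FreeAlgebra k I) where
  r := radLeft C (q : k) c
  iseqv := ⟨fun _ _ => rfl, fun h b => (h b).symm, fun h h' b => (h b).trans (h' b)⟩
  mul' {w x y z} h h' b := by
    have e : freePairing C (q : k) c w = freePairing C (q : k) c x := LinearMap.ext h
    have e' : freePairing C (q : k) c y = freePairing C (q : k) c z := LinearMap.ext h'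
    rw [freePairing_mul_left, freePairing_mul_left, e, e']
  add' h h' b := by simp only [map_add, LinearMap.add_apply, h b, h' b]

/-- The quotient of the free algebra by the relation of equality modulo the radical. -/
def Nichols.ofRel {c : I → k} {r : FreeAlgebra k I → FreeAlgebra k I → Prop}
    (hr : ∀ x y, r x y ↔ radLeft C (q : k) c x y) : Nichols C q c (RingQuot r) where
  π := RingQuot.mkAlgHom k r
  surjective := RingQuot.mkAlgHom_surjective k r
  ker x := by
    have h0 : (∀ b, freePairing C (q : k) c x b = 0) ↔ radLeft C (q : k) c x 0 := by
      simp [radLeft]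
    rw [h0]
    constructor
    -- No more than the radical is killed: equality modulo the radical is already a ring congruence,
    -- so the projection to its quotient factors through `RingQuot r`.
    · intro h
      have hx : RingQuot.mkRingHom r x = RingQuot.mkRingHom r 0 := by
        rw [map_zero, ← RingQuot.mkAlgHom_coe k]; exact h
      have w : ∀ ⦃a b⦄, r a b → (radCon C q c).mk' a = (radCon C q c).mk' b := fun a b h =>
        (RingCon.eq _).2 ((hr a b).1 h)
      have hl := RingQuot.lift_mkRingHom_apply (radCon C q c).mk' w
      exact (RingCon.eq _).1 ((hl x).symm.trans ((congrArg _ hx).trans (hl 0)))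
    · intro h
      rw [RingQuot.mkAlgHom_rel k ((hr x 0).2 h), map_zero]

theorem radRight_iff (c : I → k) (x y : FreeAlgebra k I) :
    radRight C (q : k) c x y ↔ radLeft C (q : k) c x y := by
  constructor
  · intro h b; rw [freePairing_symm, h, freePairing_symm]
  · intro h b; rw [freePairing_symm, h, freePairing_symm]

/-- `B` as a quotient by the radical. -/
def nicholsB (C : LusztigCartanDatum I) (q : kˣ) :
    Nichols C q (bosNorm C (q : k)) (QuotB C (q : k)) :=
  Nichols.ofRel (radRight_iff _)

/-- `D` as a quotient by the radical. -/
def nicholsD (C : LusztigCartanDatum I) (q : kˣ) :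
    Nichols C q (bosNorm C (q : k)) (QuotD C (q : k)) :=
  Nichols.ofRel fun _ _ => Iff.rfl

omit [DecidableEq I] in
-- Since `q_i - q_i⁻¹ = q_i (1 - q_i⁻²)`, the two normalisations differ by the unit `q_i`.
theorem lusNorm_eq (C : LusztigCartanDatum I) (q : kˣ) :
    lusNorm C (q : k) = fun i => ((q ^ C.half i : kˣ) : k) * bosNorm C (q : k) i := by
  funext i
  have h : C.qi (q : k) i ≠ 0 := zpow_ne_zero _ q.ne_zero
  rw [lusNorm, bosNorm, Units.val_zpow_eq_zpow_val]
  change _ = C.qi (q : k) i * _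
  have e : C.qi (q : k) i - (C.qi (q : k) i)⁻¹ =
      C.qi (q : k) i * (1 - (C.qi (q : k) i)⁻¹ ^ 2) := by
    field_simp
  rw [e, mul_inv, mul_inv_cancel_left₀ h]

theorem lusNorm_radical (C : LusztigCartanDatum I) (q : kˣ) (x : FreeAlgebra k I) :
    (∀ b, freePairing C (q : k) (lusNorm C (q : k)) x b = 0) ↔
      ∀ b, freePairing C (q : k) (bosNorm C (q : k)) x b = 0 := by
  rw [lusNorm_eq]
  exact radical_rescale C q _ _ x

/-- Lusztig's algebra `f` as a quotient by the radical for the other normalisation. -/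
def nicholsF (C : LusztigCartanDatum I) (q : kˣ) :
    Nichols C q (bosNorm C (q : k)) (LusztigF C (q : k)) where
  π := RingQuot.mkAlgHom k _
  surjective := RingQuot.mkAlgHom_surjective k _
  ker x := ((Nichols.ofRel (q := q) (c := lusNorm C (q : k)) fun _ _ => Iff.rfl).ker x).trans
    (lusNorm_radical C q x)

/-- Two quotients by the radical are isomorphic. -/
def Nichols.equiv {c : I → k} {V W : Type*} [Ring V] [Algebra k V] [Ring W] [Algebra k W]
    (N : Nichols C q c V) (N' : Nichols C q c W) : V ≃ₐ[k] W :=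
  have h : ∀ x, N.π x = 0 → N'.π x = 0 := fun x hx => (N'.ker x).2 ((N.ker x).1 hx)
  have h' : ∀ x, N'.π x = 0 → N.π x = 0 := fun x hx => (N.ker x).2 ((N'.ker x).1 hx)
  AlgEquiv.ofAlgHom (N.descendAlg N'.π h) (N'.descendAlg N.π h')
    (by
      ext x
      obtain ⟨x, rfl⟩ := N'.surjective x
      simp [N.descendAlg_π h, N'.descendAlg_π h'])
    (by
      ext x
      obtain ⟨x, rfl⟩ := N.surjective x
      simp [N.descendAlg_π h, N'.descendAlg_π h'])

theorem Nichols.equiv_π {c : I → k} {V W : Type*} [Ring V] [Algebra k V] [Ring W] [Algebra k W]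
    (N : Nichols C q c V) (N' : Nichols C q c W) (x : FreeAlgebra k I) :
    N.equiv N' (N.π x) = N'.π x :=
  N.descendAlg_π (fun x hx => (N'.ker x).2 ((N.ker x).1 hx)) x

end Quotients

/-! ### Realisations of the relations and the triangular map -/

section Realisation

variable {k : Type*} [Field k] {I : Type*} [DecidableEq I] {C : LusztigCartanDatum I} {q : kˣ}
  {Y X : Type*} [AddCommGroup Y] [AddCommGroup X] {T : LusztigRootDatum C Y X} {c : I → k}
  {U : Type*} [Ring U] [Algebra k U]

/-- Elements of an algebra which satisfy the relations of the double-bosonisation. -/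
structure IsRealisation (T : LusztigRootDatum C Y X) (q : kˣ) (c : I → k) (e f : I → U)
    (K : Y → U) : Prop where
  K_zero : K 0 = 1
  K_add : ∀ μ ν, K μ * K ν = K (μ + ν)
  e_K : ∀ μ i, e i * K μ = (q : k) ^ T.pairing μ (T.root i) • (K μ * e i)
  K_f : ∀ μ i, K μ * f i = (q : k) ^ T.pairing μ (T.root i) • (f i * K μ)
  e_f : ∀ i j, e i * f j - f j * e i =
    if i = j then c i • (K (T.tilde i) - K (-T.tilde i)) else 0
  rad_e : ∀ x, (∀ b, freePairing C (q : k) c x b = 0) → FreeAlgebra.lift k e x = 0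
  rad_f : ∀ x, (∀ b, freePairing C (q : k) c x b = 0) → FreeAlgebra.lift k f x = 0

theorem ev_gen_gen {D B : Type*} [Ring D] [Algebra k D] [Ring B] [Algebra k B]
    (ND : Nichols C q c D) (NB : Nichols C q c B) (i j : I) :
    ND.ev NB (ND.words.gen i) (NB.words.gen j) = if i = j then c i else 0 := by
  rw [ND.words_gen, NB.words_gen, ND.ev_π, freePairing_gen]
  by_cases h : i = j
  · simp [freeCoord, h]
  · simp [freeCoord, h, Ne.symm h]

/-- The action of the generators on `D ⊗ kY ⊗ B` by left multiplication. -/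
theorem isRealisation_operators {D B : Type*} [Ring D] [Algebra k D] [Ring B] [Algebra k B]
    (ND : Nichols C q c D) (NB : Nichols C q c B) :
    IsRealisation (U := Module.End k (D ⊗[k] (AddMonoidAlgebra k Y ⊗[k] B))) T q c
      (crossOp T ND NB) (fun i => lowerOp Y B (ND.words.gen i)) (torusOp T ND B) where
  K_zero := torusOp_zero T ND
  K_add := torusOp_add T ND
  e_K μ i := crossOp_torusOp T ND NB i μ
  K_f μ i := torusOp_lowerOp T ND μ i
  e_f i j := by
    refine (crossOp_lowerOp T ND NB i j).trans ?_
    rw [ev_gen_gen]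
    by_cases h : j = i
    · subst h; simp
    · rw [if_neg h, if_neg (Ne.symm h), zero_smul]
  rad_e x hx := by
    -- A word in the operators is left multiplication by the image of that word in `B`, so every
    -- relation of `B` acts as zero.
    have key : ∀ x : FreeAlgebra k I, ∀ m, FreeAlgebra.lift k (A := Module.End k
        (D ⊗[k] (AddMonoidAlgebra k Y ⊗[k] B))) (crossOp T ND NB) x m =
        (lusztigInput T ND NB).mulU ((1 ⊗ₜ (1 ⊗ₜ NB.π x)) ⊗ₜ m) := by
      intro x m
      induction x using (freeWords C q).induction with
      | one => rw [map_one, map_one, mulU_one]; rfl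
      | gen_mul i x hx =>
        rw [map_mul, Module.End.mul_apply, hx, freeWords_gen, FreeAlgebra.lift_ι_apply, map_mul]
        exact (mulU_gen_mul T ND NB i _ m).symm
      | add x y hx hy =>
        simp only [map_add, LinearMap.add_apply, hx, hy, TensorProduct.tmul_add,
          TensorProduct.add_tmul]
      | smul a x hx =>
        simp only [map_smul, LinearMap.smul_apply, hx, TensorProduct.tmul_smul,
          ← TensorProduct.smul_tmul']
    refine LinearMap.ext fun m => ?_
    rw [key, (NB.ker x).2 hx]
    simp
  rad_f x hx := by
    -- Likewise words in the lowering operators are left multiplication by their image in `D`.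
    have key : ∀ x : FreeAlgebra k I, FreeAlgebra.lift k (A := Module.End k
        (D ⊗[k] (AddMonoidAlgebra k Y ⊗[k] B))) (fun i => lowerOp Y B (ND.words.gen i)) x =
        lowerOp Y B (ND.π x) := by
      intro x
      induction x using (freeWords C q).induction with
      | one => rw [map_one, map_one, lowerOp_one]; rfl
      | gen_mul i x hx =>
        rw [map_mul, hx, freeWords_gen, FreeAlgebra.lift_ι_apply, map_mul]
        apply TensorProduct.ext'
        intro d z
        rw [Module.End.mul_apply, lowerOp_tmul, lowerOp_tmul, lowerOp_tmul, mul_assoc]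
        rfl
      | add x y hx hy =>
        rw [map_add, hx, hy, map_add]
        apply TensorProduct.ext'
        intro d z
        simp [add_mul, TensorProduct.add_tmul]
      | smul a x hx =>
        rw [map_smul, hx, map_smul]
        apply TensorProduct.ext'
        intro d z
        simp [TensorProduct.smul_tmul']
    rw [key, (ND.ker x).2 hx]
    apply TensorProduct.ext'
    intro d z
    simp

namespace IsRealisation

variable {e f : I → U} {K : Y → U} (h : IsRealisation T q c e f K) {D B : Type*} [Ring D]
  [Algebra k D] [Ring B] [Algebra k B] (ND : Nichols C q c D) (NB : Nichols C q c B)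

include h in
theorem torus_neg_mul (μ : Y) : K (-μ) * K μ = 1 := by rw [h.K_add, neg_add_cancel, h.K_zero]

include h in
theorem torus_mul_neg (μ : Y) : K μ * K (-μ) = 1 := by rw [h.K_add, add_neg_cancel, h.K_zero]

/-- The algebra map `kY → U`. -/
def torus (h : IsRealisation T q c e f K) : AddMonoidAlgebra k Y →ₐ[k] U :=
  AddMonoidAlgebra.lift k U Y
    { toFun := fun μ => K μ.toAdd
      map_one' := h.K_zero
      map_mul' := fun _ _ => (h.K_add _ _).symm }

@[simp] theorem torus_single (μ : Y) : h.torus (AddMonoidAlgebra.single μ 1) = K μ := by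
  simp [torus]

/-- The algebra map `D → U`. -/
def lower (h : IsRealisation T q c e f K) (ND : Nichols C q c D) : D →ₐ[k] U :=
  ND.descendAlg (FreeAlgebra.lift k f) fun x hx => h.rad_f x ((ND.ker x).1 hx)

/-- The algebra map `B → U`. -/
def upper (h : IsRealisation T q c e f K) (NB : Nichols C q c B) : B →ₐ[k] U :=
  NB.descendAlg (FreeAlgebra.lift k e) fun x hx => h.rad_e x ((NB.ker x).1 hx)

theorem lower_π (x : FreeAlgebra k I) : h.lower ND (ND.π x) = FreeAlgebra.lift k f x :=
  ND.descendAlg_π _ x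

theorem upper_π (x : FreeAlgebra k I) : h.upper NB (NB.π x) = FreeAlgebra.lift k e x :=
  NB.descendAlg_π _ x

@[simp] theorem lower_gen (i : I) : h.lower ND (ND.words.gen i) = f i := by
  rw [ND.words_gen, lower_π, FreeAlgebra.lift_ι_apply]

@[simp] theorem upper_gen (i : I) : h.upper NB (NB.words.gen i) = e i := by
  rw [NB.words_gen, upper_π, FreeAlgebra.lift_ι_apply]

theorem torus_lower (μ : Y) (v : D) :
    K μ * h.lower ND v = h.lower ND (ND.words.twist (T.weightChar q μ) v) * K μ := by
  induction v using ND.words.induction with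
  | one => simp
  | gen_mul i v hv =>
    rw [map_mul, ← mul_assoc, h.lower_gen, h.K_f, smul_mul_assoc, mul_assoc, hv, map_mul, map_mul,
      GradedGen.twist_gen, map_smul, h.lower_gen, weightChar_gElt]
    simp only [smul_mul_assoc, mul_assoc]
  | add v w hv hw => simp only [map_add, add_mul, mul_add, hv, hw]
  | smul a v hv => simp only [map_smul, smul_mul_assoc, mul_smul_comm, hv]

/-- The commutation rule built into `crossOp`, now derived in an arbitrary realisation from the
commutators `[e_i, f_j]`. Moving `K (± T.tilde i)` past the rest of a word produces exactly the
twists in the Leibniz rules of `rder` and `lder`. -/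
theorem e_lower (i : I) (v : D) : e i * h.lower ND v = h.lower ND v * e i +
    h.lower ND (ND.words.rder (evGen ND NB i) v) * K (T.tilde i) -
    h.lower ND (ND.words.chi C q (-Finsupp.single i 1) (ND.words.lder (evGen ND NB i) v)) *
      K (-T.tilde i) := by
  have hφ := ND.ev_isLetter NB i
  induction v using ND.words.induction with
  | one => simp [hφ.rder_one, hφ.lder_one]
  | gen_mul j v hv =>
    have hef : e i * f j = f j * e i + ND.ev NB (ND.words.gen j) (NB.words.gen i) •
        (K (T.tilde i) - K (-T.tilde i)) := by
      rw [ev_gen_gen, ← sub_eq_iff_eq_add', h.e_f]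
      by_cases hij : j = i
      · subst hij; simp
      · rw [if_neg hij, if_neg (Ne.symm hij), zero_smul]
    have h1 : T.weightChar q (T.tilde i) = C.formChar q (Finsupp.single i 1) := by
      rw [← T.weightChar_tildeHom, T.tildeHom_single]
    have h2 : T.weightChar q (-T.tilde i) = C.formChar q (-Finsupp.single i 1) := by
      rw [← T.weightChar_tildeHom, map_neg, T.tildeHom_single]
    have h3 := h.torus_lower ND (T.tilde i) v
    have h4 := h.torus_lower ND (-T.tilde i) v
    rw [h1] at h3
    rw [h2] at h4
    have h5 : (q : k) ^ C.form (Finsupp.single j 1) (Finsupp.single i 1) *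
        (q : k) ^ C.form (-Finsupp.single i 1) (Finsupp.single j 1) = 1 := by
      rw [← zpow_add₀ q.ne_zero, map_neg, LinearMap.neg_apply, C.symm (Finsupp.single j 1),
        add_neg_cancel, zpow_zero]
    rw [map_mul, h.lower_gen, ← mul_assoc, hef, add_mul, mul_assoc, hv, hφ.rder_gen_mul,
      hφ.lder_gen_mul]
    simp only [map_add, map_smul, map_mul, h.lower_gen, GradedGen.chi_gen, smul_mul_assoc,
      sub_mul, mul_add, mul_sub, add_mul, h3, h4, smul_sub, smul_smul, h5, one_smul, mul_assoc,
      LinearMap.flip_apply]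
    abel
  | add v w hv hw => simp only [map_add, add_mul, mul_add, hv, hw]; abel
  | smul a v hv => simp only [map_smul, smul_mul_assoc, mul_smul_comm, hv, smul_add, smul_sub]

/-- The map `c ⊗ h ⊗ b ↦ c h b`. -/
def triangular (h : IsRealisation T q c e f K) (ND : Nichols C q c D) (NB : Nichols C q c B) :
    D ⊗[k] (AddMonoidAlgebra k Y ⊗[k] B) →ₗ[k] U :=
  LinearMap.mul' k U ∘ₗ TensorProduct.map (h.lower ND).toLinearMap
    (LinearMap.mul' k U ∘ₗ TensorProduct.map h.torus.toLinearMap (h.upper NB).toLinearMap)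

@[simp] theorem triangular_tmul (d : D) (g : AddMonoidAlgebra k Y) (b : B) :
    h.triangular ND NB (d ⊗ₜ (g ⊗ₜ b)) = h.lower ND d * (h.torus g * h.upper NB b) := by
  simp [triangular]

/-- With the next two lemmas this makes the triangular map intertwine the operators on `D ⊗ kY ⊗ B`
with left multiplication in `U`. -/
theorem triangular_crossOp (i : I) (m : D ⊗[k] (AddMonoidAlgebra k Y ⊗[k] B)) :
    h.triangular ND NB (crossOp T ND NB i m) = e i * h.triangular ND NB m := by
  refine LinearMap.congr_fun (f := h.triangular ND NB ∘ₗ crossOp T ND NB i)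
    (g := LinearMap.mulLeft k (e i) ∘ₗ h.triangular ND NB) (triple_ext ?_) m
  intro d μ b
  simp only [LinearMap.comp_apply, crossOp_tmul, map_add, map_sub, map_smul, triangular_tmul,
    torus_single, LinearMap.mulLeft_apply, ← mul_assoc, h.e_lower ND NB, ← h.K_add]
  simp only [add_mul, sub_mul, mul_assoc, map_mul, h.upper_gen]
  rw [← mul_assoc (e i) (K μ), h.e_K]
  simp only [mul_smul_comm, smul_mul_assoc, mul_assoc]

theorem triangular_torusOp (μ : Y) (m : D ⊗[k] (AddMonoidAlgebra k Y ⊗[k] B)) :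
    h.triangular ND NB (torusOp T ND B μ m) = K μ * h.triangular ND NB m := by
  refine LinearMap.congr_fun (f := h.triangular ND NB ∘ₗ torusOp T ND B μ)
    (g := LinearMap.mulLeft k (K μ) ∘ₗ h.triangular ND NB) (triple_ext ?_) m
  intro d ν b
  simp only [LinearMap.comp_apply, torusOp_tmul, triangular_tmul, torus_single,
    LinearMap.mulLeft_apply, ← mul_assoc, h.torus_lower, ← h.K_add]

theorem triangular_lowerOp (d : D) (m : D ⊗[k] (AddMonoidAlgebra k Y ⊗[k] B)) :
    h.triangular ND NB (lowerOp Y B d m) = h.lower ND d * h.triangular ND NB m := by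
  refine LinearMap.congr_fun (f := h.triangular ND NB ∘ₗ lowerOp Y B d)
    (g := LinearMap.mulLeft k (h.lower ND d) ∘ₗ h.triangular ND NB) (triple_ext ?_) m
  intro d ν b
  simp only [LinearMap.comp_apply, lowerOp_tmul, triangular_tmul, LinearMap.mulLeft_apply,
    map_mul, mul_assoc]

end IsRealisation

end Realisation

/-! ### Coproduct, counit and antipode as new realisations -/

section Realisation

variable {k : Type*} [Field k] {I : Type*} {C : LusztigCartanDatum I} {q : kˣ}
  {Y X : Type*} [AddCommGroup Y] [AddCommGroup X] {T : LusztigRootDatum C Y X}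

section Stretch

variable {V : Type*} [Ring V] [Algebra k V] (T) (b : BraidedWords C q V)

/-- `u ⊗ w ↦ u⁽²⁾ ⊗ R(u⁽¹⁾) ⊗ w`. -/
def BraidedWords.stretchL : V ⊗[k] V →ₗ[k] V ⊗[k] (AddMonoidAlgebra k Y ⊗[k] V) :=
  (TensorProduct.assoc k V _ V).toLinearMap ∘ₗ LinearMap.rTensor V
    ((TensorProduct.comm k _ V).toLinearMap ∘ₗ
      LinearMap.rTensor V (groupHom k T.tildeHom).toLinearMap ∘ₗ b.coact.toLinearMap)

/-- `v ⊗ w ↦ v ⊗ Rbar(w⁽²⁾) ⊗ w⁽¹⁾`. -/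
def BraidedWords.stretchR : V ⊗[k] V →ₗ[k] (V ⊗[k] AddMonoidAlgebra k Y) ⊗[k] V :=
  (TensorProduct.assoc k V _ V).symm.toLinearMap ∘ₗ LinearMap.lTensor V
    ((TensorProduct.comm k V _).toLinearMap ∘ₗ
      LinearMap.lTensor V (groupHom k (-T.tildeHom)).toLinearMap ∘ₗ b.coactR.toLinearMap)

theorem BraidedWords.stretchL_tmul {α : I →₀ ℤ} {u : V} (hu : b.IsWt α u) (w : V) :
    b.stretchL T (u ⊗ₜ w) = u ⊗ₜ (AddMonoidAlgebra.single (T.tildeHom α) 1 ⊗ₜ w) := by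
  rw [GradedGen.IsWt] at hu
  simp [BraidedWords.stretchL, hu]

theorem BraidedWords.stretchR_tmul (v : V) {γ : I →₀ ℤ} {w : V} (hw : b.IsWt γ w) :
    b.stretchR T (v ⊗ₜ w) = (v ⊗ₜ AddMonoidAlgebra.single (-T.tildeHom γ) 1) ⊗ₜ w := by
  have := hw.coactR
  simp [BraidedWords.stretchR, this]

end Stretch

variable [DecidableEq I] {c : I → k} {U : Type*} [Ring U] [Algebra k U]

namespace IsRealisation

variable {e f : I → U} {K : Y → U} (h : IsRealisation T q c e f K) {D B : Type*} [Ring D]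
  [Algebra k D] [Ring B] [Algebra k B] (ND : Nichols C q c D) (NB : Nichols C q c B)

include h in
theorem torus_e (μ : Y) (i : I) : K μ * e i = (q : k) ^ (-T.pairing μ (T.root i)) • (e i * K μ) := by
  rw [h.e_K, smul_smul, ← zpow_add₀ q.ne_zero, neg_add_cancel, zpow_zero, one_smul]

include h in
theorem f_torus (μ : Y) (i : I) : f i * K μ = (q : k) ^ (-T.pairing μ (T.root i)) • (K μ * f i) := by
  rw [h.K_f, smul_smul, ← zpow_add₀ q.ne_zero, neg_add_cancel, zpow_zero, one_smul]

/-- The coproduct of `B` inside `U ⊗ U`, before application of the braided coproduct. -/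
def upperTensor (h : IsRealisation T q c e f K) (NB : Nichols C q c B) :
    B ⊗[k] B →ₗ[k] U ⊗[k] U :=
  TensorProduct.map (h.upper NB).toLinearMap
    (LinearMap.mul' k U ∘ₗ TensorProduct.map h.torus.toLinearMap (h.upper NB).toLinearMap) ∘ₗ
      NB.words.stretchL T

/-- The coproduct of `D` inside `U ⊗ U`, before application of the coproduct of `C̄`. -/
def lowerTensor (h : IsRealisation T q c e f K) (ND : Nichols C q c D) :
    D ⊗[k] D →ₗ[k] U ⊗[k] U :=
  TensorProduct.map (LinearMap.mul' k U ∘ₗ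
      TensorProduct.map (h.lower ND).toLinearMap h.torus.toLinearMap) (h.lower ND).toLinearMap ∘ₗ
    ND.words.stretchR T

theorem upperTensor_tmul {α : I →₀ ℤ} {u : B} (hu : NB.words.IsWt α u) (w : B) :
    h.upperTensor NB (u ⊗ₜ w) = h.upper NB u ⊗ₜ (K (T.tildeHom α) * h.upper NB w) := by
  simp [upperTensor, NB.words.stretchL_tmul T hu]

theorem lowerTensor_tmul (v : D) {γ : I →₀ ℤ} {w : D} (hw : ND.words.IsWt γ w) :
    h.lowerTensor ND (v ⊗ₜ w) = (h.lower ND v * K (-T.tildeHom γ)) ⊗ₜ h.lower ND w := by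
  simp [lowerTensor, ND.words.stretchR_tmul T v hw]

/-- Moving `e_i` past the torus element `K̃_α` in the second leg gives `q ^ (i · α)`, which is the
braiding factor in `comulStep`. -/
theorem upperTensor_comulStep (i : I) (z : B ⊗[k] B) :
    h.upperTensor NB (NB.words.comulStep C q i z) =
      (e i ⊗ₜ K (T.tilde i) + 1 ⊗ₜ e i) * h.upperTensor NB z := by
  refine LinearMap.congr_fun (f := h.upperTensor NB ∘ₗ NB.words.comulStep C q i)
    (g := LinearMap.mulLeft k (e i ⊗ₜ K (T.tilde i) + 1 ⊗ₜ e i) ∘ₗ h.upperTensor NB)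
    (NB.words.linearMap_ext_wt₂ NB.words.toGradedGen ?_) z
  intro α β u w hu _
  have h1 := (NB.words.isWt_gen i).mul hu
  have h2 := NB.words.isWt_chi C q hu (Finsupp.single i 1)
  simp only [LinearMap.comp_apply, NB.words.comulStep_tmul, map_add, h.upperTensor_tmul NB h1,
    h.upperTensor_tmul NB h2, h.upperTensor_tmul NB hu, LinearMap.mulLeft_apply, add_mul,
    Algebra.TensorProduct.tmul_mul_tmul, one_mul, map_mul, h.upper_gen, T.tildeHom_single,
    ← h.K_add, mul_assoc]
  rw [← mul_assoc (e i) (K _), h.e_K, T.pairing_tildeHom_root, C.symm α]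
  simp only [hu.chi, map_smul, smul_mul_assoc, TensorProduct.tmul_smul, TensorProduct.smul_tmul',
    mul_assoc]

/-- The inverse braiding exchanges the legs, so the first term of `comulStep` puts the letter into
the second leg. Its scalar is the one produced when `K (-T.tilde i)` passes the first leg. -/
theorem lowerTensor_comulStep (i : I) (z : D ⊗[k] D) :
    h.lowerTensor ND (braidRInv (groupPairing T q) ND.words.coactR.toLinearMap
      (ND.words.comulStep C q i z)) = (f i ⊗ₜ 1 + K (-T.tilde i) ⊗ₜ f i) *
        h.lowerTensor ND (braidRInv (groupPairing T q) ND.words.coactR.toLinearMap z) := by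
  refine LinearMap.congr_fun (f := h.lowerTensor ND ∘ₗ
      braidRInv (groupPairing T q) ND.words.coactR.toLinearMap ∘ₗ ND.words.comulStep C q i)
    (g := LinearMap.mulLeft k (f i ⊗ₜ 1 + K (-T.tilde i) ⊗ₜ f i) ∘ₗ h.lowerTensor ND ∘ₗ
      braidRInv (groupPairing T q) ND.words.coactR.toLinearMap)
    (ND.words.linearMap_ext_wt₂ ND.words.toGradedGen ?_) z
  intro β γ v w hv hw
  have h1 := (ND.words.isWt_gen i).mul hw
  have h2 := ND.words.isWt_chi C q ((ND.words.isWt_gen i).mul hv) (-γ)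
  have h3 := ND.words.isWt_chi C q (ND.words.isWt_chi C q hv (Finsupp.single i 1))
    (-(Finsupp.single i 1 + γ))
  have h4 := ND.words.isWt_chi C q hv (-γ)
  have h5 : T.weightChar q (-T.tilde i) = C.formChar q (-Finsupp.single i 1) := by
    rw [← T.weightChar_tildeHom, map_neg, T.tildeHom_single]
  have h6 := h.torus_lower ND (-T.tilde i) w
  rw [h5, hw.chi, map_smul, smul_mul_assoc] at h6
  simp only [LinearMap.comp_apply, ND.words.comulStep_tmul, map_add, braidRInv_tmul T ND.words _ h1,
    braidRInv_tmul T ND.words _ hw, h.lowerTensor_tmul ND _ h2, h.lowerTensor_tmul ND _ h3,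
    h.lowerTensor_tmul ND _ h4, LinearMap.mulLeft_apply, add_mul,
    Algebra.TensorProduct.tmul_mul_tmul, one_mul]
  rw [← mul_assoc (K _) (h.lower ND w), h6, ND.words.chi_chi,
    show -(Finsupp.single i 1 + γ) + Finsupp.single i 1 = -γ by abel]
  simp only [map_mul, ND.words.chi_gen, map_smul, smul_mul_assoc, h.lower_gen, T.tildeHom_single,
    mul_assoc, h.K_add, neg_add, TensorProduct.tmul_smul, TensorProduct.smul_tmul', map_neg,
    LinearMap.neg_apply, C.symm γ]
  abel

/-- Words in the proposed coproducts of the `e_i` factor through the braided coproduct of `B`, so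
they vanish on the radical. -/
theorem lift_tensor_e (x : FreeAlgebra k I) : FreeAlgebra.lift k
    (fun i => e i ⊗ₜ[k] K (T.tilde i) + 1 ⊗ₜ e i) x =
      h.upperTensor NB (NB.words.comul (NB.π x)) := by
  induction x using (freeWords C q).induction with
  | one =>
    rw [map_one, map_one, NB.words.comul_one, h.upperTensor_tmul NB NB.words.isWt_one, map_zero,
      h.K_zero, map_one, mul_one]
    rfl
  | gen_mul i x hx =>
    have : NB.π ((freeWords C q).gen i) = NB.words.gen i := rfl
    rw [map_mul, hx, map_mul, this, NB.words.comul_gen_mul, h.upperTensor_comulStep,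
      freeWords_gen, FreeAlgebra.lift_ι_apply]
  | add x y hx hy => simp only [map_add, hx, hy]
  | smul a x hx => simp only [map_smul, hx]

theorem lift_tensor_f (x : FreeAlgebra k I) : FreeAlgebra.lift k
    (fun i => f i ⊗ₜ[k] 1 + K (-T.tilde i) ⊗ₜ f i) x =
      h.lowerTensor ND (ND.words.comulBar T (ND.π x)) := by
  rw [BraidedWords.comulBar, LinearMap.comp_apply]
  induction x using (freeWords C q).induction with
  | one =>
    rw [map_one, map_one, ND.words.comul_one, braidRInv_tmul T _ _ ND.words.isWt_one, map_one,
      h.lowerTensor_tmul ND _ ND.words.isWt_one, map_zero, neg_zero, h.K_zero, map_one, mul_one]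
    rfl
  | gen_mul i x hx =>
    have : ND.π ((freeWords C q).gen i) = ND.words.gen i := rfl
    rw [map_mul, hx, map_mul, this, ND.words.comul_gen_mul, h.lowerTensor_comulStep,
      freeWords_gen, FreeAlgebra.lift_ι_apply]
  | add x y hx hy => simp only [map_add, hx, hy]
  | smul a x hx => simp only [map_smul, hx]

/-- The coproduct. -/
theorem tensor (h : IsRealisation T q c e f K) (ND : Nichols C q c D) (NB : Nichols C q c B) :
    IsRealisation (U := U ⊗[k] U) T q c
      (fun i => e i ⊗ₜ K (T.tilde i) + 1 ⊗ₜ e i) (fun i => f i ⊗ₜ 1 + K (-T.tilde i) ⊗ₜ f i)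
      (fun μ => K μ ⊗ₜ K μ) where
  K_zero := by rw [h.K_zero]; rfl
  K_add μ ν := by rw [Algebra.TensorProduct.tmul_mul_tmul, h.K_add]
  e_K μ i := by
    simp only [add_mul, mul_add, Algebra.TensorProduct.tmul_mul_tmul, one_mul, mul_one, h.e_K,
      smul_add, TensorProduct.tmul_smul, ← TensorProduct.smul_tmul', h.K_add, add_comm μ]
  K_f μ i := by
    simp only [add_mul, mul_add, Algebra.TensorProduct.tmul_mul_tmul, one_mul, mul_one, h.K_f,
      smul_add, TensorProduct.tmul_smul, ← TensorProduct.smul_tmul', h.K_add, add_comm μ]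
  e_f i j := by
    -- The mixed terms of the commutator cancel: reordering the two legs gives inverse powers of
    -- `q`, by symmetry of the form.
    have h1 : (e i * K (-T.tilde j)) ⊗ₜ[k] (K (T.tilde i) * f j) =
        (K (-T.tilde j) * e i) ⊗ₜ (f j * K (T.tilde i)) := by
      rw [h.e_K, h.K_f, TensorProduct.tmul_smul, ← TensorProduct.smul_tmul', smul_smul,
        ← zpow_add₀ q.ne_zero, map_neg, LinearMap.neg_apply, T.pairing_tilde_root,
        T.pairing_tilde_root, C.symm (Finsupp.single j 1), add_neg_cancel,
        zpow_zero, one_smul]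
    have h2 : (e i ⊗ₜ K (T.tilde i) + 1 ⊗ₜ e i) * (f j ⊗ₜ 1 + K (-T.tilde j) ⊗ₜ f j) -
        (f j ⊗ₜ 1 + K (-T.tilde j) ⊗ₜ f j) * (e i ⊗ₜ K (T.tilde i) + 1 ⊗ₜ e i) =
        (e i * f j - f j * e i) ⊗ₜ[k] K (T.tilde i) +
          K (-T.tilde j) ⊗ₜ (e i * f j - f j * e i) := by
      simp only [add_mul, mul_add, Algebra.TensorProduct.tmul_mul_tmul, one_mul, mul_one, h1,
        TensorProduct.sub_tmul, TensorProduct.tmul_sub]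
      abel
    rw [h2, h.e_f]
    by_cases hij : i = j
    · subst hij
      simp only [if_true, ← TensorProduct.smul_tmul', TensorProduct.tmul_smul,
        TensorProduct.sub_tmul, TensorProduct.tmul_sub, ← smul_add]
      congr 1
      abel
    · simp [hij]
  rad_e x hx := by rw [h.lift_tensor_e NB, (NB.ker x).2 hx, map_zero, map_zero]
  rad_f x hx := by rw [h.lift_tensor_f ND, (ND.ker x).2 hx, map_zero, map_zero]

/-- The counit. -/
theorem counit (NB : Nichols C q c B) :
    IsRealisation (U := k) T q c (fun _ => 0) (fun _ => 0) (fun _ => 1) where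
  K_zero := rfl
  K_add _ _ := one_mul 1
  e_K _ _ := by simp
  K_f _ _ := by simp
  e_f _ _ := by simp
  rad_e x hx := by
    -- The lift of the zero family is the counit of the free algebra, which factors through the
    -- quotient.
    have := NB.words_counit x
    rw [(NB.ker x).2 hx, map_zero] at this
    exact this.symm
  rad_f x hx := by
    have := NB.words_counit x
    rw [(NB.ker x).2 hx, map_zero] at this
    exact this.symm

/-- `v ↦ S(v) K_{-|v|}`. -/
def upperAntipode (h : IsRealisation T q c e f K) (NB : Nichols C q c B) : B →ₗ[k] U :=
  LinearMap.mul' k U ∘ₗ TensorProduct.map (h.upper NB).toLinearMap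
    (h.torus.comp (groupHom k (-T.tildeHom))).toLinearMap ∘ₗ NB.words.coactR.toLinearMap ∘ₗ
      NB.words.antipode

/-- `v ↦ K_{|v|} S⁻¹(v)`. -/
def lowerAntipode (h : IsRealisation T q c e f K) (ND : Nichols C q c D) : D →ₗ[k] U :=
  LinearMap.mul' k U ∘ₗ TensorProduct.map (h.torus.comp (groupHom k T.tildeHom)).toLinearMap
    (h.lower ND).toLinearMap ∘ₗ ND.words.coact.toLinearMap ∘ₗ ND.words.antipodeInv

theorem upperAntipode_apply {β : I →₀ ℤ} {v : B} (hv : NB.words.IsWt β v) :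
    h.upperAntipode NB v = h.upper NB (NB.words.antipode v) * K (-T.tildeHom β) := by
  have := (hv.map NB.words.antipode_covariant).coactR
  simp [upperAntipode, this]

theorem lowerAntipode_apply {β : I →₀ ℤ} {v : D} (hv : ND.words.IsWt β v) :
    h.lowerAntipode ND v = K (T.tildeHom β) * h.lower ND (ND.words.antipodeInv v) := by
  have := hv.map ND.words.antipodeInv_covariant
  rw [GradedGen.IsWt] at this
  simp [lowerAntipode, this]

/-- The twist in the recursion for the braided antipode equals the scalar for moving `e_i` past `K
(-T.tildeHom β)`. The dressed map is therefore exactly antimultiplicative on letters. -/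
theorem upperAntipode_gen_mul (i : I) (v : B) : h.upperAntipode NB (NB.words.gen i * v) =
    h.upperAntipode NB v * -(e i * K (-T.tilde i)) := by
  refine LinearMap.congr_fun (f := h.upperAntipode NB ∘ₗ LinearMap.mulLeft k (NB.words.gen i))
    (g := LinearMap.mulRight k (-(e i * K (-T.tilde i))) ∘ₗ h.upperAntipode NB)
    (NB.words.linearMap_ext_wt ?_) v
  intro β v hv
  have h1 := (NB.words.isWt_gen i).mul hv
  simp only [LinearMap.comp_apply, LinearMap.mulLeft_apply, LinearMap.mulRight_apply,
    h.upperAntipode_apply NB h1, h.upperAntipode_apply NB hv, NB.words.antipode_gen_mul,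
    (hv.map NB.words.antipode_covariant).chi, map_neg, map_mul, map_smul, h.upper_gen]
  rw [mul_neg, mul_assoc, ← mul_assoc (K _) (e i), h.torus_e, map_neg, LinearMap.neg_apply,
    T.pairing_tildeHom_root, neg_neg, C.symm β]
  simp only [smul_mul_assoc, mul_smul_comm, neg_mul, mul_assoc, h.K_add, map_add,
    T.tildeHom_single, neg_add, add_comm (-T.tildeHom β)]

/-- The inverse twist in the recursion for `antipodeInv` is undone by moving `K (T.tilde i)` across.
-/
theorem lowerAntipode_gen_mul (i : I) (v : D) : h.lowerAntipode ND (ND.words.gen i * v) =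
    h.lowerAntipode ND v * -(K (T.tilde i) * f i) := by
  refine LinearMap.congr_fun (f := h.lowerAntipode ND ∘ₗ LinearMap.mulLeft k (ND.words.gen i))
    (g := LinearMap.mulRight k (-(K (T.tilde i) * f i)) ∘ₗ h.lowerAntipode ND)
    (ND.words.linearMap_ext_wt ?_) v
  intro β v hv
  have h1 := (ND.words.isWt_gen i).mul hv
  have h2 := h.torus_lower ND (T.tilde i)
    (ND.words.chi C q (-Finsupp.single i 1) (ND.words.antipodeInv v))
  rw [← T.tildeHom_single, T.weightChar_tildeHom, ND.words.chi_chi, add_neg_cancel,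
    ND.words.chi_zero, T.tildeHom_single] at h2
  simp only [LinearMap.comp_apply, LinearMap.mulLeft_apply, LinearMap.mulRight_apply,
    h.lowerAntipode_apply ND h1, h.lowerAntipode_apply ND hv, ND.words.antipodeInv_gen_mul,
    map_neg, map_mul, h.lower_gen, mul_neg]
  rw [mul_assoc, ← mul_assoc (h.lower ND (ND.words.antipodeInv v)), ← h2, map_add,
    T.tildeHom_single, add_comm, ← h.K_add]
  simp only [mul_assoc]

open MulOpposite in
/-- The antipode. -/
theorem opposite (h : IsRealisation T q c e f K) (ND : Nichols C q c D) (NB : Nichols C q c B) :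
    IsRealisation (U := Uᵐᵒᵖ) T q c
      (fun i => op (-(e i * K (-T.tilde i)))) (fun i => op (-(K (T.tilde i) * f i)))
      (fun μ => op (K (-μ))) where
  K_zero := by rw [neg_zero, h.K_zero, op_one]
  K_add μ ν := by rw [← op_mul, h.K_add, neg_add, add_comm]
  e_K μ i := by
    rw [← op_mul, ← op_mul, ← op_smul, mul_neg, neg_mul, ← mul_assoc, h.torus_e, mul_assoc,
      smul_mul_assoc, mul_assoc, h.K_add, h.K_add, map_neg, LinearMap.neg_apply, neg_neg, smul_neg,
      add_comm]
  K_f μ i := by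
    rw [← op_mul, ← op_mul, ← op_smul, mul_neg, neg_mul, mul_assoc, h.f_torus, ← mul_assoc,
      mul_smul_comm, ← mul_assoc, h.K_add, h.K_add, map_neg, LinearMap.neg_apply, neg_neg, smul_neg,
      add_comm]
  e_f i j := by
    -- The two exchanges give powers of `q` which cancel by symmetry. The commutator in the opposite
    -- algebra becomes `-[e_i, f_j]` between two torus elements.
    have h1 : e i * (K (-T.tilde i) * (K (T.tilde j) * f j)) =
        K (T.tilde j) * (e i * f j) * K (-T.tilde i) := by
      rw [← mul_assoc (K _), h.K_add, add_comm, ← h.K_add, mul_assoc, h.K_f, ← mul_assoc, h.e_K]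
      simp only [smul_mul_assoc, mul_smul_comm, smul_smul, mul_assoc]
      rw [← zpow_add₀ q.ne_zero, map_neg, LinearMap.neg_apply, T.pairing_tilde_root,
        T.pairing_tilde_root, C.symm (Finsupp.single j 1), neg_add_cancel,
        zpow_zero, one_smul]
    have h2 : K (T.tilde j) * f j * (e i * K (-T.tilde i)) -
        e i * K (-T.tilde i) * (K (T.tilde j) * f j) =
        K (T.tilde j) * -(e i * f j - f j * e i) * K (-T.tilde i) := by
      rw [mul_assoc (e i), h1, neg_sub, mul_sub, sub_mul]
      simp only [mul_assoc]
    rw [← op_mul, ← op_mul, ← op_sub, neg_mul_neg, neg_mul_neg, h2, h.e_f]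
    by_cases hij : i = j
    · subst hij
      rw [if_pos rfl, if_pos rfl, ← op_sub, ← op_smul, neg_neg, ← smul_neg, mul_smul_comm,
        smul_mul_assoc, neg_sub, mul_sub, sub_mul, h.K_add, h.K_add, h.K_add, h.K_add,
        add_neg_cancel, zero_add, add_neg_cancel_right]
    · rw [if_neg hij, if_neg hij, neg_zero, mul_zero, zero_mul, op_zero]
  rad_e x hx := by
    have key : ∀ x : FreeAlgebra k I, FreeAlgebra.lift k
        (fun i => op (-(e i * K (-T.tilde i)))) x = op (h.upperAntipode NB (NB.π x)) := by
      intro x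
      induction x using (freeWords C q).induction with
      | one =>
        rw [map_one, map_one, h.upperAntipode_apply NB NB.words.isWt_one, NB.words.antipode_one,
          map_zero, neg_zero, h.K_zero, map_one, mul_one, op_one]
      | gen_mul i x hx =>
        have : NB.π ((freeWords C q).gen i) = NB.words.gen i := rfl
        rw [map_mul, hx, map_mul, this, h.upperAntipode_gen_mul, op_mul,
          freeWords_gen, FreeAlgebra.lift_ι_apply]
      | add x y hx hy => simp only [map_add, hx, hy, op_add]
      | smul a x hx => simp only [map_smul, hx, op_smul]
    rw [key, (NB.ker x).2 hx, map_zero, op_zero]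
  rad_f x hx := by
    have key : ∀ x : FreeAlgebra k I, FreeAlgebra.lift k
        (fun i => op (-(K (T.tilde i) * f i))) x = op (h.lowerAntipode ND (ND.π x)) := by
      intro x
      induction x using (freeWords C q).induction with
      | one =>
        rw [map_one, map_one, h.lowerAntipode_apply ND ND.words.isWt_one, ND.words.antipodeInv_one,
          map_zero, h.K_zero, map_one, mul_one, op_one]
      | gen_mul i x hx =>
        have : ND.π ((freeWords C q).gen i) = ND.words.gen i := rfl
        rw [map_mul, hx, map_mul, this, h.lowerAntipode_gen_mul, op_mul,
          freeWords_gen, FreeAlgebra.lift_ι_apply]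
      | add x y hx hy => simp only [map_add, hx, hy, op_add]
      | smul a x hx => simp only [map_smul, hx, op_smul]
    rw [key, (ND.ker x).2 hx, map_zero, op_zero]

end IsRealisation

end Realisation

/-! ### The antipode axiom on products -/

section Antipode

variable {k : Type*} [Field k] {U : Type*} [Ring U] [Algebra k U] (S : U →ₐ[k] Uᵐᵒᵖ)

/-- An algebra map to the opposite algebra, as a linear endomorphism. -/
def antiEnd : U →ₗ[k] U := (MulOpposite.opLinearEquiv k).symm.toLinearMap ∘ₗ S.toLinearMap

@[simp] theorem antiEnd_apply (u : U) : antiEnd S u = (S u).unop := rfl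

/-- Since `S` reverses products, the contraction of `z` appears in the middle of that of `z * w`; if
it is a scalar it comes out. Thus the antipode axiom passes to products and need only be checked on
generators. -/
theorem mul_antiEnd_rTensor (z w : U ⊗[k] U) (r : k)
    (hz : LinearMap.mul' k U (LinearMap.rTensor U (antiEnd S) z) = algebraMap k U r) :
    LinearMap.mul' k U (LinearMap.rTensor U (antiEnd S) (z * w)) =
      r • LinearMap.mul' k U (LinearMap.rTensor U (antiEnd S) w) := by
  induction w with
  | zero => simp
  | add x y hx hy => simp only [mul_add, map_add, hx, hy, smul_add]
  | tmul x y =>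
    have h : ∀ z : U ⊗[k] U, LinearMap.mul' k U (LinearMap.rTensor U (antiEnd S) (z * x ⊗ₜ y)) =
        (S x).unop * LinearMap.mul' k U (LinearMap.rTensor U (antiEnd S) z) * y := fun z => by
      induction z with
      | zero => simp
      | add x y hx hy => simp only [add_mul, mul_add, map_add, hx, hy]
      | tmul a b => simp [mul_assoc]
    rw [h, hz, Algebra.algebraMap_eq_smul_one]
    simp

theorem mul_antiEnd_lTensor (z w : U ⊗[k] U) (r : k)
    (hw : LinearMap.mul' k U (LinearMap.lTensor U (antiEnd S) w) = algebraMap k U r) :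
    LinearMap.mul' k U (LinearMap.lTensor U (antiEnd S) (z * w)) =
      r • LinearMap.mul' k U (LinearMap.lTensor U (antiEnd S) z) := by
  induction z with
  | zero => simp
  | add x y hx hy => simp only [add_mul, map_add, hx, hy, smul_add]
  | tmul x y =>
    have h : ∀ w : U ⊗[k] U, LinearMap.mul' k U (LinearMap.lTensor U (antiEnd S) (x ⊗ₜ y * w)) =
        x * LinearMap.mul' k U (LinearMap.lTensor U (antiEnd S) w) * (S y).unop := fun w => by
      induction w with
      | zero => simp
      | add x y hx hy => simp only [add_mul, mul_add, map_add, hx, hy]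
      | tmul a b => simp [mul_assoc]
    rw [h, hw, Algebra.algebraMap_eq_smul_one]
    simp

end Antipode

/-! ### `U_q(g)` as a Hopf algebra -/

section UqHopf

variable {k : Type*} [Field k] {I : Type*} [DecidableEq I] {C : LusztigCartanDatum I}
  {Y X : Type*} [AddCommGroup Y] [AddCommGroup X] (T : LusztigRootDatum C Y X) (q : kˣ)

omit [DecidableEq I] in
theorem algHom_lift {A U : Type*} [Ring A] [Algebra k A] [Ring U] [Algebra k U] (g : A →ₐ[k] U)
    (f : I → A) (x : FreeAlgebra k I) :
    g (FreeAlgebra.lift k f x) = FreeAlgebra.lift k (fun i => g (f i)) x := by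
  refine AlgHom.congr_fun (φ₁ := g.comp (FreeAlgebra.lift k f)) ?_ x
  ext i
  simp

/-- Lusztig's algebra, to carry the Hopf algebra structure of the double-bosonisation. -/
def QuantumGroup : Type _ := Uq T (q : k)

instance : Ring (QuantumGroup T q) := inferInstanceAs (Ring (Uq T (q : k)))

instance : Algebra k (QuantumGroup T q) := inferInstanceAs (Algebra k (Uq T (q : k)))

/-- The identity map. -/
def quantumEquiv : Uq T (q : k) ≃ₐ[k] QuantumGroup T q := AlgEquiv.refl

/-- The presentation of Lusztig's algebra. -/
def quantumMk : FreeAlgebra k (UqGen I Y) →ₐ[k] QuantumGroup T q :=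
  (quantumEquiv T q).toAlgHom.comp (RingQuot.mkAlgHom k (UqRel T (q : k)))

/-- `-Eᵢ ∈ U_q(g)`. -/
def uqE (i : I) : QuantumGroup T q := -quantumMk T q (ug k (.E i))

/-- `Fᵢ ∈ U_q(g)`. -/
def uqF (i : I) : QuantumGroup T q := quantumMk T q (ug k (.F i))

/-- `K_{-μ} ∈ U_q(g)`. -/
def uqK (μ : Y) : QuantumGroup T q := quantumMk T q (ug k (.K (-μ)))

variable {T q}

/-- Changing the sign of all letters is the twist by the character `gᵢ ↦ -1`. It is self-adjoint for
the pairing and so preserves the radical. -/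
theorem lift_neg_eq_zero {U : Type*} [Ring U] [Algebra k U] {e : I → U} {c : I → k}
    (he : ∀ x, (∀ b, freePairing C (q : k) c x b = 0) → FreeAlgebra.lift k e x = 0)
    (x : FreeAlgebra k I) (hx : ∀ b, freePairing C (q : k) c x b = 0) :
    FreeAlgebra.lift k (fun i => -e i) x = 0 := by
  have h : FreeAlgebra.lift k (fun i => -e i) =
      (FreeAlgebra.lift k e).comp ((freeWords C q).twist (scaleChar fun _ => -1)) := by
    ext i
    have := (freeWords C q).twist_gen (scaleChar fun _ => -1) i
    rw [freeWords_gen] at this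
    simp [this]
  rw [h, AlgHom.comp_apply]
  refine he _ fun b => ?_
  rw [freePairing_twist, hx]

theorem quantumMk_rel {x y : FreeAlgebra k (UqGen I Y)} (h : UqRel T (q : k) x y) :
    quantumMk T q x = quantumMk T q y :=
  congrArg (quantumEquiv T q) (RingQuot.mkAlgHom_rel k h)

/-- Negating the exponents of `K` converts the commutation rules with the `E_i` and `F_i`, and
exchanges `K̃_i` with its inverse in `[E_i, F_i]`; the sign in `-E_i` compensates for this exchange.
-/
theorem uq_isRealisation : IsRealisation T q (bosNorm C (q : k)) (uqE T q) (uqF T q) (uqK T q) where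
  K_zero := by
    have := quantumMk_rel (UqRel.K_zero (T := T) (q := (q : k)))
    rw [map_one] at this
    rwa [uqK, neg_zero]
  K_add μ ν := by
    have := quantumMk_rel (UqRel.K_add (T := T) (q := (q : k)) (-μ) (-ν))
    rw [map_mul] at this
    rwa [uqK, uqK, uqK, neg_add]
  e_K μ i := by
    have := quantumMk_rel (UqRel.K_E (T := T) (q := (q : k)) (-μ) i)
    rw [map_mul, map_smul, map_mul] at this
    rw [uqE, uqK, mul_neg, this, neg_mul, smul_neg, smul_smul, ← zpow_add₀ q.ne_zero, map_neg,
      LinearMap.neg_apply, add_neg_cancel, zpow_zero, one_smul]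
  K_f μ i := by
    have := quantumMk_rel (UqRel.K_F (T := T) (q := (q : k)) (-μ) i)
    rwa [map_mul, map_smul, map_mul, map_neg, LinearMap.neg_apply, neg_neg] at this
  e_f i j := by
    by_cases hij : i = j
    · subst hij
      have := quantumMk_rel (UqRel.E_F_same (T := T) (q := (q : k)) i)
      rw [map_sub, map_mul, map_mul, map_smul, map_sub] at this
      rw [if_pos rfl, uqE, uqK, uqK, neg_neg, ← neg_sub (quantumMk T q _), smul_neg, neg_mul,
        mul_neg, sub_neg_eq_add, neg_add_eq_sub, ← neg_sub]
      exact congrArg Neg.neg this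
    · have := quantumMk_rel (UqRel.E_F_ne (T := T) (q := (q : k)) i j hij)
      rw [map_sub, map_mul, map_mul, map_zero] at this
      rw [if_neg hij, uqE, neg_mul, mul_neg, sub_neg_eq_add, neg_add_eq_sub, ← neg_sub]
      exact (congrArg Neg.neg this).trans neg_zero
  rad_e := lift_neg_eq_zero fun x hx => by
    have := quantumMk_rel (UqRel.rad_E (T := T) (q := (q : k)) x ((lusNorm_radical C q x).2 hx))
    rwa [map_zero, algHom_lift] at this
  rad_f x hx := by
    have := quantumMk_rel (UqRel.rad_F (T := T) (q := (q : k)) x ((lusNorm_radical C q x).2 hx))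
    rwa [map_zero, algHom_lift] at this

namespace IsRealisation

variable {U : Type*} [Ring U] [Algebra k U] {e f : I → U} {K : Y → U}
  (h : IsRealisation T q (bosNorm C (q : k)) e f K)

/-- The values on the generators of the algebra map defined by a realisation. -/
def genMap (e f : I → U) (K : Y → U) : UqGen I Y → U
  | .E i => -e i
  | .F i => f i
  | .K μ => K (-μ)

/-- The algebra map from `U_q(g)` defined by a realisation. -/
def ofUq (h : IsRealisation T q (bosNorm C (q : k)) e f K) : QuantumGroup T q →ₐ[k] U :=
  (RingQuot.liftAlgHom k ⟨FreeAlgebra.lift k (genMap e f K), fun x y r => by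
    induction r with
    | K_zero => simp [genMap, h.K_zero]
    | K_add μ ν => simp [genMap, h.K_add, add_comm]
    | K_E μ i => simp [genMap, h.torus_e]
    | K_F μ i => simp [genMap, h.K_f]
    | E_F_same i =>
      have := h.e_f i i
      rw [if_pos rfl] at this
      simp only [map_sub, map_mul, map_smul, FreeAlgebra.lift_ι_apply, genMap, neg_mul, mul_neg,
        neg_neg, sub_neg_eq_add, neg_add_eq_sub]
      rw [← neg_sub, this, ← smul_neg, neg_sub]
      rfl
    | E_F_ne i j hij =>
      have := h.e_f i j
      rw [if_neg hij] at this
      simp only [map_sub, map_mul, map_zero, FreeAlgebra.lift_ι_apply, genMap, neg_mul, mul_neg,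
        sub_neg_eq_add, neg_add_eq_sub]
      rw [← neg_sub, this, neg_zero]
    | rad_E x hx =>
      rw [map_zero, algHom_lift]
      simp only [FreeAlgebra.lift_ι_apply, genMap]
      exact lift_neg_eq_zero h.rad_e x ((lusNorm_radical C q x).1 hx)
    | rad_F x hx =>
      rw [map_zero, algHom_lift]
      simp only [FreeAlgebra.lift_ι_apply, genMap]
      exact h.rad_f x ((lusNorm_radical C q x).1 hx)⟩).comp
        (quantumEquiv T q).symm.toAlgHom

theorem ofUq_gen (g : UqGen I Y) : h.ofUq (quantumMk T q (ug k g)) = genMap e f K g :=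
  (RingQuot.liftAlgHom_mkAlgHom_apply k _ _ _).trans (FreeAlgebra.lift_ι_apply _ _)

@[simp] theorem ofUq_e (i : I) : h.ofUq (uqE T q i) = e i := by
  rw [uqE, map_neg, ofUq_gen, genMap, neg_neg]

@[simp] theorem ofUq_f (i : I) : h.ofUq (uqF T q i) = f i := h.ofUq_gen _

@[simp] theorem ofUq_K (μ : Y) : h.ofUq (uqK T q μ) = K μ := by
  rw [uqK, ofUq_gen, genMap, neg_neg]

end IsRealisation

theorem uq_induction {p : QuantumGroup T q → Prop} (scalar : ∀ r, p (algebraMap k _ r))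
    (e : ∀ i, p (uqE T q i)) (f : ∀ i, p (uqF T q i)) (K : ∀ μ, p (uqK T q μ))
    (mul : ∀ x y, p x → p y → p (x * y)) (add : ∀ x y, p x → p y → p (x + y))
    (x : QuantumGroup T q) : p x := by
  obtain ⟨x, rfl⟩ : ∃ y, quantumMk T q y = x :=
    RingQuot.mkAlgHom_surjective k (UqRel T (q : k)) x
  induction x with
  | grade0 r => rw [AlgHom.commutes]; exact scalar r
  | grade1 g =>
    cases g with
    | E i =>
      have h := mul _ _ (scalar (-1)) (e i)
      rw [← Algebra.smul_def, neg_one_smul, uqE, neg_neg] at h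
      exact h
    | F i => exact f i
    | K μ =>
      have h := K (-μ)
      rw [uqK, neg_neg] at h
      exact h
  | mul x y hx hy => rw [map_mul]; exact mul _ _ hx hy
  | add x y hx hy => rw [map_add]; exact add _ _ hx hy

theorem uq_algHom_ext {U : Type*} [Semiring U] [Algebra k U] {φ ψ : QuantumGroup T q →ₐ[k] U}
    (he : ∀ i, φ (uqE T q i) = ψ (uqE T q i)) (hf : ∀ i, φ (uqF T q i) = ψ (uqF T q i))
    (hK : ∀ μ, φ (uqK T q μ) = ψ (uqK T q μ)) : φ = ψ := by
  refine AlgHom.ext fun x => ?_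
  induction x using uq_induction with
  | scalar r => rw [AlgHom.commutes, AlgHom.commutes]
  | e i => exact he i
  | f i => exact hf i
  | K μ => exact hK μ
  | mul x y hx hy => rw [map_mul, map_mul, hx, hy]
  | add x y hx hy => rw [map_add, map_add, hx, hy]

variable (T q)

/-- The coproduct of `U_q(g)`. -/
def uqComul : QuantumGroup T q →ₐ[k] QuantumGroup T q ⊗[k] QuantumGroup T q :=
  (uq_isRealisation.tensor (nicholsD C q) (nicholsB C q)).ofUq

/-- The counit of `U_q(g)`. -/
def uqCounit : QuantumGroup T q →ₐ[k] k := (IsRealisation.counit (nicholsB C q)).ofUq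

/-- The antipode of `U_q(g)`, as a map to the opposite algebra. -/
def uqAntipode : QuantumGroup T q →ₐ[k] (QuantumGroup T q)ᵐᵒᵖ :=
  (uq_isRealisation.opposite (nicholsD C q) (nicholsB C q)).ofUq

@[simp] theorem uqComul_e (i : I) : uqComul T q (uqE T q i) =
    uqE T q i ⊗ₜ uqK T q (T.tilde i) + 1 ⊗ₜ uqE T q i := IsRealisation.ofUq_e _ i

@[simp] theorem uqComul_f (i : I) : uqComul T q (uqF T q i) =
    uqF T q i ⊗ₜ 1 + uqK T q (-T.tilde i) ⊗ₜ uqF T q i := IsRealisation.ofUq_f _ i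

@[simp] theorem uqComul_K (μ : Y) : uqComul T q (uqK T q μ) = uqK T q μ ⊗ₜ uqK T q μ :=
  IsRealisation.ofUq_K _ μ

@[simp] theorem uqCounit_e (i : I) : uqCounit T q (uqE T q i) = 0 := IsRealisation.ofUq_e _ i

@[simp] theorem uqCounit_f (i : I) : uqCounit T q (uqF T q i) = 0 := IsRealisation.ofUq_f _ i

@[simp] theorem uqCounit_K (μ : Y) : uqCounit T q (uqK T q μ) = 1 := IsRealisation.ofUq_K _ μ

@[simp] theorem uqAntipode_e (i : I) : uqAntipode T q (uqE T q i) =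
    MulOpposite.op (-(uqE T q i * uqK T q (-T.tilde i))) := IsRealisation.ofUq_e _ i

@[simp] theorem uqAntipode_f (i : I) : uqAntipode T q (uqF T q i) =
    MulOpposite.op (-(uqK T q (T.tilde i) * uqF T q i)) := IsRealisation.ofUq_f _ i

@[simp] theorem uqAntipode_K (μ : Y) : uqAntipode T q (uqK T q μ) =
    MulOpposite.op (uqK T q (-μ)) := IsRealisation.ofUq_K _ μ

/-- `U_q(g)` as a bialgebra. -/
instance uqBialgebra : Bialgebra k (QuantumGroup T q) :=
  Bialgebra.ofAlgHom (uqComul T q) (uqCounit T q)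
    (uq_algHom_ext
      (fun i => by simp [TensorProduct.tmul_add, TensorProduct.add_tmul, add_assoc,
        Algebra.TensorProduct.one_def])
      (fun i => by simp [TensorProduct.tmul_add, TensorProduct.add_tmul, add_assoc,
        Algebra.TensorProduct.one_def])
      (fun μ => by simp))
    (uq_algHom_ext (fun i => by simp) (fun i => by simp) (fun μ => by simp))
    (uq_algHom_ext (fun i => by simp) (fun i => by simp) (fun μ => by simp))

theorem uq_antipode_left (x : QuantumGroup T q) : LinearMap.mul' k _ (LinearMap.rTensor _
    (antiEnd (uqAntipode T q)) (uqComul T q x)) = algebraMap k _ (uqCounit T q x) := by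
  have g := uq_isRealisation (T := T) (q := q)
  induction x using uq_induction with
  | scalar r =>
    rw [AlgHom.commutes, AlgHom.commutes, Algebra.TensorProduct.algebraMap_apply,
      LinearMap.rTensor_tmul, LinearMap.mul'_apply, mul_one, antiEnd_apply, AlgHom.commutes]
    rfl
  | e i => simp [mul_assoc, g.torus_neg_mul]
  | f i => simp
  | K μ => simp [g.torus_neg_mul]
  | mul x y hx hy =>
    rw [map_mul, mul_antiEnd_rTensor _ _ _ _ hx, hy, map_mul, map_mul, Algebra.smul_def]
  | add x y hx hy => simp only [map_add, hx, hy]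

theorem uq_antipode_right (x : QuantumGroup T q) : LinearMap.mul' k _ (LinearMap.lTensor _
    (antiEnd (uqAntipode T q)) (uqComul T q x)) = algebraMap k _ (uqCounit T q x) := by
  have g := uq_isRealisation (T := T) (q := q)
  induction x using uq_induction with
  | scalar r =>
    rw [AlgHom.commutes, AlgHom.commutes, Algebra.TensorProduct.algebraMap_apply,
      LinearMap.lTensor_tmul, LinearMap.mul'_apply, antiEnd_apply, map_one]
    exact mul_one _
  | e i => simp
  | f i => simp [← mul_assoc, g.torus_neg_mul]
  | K μ => simp [g.torus_mul_neg]
  | mul x y hx hy =>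
    rw [map_mul, mul_antiEnd_lTensor _ _ _ _ hy, hx, map_mul, map_mul, Algebra.smul_def,
      Algebra.commutes]
  | add x y hx hy => simp only [map_add, hx, hy]

/-- `U_q(g)` as a Hopf algebra. -/
instance uqHopf : HopfAlgebra k (QuantumGroup T q) where
  toBialgebra := uqBialgebra T q
  antipode := antiEnd (uqAntipode T q)
  mul_antipode_rTensor_comul := LinearMap.ext (uq_antipode_left T q)
  mul_antipode_lTensor_comul := LinearMap.ext (uq_antipode_right T q)

end UqHopf

/-! ### Triangular decomposition and the double-bosonisation -/

section Triangular

variable {k : Type*} [Field k] {I : Type*} [DecidableEq I] {C : LusztigCartanDatum I}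
  {Y X : Type*} [AddCommGroup Y] [AddCommGroup X] (T : LusztigRootDatum C Y X) {q : kˣ}
  {D B : Type*} [Ring D] [Algebra k D] [Ring B] [Algebra k B]
  (ND : Nichols C q (bosNorm C (q : k)) D) (NB : Nichols C q (bosNorm C (q : k)) B)

/-- The action of `U_q(g)` on `D ⊗ kY ⊗ B`. -/
def quantumAction : QuantumGroup T q →ₐ[k]
    Module.End k (D ⊗[k] (AddMonoidAlgebra k Y ⊗[k] B)) :=
  (isRealisation_operators ND NB).ofUq

/-- The map `B → U_q(g)`. -/
abbrev quantumUpper : B →ₐ[k] QuantumGroup T q :=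
  (uq_isRealisation (T := T) (q := q)).upper NB

/-- The map `D → U_q(g)`. -/
abbrev quantumLower : D →ₐ[k] QuantumGroup T q :=
  (uq_isRealisation (T := T) (q := q)).lower ND

/-- The map `D ⊗ kY ⊗ B → U_q(g)`. -/
abbrev quantumTriangular : D ⊗[k] (AddMonoidAlgebra k Y ⊗[k] B) →ₗ[k]
    QuantumGroup T q :=
  (uq_isRealisation (T := T) (q := q)).triangular ND NB

theorem quantumAction_e (i : I) : quantumAction T ND NB (uqE T q i) =
    crossOp T ND NB i := IsRealisation.ofUq_e _ i

theorem quantumAction_f (i : I) : quantumAction T ND NB (uqF T q i) =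
    lowerOp Y (B) (ND.words.gen i) := IsRealisation.ofUq_f _ i

theorem quantumAction_K (μ : Y) : quantumAction T ND NB (uqK T q μ) =
    torusOp T ND (B) μ := IsRealisation.ofUq_K _ μ

/-- The intertwining property holds on generators, hence for all of `U_q(g)`. At `1 ⊗ 1 ⊗ 1` it
gives one half of the triangular decomposition. -/
theorem triangular_action (u : QuantumGroup T q)
    (m : D ⊗[k] (AddMonoidAlgebra k Y ⊗[k] B)) :
    quantumTriangular T ND NB (quantumAction T ND NB u m) = u * quantumTriangular T ND NB m := by
  induction u using uq_induction generalizing m with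
  | scalar r =>
    rw [AlgHom.commutes, Algebra.algebraMap_eq_smul_one, Algebra.algebraMap_eq_smul_one]
    simp
  | e i => rw [quantumAction_e, IsRealisation.triangular_crossOp]
  | f i => rw [quantumAction_f, IsRealisation.triangular_lowerOp, IsRealisation.lower_gen]
  | K μ => rw [quantumAction_K, IsRealisation.triangular_torusOp]
  | mul x y hx hy => rw [map_mul, Module.End.mul_apply, hx, hy, mul_assoc]
  | add x y hx hy => rw [map_add, LinearMap.add_apply, map_add, hx, hy, add_mul]

theorem action_upper (b : B)
    (m : D ⊗[k] (AddMonoidAlgebra k Y ⊗[k] B)) :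
    quantumAction T ND NB (quantumUpper T NB b) m =
      (lusztigInput T ND NB).mulU ((1 ⊗ₜ (1 ⊗ₜ b)) ⊗ₜ m) := by
  induction b using NB.words.induction with
  | one => rw [map_one, map_one, mulU_one]; rfl
  | gen_mul i b hb =>
    rw [map_mul, map_mul, IsRealisation.upper_gen, quantumAction_e, Module.End.mul_apply, hb,
      mulU_gen_mul]
  | add x y hx hy =>
    simp only [map_add, LinearMap.add_apply, hx, hy, TensorProduct.tmul_add, TensorProduct.add_tmul]
  | smul a x hx =>
    simp only [map_smul, LinearMap.smul_apply, hx, TensorProduct.tmul_smul,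
      ← TensorProduct.smul_tmul']

theorem action_upper_one (b : B) :
    quantumAction T ND NB (quantumUpper T NB b) (1 ⊗ₜ (1 ⊗ₜ 1)) = 1 ⊗ₜ (1 ⊗ₜ b) := by
  induction b using NB.words.induction with
  | one => rw [map_one, map_one]; rfl
  | gen_mul i b hb =>
    have hφ := ND.ev_isLetter NB i
    rw [map_mul, map_mul, IsRealisation.upper_gen, quantumAction_e, Module.End.mul_apply, hb,
      AddMonoidAlgebra.one_def, crossOp_tmul, hφ.rder_one, hφ.lder_one]
    simp
  | add x y hx hy =>
    simp only [map_add, LinearMap.add_apply, hx, hy, TensorProduct.tmul_add]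
  | smul a x hx =>
    simp only [map_smul, LinearMap.smul_apply, hx, TensorProduct.tmul_smul]

theorem action_lower (d : D) :
    quantumAction T ND NB (quantumLower T ND d) = lowerOp Y (B) d := by
  refine LinearMap.ext fun m => ?_
  induction d using ND.words.induction generalizing m with
  | one => rw [map_one, map_one, lowerOp_one]; rfl
  | gen_mul i d hd =>
    rw [map_mul, map_mul, IsRealisation.lower_gen, quantumAction_f, Module.End.mul_apply, hd]
    refine LinearMap.congr_fun (f := lowerOp Y (B) (ND.words.gen i) ∘ₗ
      lowerOp Y (B) d) (TensorProduct.ext' fun x z => ?_) m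
    simp [mul_assoc]
  | add x y hx hy =>
    rw [map_add, map_add, LinearMap.add_apply, hx, hy]
    exact LinearMap.congr_fun (f := lowerOp Y B x + lowerOp Y B y)
      (g := lowerOp Y B (x + y)) (TensorProduct.ext' fun d z => by
      simp [add_mul, TensorProduct.add_tmul]) m
  | smul a x hx =>
    rw [map_smul, map_smul, LinearMap.smul_apply, hx]
    exact LinearMap.congr_fun (f := a • lowerOp Y B x)
      (g := lowerOp Y B (a • x)) (TensorProduct.ext' fun d z => by
      simp [TensorProduct.smul_tmul']) m

/-- The product `mulU` is thereby expressed through an action of an associative algebra, which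
replaces a direct proof of its associativity. -/
theorem action_triangular
    (x m : D ⊗[k] (AddMonoidAlgebra k Y ⊗[k] B)) :
    quantumAction T ND NB (quantumTriangular T ND NB x) m = (lusztigInput T ND NB).mulU (x ⊗ₜ m) := by
  refine LinearMap.congr_fun (f := LinearMap.applyₗ m ∘ₗ (quantumAction T ND NB).toLinearMap ∘ₗ
      quantumTriangular T ND NB) (g := (lusztigInput T ND NB).mulU ∘ₗ (TensorProduct.mk k _ _).flip m)
    (triple_ext fun d μ b => ?_) x
  simp only [LinearMap.comp_apply, LinearMap.applyₗ_apply_apply, AlgHom.toLinearMap_apply,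
    LinearMap.flip_apply, TensorProduct.mk_apply, IsRealisation.triangular_tmul, map_mul,
    IsRealisation.torus_single, Module.End.mul_apply, action_upper, action_lower, quantumAction_K,
    mulU_tmul]

/-- On `1 ⊗ 1 ⊗ 1` the derivations in `crossOp` vanish, so `B`, then the torus, then `D` fill the
three factors in turn. This shows that the triangular map is injective. -/
theorem action_triangular_one
    (x : D ⊗[k] (AddMonoidAlgebra k Y ⊗[k] B)) :
    quantumAction T ND NB (quantumTriangular T ND NB x) (1 ⊗ₜ (1 ⊗ₜ 1)) = x := by
  refine LinearMap.congr_fun (f := LinearMap.applyₗ (1 ⊗ₜ (1 ⊗ₜ 1)) ∘ₗ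
    (quantumAction T ND NB).toLinearMap ∘ₗ quantumTriangular T ND NB) (g := LinearMap.id)
    (triple_ext fun d μ b => ?_) x
  simp only [LinearMap.comp_apply, LinearMap.applyₗ_apply_apply, AlgHom.toLinearMap_apply,
    LinearMap.id_apply, IsRealisation.triangular_tmul, map_mul,
    IsRealisation.torus_single, Module.End.mul_apply, action_upper_one, action_lower,
    quantumAction_K]
  rw [AddMonoidAlgebra.one_def, torusOp_tmul]
  simp

/-- The triangular decomposition of `U_q(g)`. -/
def quantumTriangularEquiv :
    D ⊗[k] (AddMonoidAlgebra k Y ⊗[k] B) ≃ₗ[k] QuantumGroup T q :=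
  LinearEquiv.ofLinearMap (quantumTriangular T ND NB)
    -- The inverse lets an element of `U_q(g)` act on `1 ⊗ 1 ⊗ 1`.
    (LinearMap.applyₗ (1 ⊗ₜ (1 ⊗ₜ 1)) ∘ₗ (quantumAction T ND NB).toLinearMap)
    (LinearMap.ext fun u => (triangular_action T ND NB u _).trans (by simp))
    (LinearMap.ext fun x => action_triangular_one T ND NB x)

theorem quantumTriangularEquiv_tmul (d : D) (g : AddMonoidAlgebra k Y)
    (b : B) : quantumTriangularEquiv T ND NB (d ⊗ₜ (g ⊗ₜ b)) =
      quantumLower T ND d *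
        ((uq_isRealisation (T := T) (q := q)).torus g * quantumUpper T NB b) :=
  IsRealisation.triangular_tmul _ _ _ _ _ _

theorem comul_upper (b : B) : uqComul T q (quantumUpper T NB b) =
    (uq_isRealisation (T := T) (q := q)).upperTensor NB
      (NB.words.comul b) := by
  obtain ⟨b, rfl⟩ := NB.surjective b
  rw [IsRealisation.upper_π, algHom_lift]
  simp only [uqComul_e]
  exact IsRealisation.lift_tensor_e _ _ b

theorem comul_lower (d : D) : uqComul T q (quantumLower T ND d) =
    (uq_isRealisation (T := T) (q := q)).lowerTensor ND
      (ND.words.comulBar T d) := by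
  obtain ⟨d, rfl⟩ := ND.surjective d
  rw [IsRealisation.lower_π, algHom_lift]
  simp only [uqComul_f]
  exact IsRealisation.lift_tensor_f _ _ d

theorem comulHB_eq (μ : Y) (b : B) : (lusztigInput T ND NB).comulHB
    (AddMonoidAlgebra.single μ 1 ⊗ₜ b) = LinearMap.lTensor _
      (LinearMap.rTensor _ (LinearMap.mul' k _) ∘ₗ (TensorProduct.assoc k _ _ _).symm.toLinearMap)
      (TensorProduct.tensorTensorTensorComm k _ _ _ _
        ((AddMonoidAlgebra.single μ (1 : k) ⊗ₜ AddMonoidAlgebra.single μ (1 : k)) ⊗ₜ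
        NB.words.stretchL T (NB.words.comul b))) := by
  have h : (lusztigInput T ND NB).comulHB (AddMonoidAlgebra.single μ 1 ⊗ₜ b) = LinearMap.lTensor _
      (LinearMap.rTensor _ (LinearMap.mul' k _) ∘ₗ (TensorProduct.assoc k _ _ _).symm.toLinearMap)
      (TensorProduct.tensorTensorTensorComm k _ _ _ _
        (Coalgebra.comul (R := k) (AddMonoidAlgebra.single μ (1 : k)) ⊗ₜ
        NB.words.stretchL T (NB.words.comul b))) := rfl
  rw [h]
  simp

theorem comulC_eq (d : D) : (lusztigInput T ND NB).comulC d =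
    ND.words.stretchR T (ND.words.comulBar T d) := rfl

/-- Only associativity in `U ⊗ U` is used here: the coproducts of the three tensor factors are
multiplied and regrouped in the pattern of `comulU`. -/
theorem tensor_mul_eq (μ : Y) (z : (D ⊗[k] AddMonoidAlgebra k Y) ⊗[k] D)
    (y : B ⊗[k] (AddMonoidAlgebra k Y ⊗[k] B)) :
    TensorProduct.map (LinearMap.mul' k _ ∘ₗ TensorProduct.map (quantumLower T ND).toLinearMap
        (uq_isRealisation (T := T) (q := q)).torus.toLinearMap) (quantumLower T ND).toLinearMap z *
      (uqK T q μ ⊗ₜ uqK T q μ * TensorProduct.map (quantumUpper T NB).toLinearMap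
        (LinearMap.mul' k _ ∘ₗ TensorProduct.map
          (uq_isRealisation (T := T) (q := q)).torus.toLinearMap
          (quantumUpper T NB).toLinearMap) y) =
    TensorProduct.map (quantumTriangular T ND NB) (quantumTriangular T ND NB)
      (LinearMap.rTensor _ (LinearMap.lTensor _ (LinearMap.rTensor _ (LinearMap.mul' k _)
          ∘ₗ (TensorProduct.assoc k _ _ _).symm.toLinearMap)
        ∘ₗ (TensorProduct.assoc k _ _ _).toLinearMap)
        (TensorProduct.tensorTensorTensorComm k _ _ _ _ (z ⊗ₜ LinearMap.lTensor _
          (LinearMap.rTensor _ (LinearMap.mul' k _) ∘ₗ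
            (TensorProduct.assoc k _ _ _).symm.toLinearMap)
          (TensorProduct.tensorTensorTensorComm k _ _ _ _
            ((AddMonoidAlgebra.single μ (1 : k) ⊗ₜ AddMonoidAlgebra.single μ (1 : k)) ⊗ₜ y))))) := by
  induction z with
  | zero => simp
  | add z w hz hw => simp only [map_add, add_mul, TensorProduct.add_tmul, hz, hw]
  | tmul z d =>
    induction y with
    | zero => simp
    | add y w hy hw => simp only [map_add, mul_add, TensorProduct.tmul_add, hy, hw]
    | tmul b y =>
      induction z with
      | zero => simp
      | add z w hz hw => simp only [map_add, add_mul, TensorProduct.add_tmul, hz, hw]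
      | tmul c g =>
        induction y with
        | zero => simp
        | add y w hy hw => simp only [map_add, mul_add, TensorProduct.tmul_add, hy, hw]
        | tmul g' b' => simp [mul_assoc]

theorem quantum_isDoubleBosonisation :
    (lusztigInput T ND NB).IsDoubleBosonisation (quantumTriangularEquiv T ND NB) where
  one := by simp [quantumTriangularEquiv_tmul]
  mul x y := by
    -- Acting by the image of `x` on `y` is `mulU`, and the triangular map turns this action into
    -- the product of the images.
    have h := triangular_action T ND NB (quantumTriangular T ND NB x) y
    rw [action_triangular] at h
    exact h.symm
  comul x := by
    refine LinearMap.congr_fun (f := (uqComul T q).toLinearMap ∘ₗ quantumTriangular T ND NB)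
      (g := TensorProduct.map (quantumTriangular T ND NB) (quantumTriangular T ND NB) ∘ₗ
        (lusztigInput T ND NB).comulU) (triple_ext fun d μ b => ?_) x
    simp only [LinearMap.comp_apply, AlgHom.toLinearMap_apply, IsRealisation.triangular_tmul,
      IsRealisation.torus_single, map_mul, comul_lower, comul_upper, uqComul_K,
      DoubleInput.comulU, TensorProduct.map_tmul, LinearEquiv.coe_coe, comulHB_eq, comulC_eq]
    exact tensor_mul_eq T ND NB μ _ _
  counit x := by
    refine LinearMap.congr_fun (f := (uqCounit T q).toLinearMap ∘ₗ quantumTriangular T ND NB)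
      (g := (lusztigInput T ND NB).counitU) (triple_ext fun d μ b => ?_) x
    have h1 : (uqCounit T q).comp (quantumUpper T NB) = NB.words.counit :=
      NB.words.algHom_ext fun i => by simp [BraidedWords.counit_gen]
    have h2 : (uqCounit T q).comp (quantumLower T ND) = ND.words.counit :=
      ND.words.algHom_ext fun i => by simp [BraidedWords.counit_gen]
    have h3 : (lusztigInput T ND NB).counitU (d ⊗ₜ (AddMonoidAlgebra.single μ 1 ⊗ₜ b)) =
        ND.words.counit d * (Coalgebra.counit (R := k) (AddMonoidAlgebra.single μ (1 : k))
          * NB.words.counit b) := rfl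
    rw [h3, ← h1, ← h2]
    simp

theorem quantum_isLusztigInput (q : kˣ) : IsLusztigInput T (q : k) (lusztigInput T (nicholsD C q) (nicholsB C q)) where
  pair μ i := (groupPair_single T q μ ▸ weightChar_gElt T μ i : _)
  R i := by
    change groupHom k T.tildeHom (gElt k i) = _
    simp
  Rbar i := by
    change groupHom k (-T.tildeHom) (gElt k i) = _
    simp
  coactB i := (nicholsB C q).words.coact_gen i
  comulB i := (nicholsB C q).words.comul_gen i
  counitB i := (nicholsB C q).words.counit_gen i
  antipodeB i := (nicholsB C q).words.antipode_gen i
  coactD i := ((nicholsD C q).words.isWt_gen i).coactR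
  comulD i := (nicholsD C q).words.comul_gen i
  counitD i := (nicholsD C q).words.counit_gen i
  antipodeD i := (nicholsD C q).words.antipode_gen i
  ev_gen i j := ev_gen_gen (nicholsD C q) (nicholsB C q) i j
  ev_mk x b := (nicholsD C q).ev_π (nicholsB C q) x b
  ev_nondegenerate_left d h := (nicholsD C q).eq_zero_of_ev (nicholsB C q) d h
  ev_nondegenerate_right b h := (nicholsB C q).eq_zero_of_ev (nicholsD C q) b fun d => by
    rw [Nichols.ev_symm]; exact h d

theorem quantumEquiv_E (q : kˣ) (i : I) :
    quantumEquiv T q (uqGen T (q : k) (.E i)) = -uqE T q i := (neg_neg _).symm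

theorem quantumEquiv_F (q : kˣ) (i : I) :
    quantumEquiv T q (uqGen T (q : k) (.F i)) = uqF T q i := rfl

theorem quantumEquiv_K (q : kˣ) (μ : Y) :
    quantumEquiv T q (uqGen T (q : k) (.K μ)) = uqK T q (-μ) := by
  rw [uqK, neg_neg]; rfl

/-- The coproduct in terms of Lusztig's generators. -/
def lusztigComul (q : kˣ) : Uq T (q : k) →ₐ[k] Uq T (q : k) ⊗[k] Uq T (q : k) :=
  (Algebra.TensorProduct.map (quantumEquiv T q).symm.toAlgHom
    (quantumEquiv T q).symm.toAlgHom).comp ((uqComul T q).comp (quantumEquiv T q).toAlgHom)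

theorem map_lusztigComul (q : kˣ) (z : Uq T (q : k)) :
    TensorProduct.map (quantumEquiv T q).toLinearMap (quantumEquiv T q).toLinearMap
      (lusztigComul T q z) = uqComul T q (quantumEquiv T q z) := by
  change TensorProduct.map (quantumEquiv T q).toLinearMap (quantumEquiv T q).toLinearMap
    (TensorProduct.map (quantumEquiv T q).symm.toLinearMap (quantumEquiv T q).symm.toLinearMap
      (uqComul T q (quantumEquiv T q z))) = _
  generalize uqComul T q (quantumEquiv T q z) = w
  induction w with
  | zero => simp
  | add x y hx hy => simp only [map_add, hx, hy]
  | tmul x y => simp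

/-- The tensor square of an isomorphism is injective, so the formulas for Lusztig's generators may
be checked after transport. -/
theorem lusztigComul_eq (q : kˣ) (z : Uq T (q : k)) (w : Uq T (q : k) ⊗[k] Uq T (q : k))
    (h : uqComul T q (quantumEquiv T q z) =
      TensorProduct.map (quantumEquiv T q).toLinearMap (quantumEquiv T q).toLinearMap w) :
    lusztigComul T q z = w := by
  rw [← map_lusztigComul] at h
  exact (TensorProduct.congr (quantumEquiv T q).toLinearEquiv
    (quantumEquiv T q).toLinearEquiv).injective h

end Triangular
end DoubleBoson
end

/-! ### The theorem -/

theorem proposition4p3 {k : Type u} [Field k] {I : Type v} [DecidableEq I]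
    {Y : Type w} {X : Type x} [AddCommGroup Y] [AddCommGroup X]
    [Module.Free ℤ Y] [Module.Finite ℤ Y] [Module.Free ℤ X] [Module.Finite ℤ X]
    (C : LusztigCartanDatum I) (T : LusztigRootDatum C Y X)
    (q : k) (hq0 : q ≠ 0) (hq : ∀ i, q ^ C.dot i i ≠ 1) :
    -- `B` and `D` are copies of the algebra `f`
    (∃ φ : LusztigF C q ≃ₐ[k] QuotB C q, ∀ i, φ (genF C q i) = genB C q i) ∧
    (∃ φ : LusztigF C q ≃ₐ[k] QuotD C q, ∀ i, φ (genF C q i) = genD C q i) ∧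
    ∃ P : DoubleInput k (AddMonoidAlgebra k Y) (AddMonoidAlgebra k (I →₀ ℤ))
        (QuotD C q) (QuotB C q),
      IsLusztigInput T q P ∧
      -- the Hopf algebra `U(C̄, H, B)`
      ∃ (U : Type (max u v w)) (_ : Ring U) (_ : HopfAlgebra k U)
        (θ : QuotD C q ⊗[k] (AddMonoidAlgebra k Y ⊗[k] QuotB C q) ≃ₗ[k] U)
        (e f : I → U) (K : Y → U),
        P.IsDoubleBosonisation θ ∧
        (∀ i, e i = θ (1 ⊗ₜ (1 ⊗ₜ genB C q i))) ∧
        (∀ i, f i = θ (genD C q i ⊗ₜ (1 ⊗ₜ 1))) ∧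
        (∀ μ, K μ = θ (1 ⊗ₜ (grp k μ ⊗ₜ 1))) ∧
        -- relations
        K 0 = 1 ∧
        (∀ μ ν, K μ * K ν = K (μ + ν)) ∧
        (∀ μ i, e i * K μ = q ^ T.pairing μ (T.root i) • (K μ * e i)) ∧
        (∀ μ i, K μ * f i = q ^ T.pairing μ (T.root i) • (f i * K μ)) ∧
        (∀ i j, e i * f j - f j * e i =
          if i = j then (C.qi q i - (C.qi q i)⁻¹)⁻¹ • (K (T.tilde i) - K (-T.tilde i)) else 0) ∧
        -- coproducts and counits
        (∀ i, Coalgebra.comul (R := k) (e i) = e i ⊗ₜ K (T.tilde i) + 1 ⊗ₜ e i) ∧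
        (∀ i, Coalgebra.comul (R := k) (f i) = f i ⊗ₜ 1 + K (-T.tilde i) ⊗ₜ f i) ∧
        (∀ μ, Coalgebra.comul (R := k) (K μ) = K μ ⊗ₜ K μ) ∧
        (∀ i, Coalgebra.counit (R := k) (e i) = 0) ∧
        (∀ i, Coalgebra.counit (R := k) (f i) = 0) ∧
        (∀ μ, Coalgebra.counit (R := k) (K μ) = 1) ∧
        -- the identification with `U_q(g)`, as algebras and for the right-handed coproduct
        ∃ (Φ : Uq T q ≃ₐ[k] U) (Δ : Uq T q →ₐ[k] Uq T q ⊗[k] Uq T q),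
          (∀ i, Φ (uqGen T q (.E i)) = -e i) ∧
          (∀ i, Φ (uqGen T q (.F i)) = f i) ∧
          (∀ μ, Φ (uqGen T q (.K μ)) = K (-μ)) ∧
          (∀ i, Δ (uqGen T q (.E i)) =
            uqGen T q (.E i) ⊗ₜ uqGen T q (.K (-T.tilde i)) + 1 ⊗ₜ uqGen T q (.E i)) ∧
          (∀ i, Δ (uqGen T q (.F i)) =
            uqGen T q (.F i) ⊗ₜ 1 + uqGen T q (.K (T.tilde i)) ⊗ₜ uqGen T q (.F i)) ∧
          (∀ μ, Δ (uqGen T q (.K μ)) = uqGen T q (.K μ) ⊗ₜ uqGen T q (.K μ)) ∧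
          (∀ z, Coalgebra.comul (R := k) (Φ z) =
            TensorProduct.map Φ.toLinearMap Φ.toLinearMap (Δ z)) := by
  obtain ⟨q, rfl⟩ : ∃ s : kˣ, (s : k) = q := ⟨Units.mk0 q hq0, rfl⟩
  have g := uq_isRealisation (T := T) (q := q)
  -- `U` is `U_q(g)` itself and `Φ` is the identity map; the signs in `E_i ↦ -e_i` and `K_μ ↦
  -- K_{-μ}` come from the choice of `uqE` and `uqK`.
  refine ⟨⟨(nicholsF C q).equiv (nicholsB C q), fun i => Nichols.equiv_π _ _ _⟩,
    ⟨(nicholsF C q).equiv (nicholsD C q), fun i => Nichols.equiv_π _ _ _⟩,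
    lusztigInput T (nicholsD C q) (nicholsB C q), quantum_isLusztigInput T q, QuantumGroup T q, inferInstance, uqHopf T q,
    quantumTriangularEquiv T (nicholsD C q) (nicholsB C q), uqE T q, uqF T q, uqK T q, quantum_isDoubleBosonisation T (nicholsD C q) (nicholsB C q),
    ?_, ?_, ?_, g.K_zero, g.K_add, g.e_K, g.K_f, g.e_f, uqComul_e T q, uqComul_f T q,
    uqComul_K T q, uqCounit_e T q, uqCounit_f T q, uqCounit_K T q, quantumEquiv T q,
    lusztigComul T q, quantumEquiv_E T q, quantumEquiv_F T q, quantumEquiv_K T q, fun i => ?_,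
    fun i => ?_, fun μ => ?_, fun z => (map_lusztigComul T q z).symm⟩
  · intro i
    rw [quantumTriangularEquiv_tmul, map_one, map_one, one_mul, one_mul]
    exact (IsRealisation.upper_gen _ _ i).symm
  · intro i
    rw [quantumTriangularEquiv_tmul, map_one, map_one, mul_one, mul_one]
    exact (IsRealisation.lower_gen _ _ i).symm
  · intro μ
    rw [quantumTriangularEquiv_tmul, map_one, map_one, one_mul, mul_one]
    exact (IsRealisation.torus_single _ μ).symm
  · apply lusztigComul_eq
    rw [quantumEquiv_E, map_neg, uqComul_e, map_add, TensorProduct.map_tmul, TensorProduct.map_tmul]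
    simp only [AlgEquiv.toLinearMap_apply, quantumEquiv_E, quantumEquiv_K, neg_neg, map_one,
      TensorProduct.neg_tmul, TensorProduct.tmul_neg, neg_add]
  · apply lusztigComul_eq
    rw [quantumEquiv_F, uqComul_f, map_add, TensorProduct.map_tmul, TensorProduct.map_tmul]
    simp only [AlgEquiv.toLinearMap_apply, quantumEquiv_F, quantumEquiv_K, map_one]
  · apply lusztigComul_eq
    rw [quantumEquiv_K, uqComul_K, TensorProduct.map_tmul]
    simp only [AlgEquiv.toLinearMap_apply, quantumEquiv_K]
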